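/- Let $\Gamma=\mathrm{Gal}(\mathbb C/\mathbb R)$, let $T$ be a complex algebraic torus, and let ${}^\vee T$ be the dual torus, so that $X_*({}^\vee T)=X^*(T)$ and $X^*({}^\vee T)=X_*(T)$. *Groups.* Let $(T^\Gamma,\mathcal W)$ be an extended group for $T$: an extension of $\Gamma$ by $T$ in which the elements outside $T$ act on $T$ by an antiholomorphic automorphism $\sigma$, together with the $T$-conjugacy class $\mathcal W$ of a strong real form (an element $\delta\in T^\Gamma-T$ such that $\delta^2$ is central of finite order). Write $a$ for the involution of $X_*(T)$ given by $(a\mu)(w)=\sigma(\mu(\bar w))$. Let $({}^\vee T^\Gamma,\mathcal D)$ be an E-group for $T^\Gamma$ with second invariant $z$: an algebraic extension of $\Gamma$ by ${}^\vee T$ in which the elements outside ${}^\vee T$ act on $X_*({}^\vee T)=X^*(T)$ by the transpose $\theta$ of $a$, with a ${}^\vee T$-conjugacy class $\mathcal D$ of elements of finite order outside ${}^\vee T$, and $z=d^2$ for $d\in\mathcal D$. *Representations.* Let $T^{can}$ be the projective limit of the connected finite covers of $T$ to which $\sigma$ lifts and acts by inversion on the covering group, and let $T(\mathbb R,\delta)^{can}$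 be the preimage of $T(\mathbb R,\delta)=T^{\mathrm{Int}(\delta)}$. Consider the pairs $(\pi,\delta)$ with $\delta$ a strong real form and $\pi$ a quasicharacter of $T(\mathbb R,\delta)^{can}$ whose restriction to $\pi_1(T)^{can}$ is the character defined by $z$, that is, which on the image of $\pi_1(T)=X_*(T)$ is $m\mapsto m(z)$; they are taken up to $T$-conjugacy. Let $Q=\pi_1({}^\vee T)^{alg}/K$, where $K$ is a closed subgroup of the algebraic fundamental group $\pi_1({}^\vee T)^{alg}=\ker({}^\vee T^{alg}\to{}^\vee T)$ and ${}^\vee T^{alg}$ is the projective limit of all connected finite covers of ${}^\vee T$. Then $X^*({}^\vee T^{alg})=X_*(T)\otimes\mathbb Q$. Identify $\hat Q$ with the group $J$ of the elements $\exp(2\pi i c)\in T$, where $c\in X_*(T)\otimes\mathbb Q$ is trivial on $K$ as a character of ${}^\vee T^{alg}$. Let $\Pi^z(T/\mathbb R)_{\hat Q}$ be the set of classes of such $(\pi,\delta)$ with $\delta^2\in\delta_0^2J$ for $\delta_0\in\mathcal W$. *Parameters.* Let $\Xi^z({}^\vee T^\Gamma)^Q$ be the set of ${}^\vee T$-conjugacy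 classes of pairs $((y,\lambda),\tau)$ with $y\in{}^\vee T^\Gamma-{}^\vee T$, $\lambda\in{}^\vee\mathfrak t$, $y^2=\exp(2\pi i\lambda)$, and $\tau$ a continuous character of the component group of the preimage, in ${}^\vee T^{alg}/K$, of the centralizer of $y$ in ${}^\vee T$. *Correspondence.* Let $(\pi,\delta)\leftrightarrow((y,\lambda),\tau)$ under LLC if both of the following hold. 1. For some $d\in\mathcal D$ and $X\in{}^\vee\mathfrak t$ with $\exp(-\pi i\lambda)\,y=\exp(2\pi iX)\,d$, the differential of $\pi$ is $\lambda\in{}^\vee\mathfrak t=\mathfrak t^*$, and $\pi$ restricts to the maximal compact subgroup (more precisely, at the image in $T^{can}$ of $2\pi i v$, for $v\in X_*(T)\otimes\mathbb R$ with $\exp(2\pi iv)\in T(\mathbb R,\delta)$) as $\exp(2\pi i v)\mapsto e^{2\pi i\langle\nu,v\rangle}$, where $\nu=\tfrac12(\lambda-\theta\lambda)-(X+\theta X)$. 2. There are $\delta_0\in\mathcal W$ and $\mu\in X_*(T)\otimes\mathbb Q$ with $-a\mu=\mu$ such that $\delta$ is $T$-conjugate to $\exp(\pi i\mu)\delta_0$,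 and $\tau$ is the restriction of $\mu\in X_*(T)\otimes\mathbb Q=X^*({}^\vee T^{alg})$. *Automorphisms.* Let $\vartheta^\Gamma$ be an automorphism of the group $T^\Gamma$ which preserves $\mathcal W$ and whose restriction $\vartheta$ to $T$ is an algebraic automorphism of $T$. Let ${}^\vee\vartheta^\Gamma$ be an algebraic automorphism of ${}^\vee T^\Gamma$ which preserves $\mathcal D$, with restriction ${}^\vee\vartheta$ to ${}^\vee T$. Suppose that they are compatible, that is, ${}^\vee\vartheta\circ\nu=\nu\circ\vartheta$ for all $\nu\in X_*({}^\vee T)=X^*(T)$. Suppose that $K$ is stable under the lift of ${}^\vee\vartheta$ to ${}^\vee T^{alg}$. **Theorem.** LLC is a bijection $$\Pi^z(T/\mathbb R)_{\hat Q}\longleftrightarrow\Xi^z({}^\vee T^\Gamma)^Q,$$ the actions below preserve both sides, and the bijection is $\vartheta^\Gamma$-equivariant: if $(\pi,\delta)\leftrightarrow((y,\lambda),\tau)$, then $$(\pi\circ\vartheta,\ (\vartheta^\Gamma)^{-1}(\delta))\ \leftrightarrow\ \big(({}^\vee\vartheta^\Gamma(y),\ d\,{}^\vee\vartheta(\lambda)),\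 \tau\circ{}^\vee\vartheta^{-1}\big),$$ where $\vartheta$ and ${}^\vee\vartheta$ also denote the lifts to $T^{can}$ and ${}^\vee T^{alg}$. -/

import Mathlib

open scoped Matrix

noncomputable section

namespace RealTori

/-! ### Complex algebraic tori -/

/-- The complex algebraic torus of rank `n`, in coordinates: `T = (ℂˣ)ⁿ`. Its cocharacter lattice
`X_*(T)` and its character lattice `X^*(T)` are `ℤⁿ`, with the standard pairing, and its Lie algebra
`X_*(T) ⊗ ℂ` is `ℂⁿ`. The dual torus has `X_*` and `X^*` exchanged; in the dual coordinates it is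
again `(ℂˣ)ⁿ`, with `X_*` of the one torus equal to `X^*` of the other. -/
abbrev Torus (n : ℕ) : Type := Fin n → ℂˣ

/-- The exponential map `ℂⁿ → (ℂˣ)ⁿ` from the Lie algebra. -/
def texp {n : ℕ} (v : Fin n → ℂ) : Torus n :=
  fun i => Units.mk0 (Complex.exp (v i)) (Complex.exp_ne_zero _)

/-- `v ↦ exp (2 π i v)`; its kernel is `X_*(T) = ℤⁿ`. -/
def texp2 {n : ℕ} (v : Fin n → ℂ) : Torus n :=
  texp ((2 * (Real.pi : ℂ) * Complex.I) • v)

/-- The algebraic endomorphism of `(ℂˣ)ⁿ` which induces the integral matrix `A` on `X_*(T) = ℤⁿ`.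
Every algebraic endomorphism of `(ℂˣ)ⁿ` is of this form; the automorphisms are those with `A`
invertible. -/
def powMap {n : ℕ} (A : Matrix (Fin n) (Fin n) ℤ) : Torus n →* Torus n where
  toFun t := fun i => ∏ j, t j ^ A i j
  map_one' := by ext i; simp
  map_mul' s t := by
    funext i
    simp [mul_zpow, Finset.prod_mul_distrib]

/-- Complex conjugation on the coordinates of the torus. -/
def conjTorus {n : ℕ} : Torus n →* Torus n where
  toFun t := fun i => Units.map (starRingEnd ℂ : ℂ →* ℂ) (t i)
  map_one' := by ext i; simp
  map_mul' s t := by ext i; simp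

/-- The antiholomorphic endomorphism of `T = (ℂˣ)ⁿ` attached to the integral matrix `a`. On a
cocharacter `μ : ℂˣ → T` the matrix `a` acts by sending it to `z ↦ σ (μ (conj z))`. -/
def antiMap {n : ℕ} (a : Matrix (Fin n) (Fin n) ℤ) : Torus n →* Torus n :=
  conjTorus.comp (powMap a)

/-- The action of an integral matrix on the Lie algebra `ℂⁿ`. -/
def act {n : ℕ} (A : Matrix (Fin n) (Fin n) ℤ) (v : Fin n → ℂ) : Fin n → ℂ :=
  (A.map (Int.cast : ℤ → ℂ)) *ᵥ v

/-- The inclusion `ℤⁿ → ℂⁿ`. -/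
def intCastHom (n : ℕ) : (Fin n → ℤ) →+ (Fin n → ℂ) where
  toFun m := fun i => (m i : ℂ)
  map_zero' := by ext i; simp
  map_add' x y := by ext i; simp

/-- An integral matrix as an endomorphism of `ℤⁿ`. -/
def intAct {n : ℕ} (A : Matrix (Fin n) (Fin n) ℤ) : (Fin n → ℤ) →+ (Fin n → ℤ) :=
  A.mulVecLin.toAddMonoidHom

/-- A matrix as an additive endomorphism of `ℂⁿ`. -/
def actHom {n : ℕ} (A : Matrix (Fin n) (Fin n) ℤ) : (Fin n → ℂ) →+ (Fin n → ℂ) where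
  toFun := act A
  map_zero' := by simp [act]
  map_add' x y := by simp [act, Matrix.mulVec_add]

theorem act_intCast {n : ℕ} (A : Matrix (Fin n) (Fin n) ℤ) (m : Fin n → ℤ) :
    act A (intCastHom n m) = intCastHom n (intAct A m) := by
  ext i
  simp [act, intCastHom, intAct, Matrix.mulVec, dotProduct]

theorem act_act {n : ℕ} (A B : Matrix (Fin n) (Fin n) ℤ) (v : Fin n → ℂ) :
    act A (act B v) = act (A * B) v := by
  simp only [act, Matrix.mulVec_mulVec]
  congr 1
  ext i j
  simp [Matrix.mul_apply]

theorem powMap_powMap {n : ℕ} (A B : Matrix (Fin n) (Fin n) ℤ) (t : Torus n) :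
    powMap A (powMap B t) = powMap (A * B) t := by
  funext i
  simp only [powMap, MonoidHom.coe_mk, OneHom.coe_mk, Matrix.mul_apply]
  have h1 : ∀ j, (∏ k, t k ^ B j k) ^ A i j = ∏ k, t k ^ (B j k * A i j) := by
    intro j
    rw [← Finset.prod_zpow]
    exact Finset.prod_congr rfl fun k _ => (zpow_mul _ _ _).symm
  rw [Finset.prod_congr rfl fun j _ => h1 j, Finset.prod_comm]
  refine Finset.prod_congr rfl fun k _ => ?_
  have h2 : ∀ (s : Finset (Fin n)) (u : ℂˣ) (f : Fin n → ℤ),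
      ∏ j ∈ s, u ^ f j = u ^ ∑ j ∈ s, f j := by
    intro s u f
    classical
    induction s using Finset.induction_on with
    | empty => simp
    | insert j s hj ih => rw [Finset.prod_insert hj, Finset.sum_insert hj, ih, zpow_add]
  rw [h2]
  congr 1
  exact Finset.sum_congr rfl fun j _ => mul_comm _ _

theorem powMap_one {n : ℕ} (t : Torus n) : powMap 1 t = t := by
  funext i
  simp [powMap, Matrix.one_apply]

theorem powMap_conj {n : ℕ} (A : Matrix (Fin n) (Fin n) ℤ) (t : Torus n) :
    powMap A (conjTorus t) = conjTorus (powMap A t) := by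
  funext i
  simp [powMap, conjTorus, map_prod, map_zpow]

theorem powMap_injective {n : ℕ} {A B : Matrix (Fin n) (Fin n) ℤ}
    (h : ∀ t : Torus n, powMap A t = powMap B t) : A = B := by
  ext i j
  have h2 := congrFun (h (Function.update 1 j (Units.mk0 (2 : ℂ) two_ne_zero))) i
  have key : ∀ C : Matrix (Fin n) (Fin n) ℤ,
      powMap C (Function.update 1 j (Units.mk0 (2 : ℂ) two_ne_zero)) i
        = (Units.mk0 (2 : ℂ) two_ne_zero) ^ C i j := by
    intro C
    simp only [powMap, MonoidHom.coe_mk, OneHom.coe_mk]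
    rw [Finset.prod_eq_single j]
    · simp
    · intro k _ hk
      simp [Function.update_of_ne hk]
    · simp
  rw [key, key] at h2
  have h3 : ((2 : ℝ)) ^ A i j = (2 : ℝ) ^ B i j := by
    have := congrArg (fun u : ℂˣ => ‖(u : ℂ)‖) h2
    simpa using this
  exact zpow_right_injective₀ (by norm_num) (by norm_num) h3

theorem antiMap_injective {n : ℕ} {a b : Matrix (Fin n) (Fin n) ℤ}
    (h : ∀ t : Torus n, antiMap a t = antiMap b t) : a = b := by
  apply powMap_injective
  intro t
  have h2 := congrArg conjTorus (h t)
  have cc : ∀ s : Torus n, conjTorus (conjTorus s) = s := by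
    intro s
    ext i
    simp [conjTorus]
  simpa [antiMap, cc] using h2

/-! ### Projective limits of finite covers -/

/-- Connected finite covers of `T = ℂⁿ / ℤⁿ` (via `v ↦ exp (2 π i v)`) correspond to the subgroups
`L` of finite index of `π₁(T) = ℤⁿ`. -/
abbrev Lattice (n : ℕ) : Type := AddSubgroup (Fin n → ℤ)

/-- The cover `ℂⁿ / L` of `T = ℂⁿ / ℤⁿ`, written additively. -/
abbrev FiniteCover {n : ℕ} (L : Lattice n) : Type := (Fin n → ℂ) ⧸ (L.map (intCastHom n))

/-- The projection from `ℂⁿ / L` to `ℂⁿ / L'` for `L ⊆ L'`. -/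
def coverMap {n : ℕ} {L L' : Lattice n} (h : L ≤ L') : FiniteCover L →+ FiniteCover L' :=
  QuotientAddGroup.map _ _ (AddMonoidHom.id _) (AddSubgroup.map_mono h)

/-- The projective limit of the covers attached to the lattices in `C`, with the topology of the
projective limit. -/
def proCover {n : ℕ} (C : Set (Lattice n)) : AddSubgroup (∀ L : C, FiniteCover L.1) where
  carrier := {x | ∀ (L L' : C) (h : L.1 ≤ L'.1), coverMap h (x L) = x L'}
  zero_mem' := by intro L L' h; simp
  add_mem' := by
    intro x y hx hy L L' h
    simp [hx L L' h, hy L L' h]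
  neg_mem' := by
    intro x hx L L' h
    simp [hx L L' h]

/-- The map from the Lie algebra `ℂⁿ` to the projective limit of covers. It lifts
`v ↦ exp (2 π i v)`. -/
def toPro {n : ℕ} (C : Set (Lattice n)) : (Fin n → ℂ) →+ proCover C where
  toFun v := ⟨fun _ => (QuotientAddGroup.mk v), by intro L L' h; rfl⟩
  map_zero' := rfl
  map_add' _ _ := rfl

theorem texp2_intCast {n : ℕ} (m : Fin n → ℤ) : texp2 (intCastHom n m) = 1 := by
  funext i
  ext
  simp only [texp2, texp, intCastHom, Pi.smul_apply, AddMonoidHom.coe_mk, ZeroHom.coe_mk,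
    smul_eq_mul, Units.val_mk0, Pi.one_apply, Units.val_one]
  rw [Complex.exp_eq_one_iff]
  exact ⟨m i, by ring⟩

theorem texp2_add {n : ℕ} (v w : Fin n → ℂ) : texp2 (v + w) = texp2 v * texp2 w := by
  funext i
  ext
  simp [texp2, texp, mul_add, Complex.exp_add]

/-- `v ↦ exp (2 π i v)` as a homomorphism. -/
def texp2Hom (n : ℕ) : (Fin n → ℂ) →+ Additive (Torus n) where
  toFun v := Additive.ofMul (texp2 v)
  map_zero' := by
    have := texp2_intCast (n := n) 0
    simpa using congrArg Additive.ofMul this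
  map_add' v w := by rw [texp2_add]; rfl

/-- The covering map `ℂⁿ / L → T`. -/
def coverProj {n : ℕ} (L : Lattice n) : FiniteCover L →+ Additive (Torus n) :=
  QuotientAddGroup.lift _ (texp2Hom n) (by
    rintro _ ⟨m, _, rfl⟩
    exact congrArg Additive.ofMul (texp2_intCast m))

/-- The projection of the projective limit to `T`, through any one of the covers. -/
def proProj {n : ℕ} {C : Set (Lattice n)} (L : C) : proCover C →+ Additive (Torus n) :=
  (coverProj L.1).comp ((Pi.evalAddMonoidHom _ L).comp (proCover C).subtype)

/-- The lift to finite covers of the endomorphism of `T` with matrix `A`. -/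
def coverLift {n : ℕ} (A : Matrix (Fin n) (Fin n) ℤ) (L : Lattice n) :
    FiniteCover (L.comap (intAct A)) →+ FiniteCover L :=
  QuotientAddGroup.map _ _ (actHom A) (by
    rintro _ ⟨m, hm, rfl⟩
    exact ⟨intAct A m, hm, (act_intCast A m).symm⟩)

/-- The lift to the projective limit of covers of the endomorphism of `T` with matrix `A`. -/
def proLift {n : ℕ} (C : Set (Lattice n)) (A : Matrix (Fin n) (Fin n) ℤ)
    (hA : ∀ L ∈ C, L.comap (intAct A) ∈ C) : proCover C →+ proCover C where
  toFun x := ⟨fun L => coverLift A L.1 (x.1 ⟨_, hA L.1 L.2⟩), by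
    intro L L' h
    have h2 := x.2 ⟨_, hA L.1 L.2⟩ ⟨_, hA L'.1 L'.2⟩ (AddSubgroup.comap_mono h)
    beta_reduce
    rw [← h2]
    generalize x.1 ⟨_, hA L.1 L.2⟩ = u
    induction u using QuotientAddGroup.induction_on with
    | H v => rfl⟩
  map_zero' := by
    apply Subtype.ext
    funext L
    exact map_zero _
  map_add' x y := by
    apply Subtype.ext
    funext L
    exact map_add _ _ _

theorem proLift_continuous {n : ℕ} (C : Set (Lattice n)) (A : Matrix (Fin n) (Fin n) ℤ)
    (hA : ∀ L ∈ C, L.comap (intAct A) ∈ C) : Continuous (proLift C A hA) := by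
  refine Continuous.subtype_mk (continuous_pi fun L => ?_) _
  have h1 : Continuous (coverLift A L.1) := by
    refine continuous_quot_lift _ ?_
    refine continuous_quot_mk.comp ?_
    exact (Continuous.matrix_mulVec continuous_const continuous_id)
  exact h1.comp ((continuous_apply _).comp continuous_subtype_val)

theorem proLift_inv {n : ℕ} (C : Set (Lattice n)) (A B : Matrix (Fin n) (Fin n) ℤ)
    (hA : ∀ L ∈ C, L.comap (intAct A) ∈ C) (hB : ∀ L ∈ C, L.comap (intAct B) ∈ C)
    (h : A * B = 1) (x : proCover C) : proLift C A hA (proLift C B hB x) = x := by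
  apply Subtype.ext
  funext L
  have hle : (L.1.comap (intAct A)).comap (intAct B) ≤ L.1 := by
    intro m hm
    have : intAct A (intAct B m) = m := by simp [intAct, h]
    simpa [this] using hm
  rw [← x.2 ⟨_, hB _ (hA L.1 L.2)⟩ L hle]
  change coverLift A L.1 (coverLift B _ (x.1 ⟨_, hB _ (hA L.1 L.2)⟩)) = _
  generalize x.1 ⟨_, hB _ (hA L.1 L.2)⟩ = u
  induction u using QuotientAddGroup.induction_on with
  | H v =>
    change (QuotientAddGroup.mk (act A (act B v)) : FiniteCover L.1) = QuotientAddGroup.mk v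
    rw [act_act, h]
    simp [act]

theorem texp2_act {n : ℕ} (A : Matrix (Fin n) (Fin n) ℤ) (v : Fin n → ℂ) :
    texp2 (act A v) = powMap A (texp2 v) := by
  funext i
  ext
  simp only [texp2, texp, act, powMap, MonoidHom.coe_mk, OneHom.coe_mk, Units.val_mk0,
    Pi.smul_apply, smul_eq_mul, Matrix.mulVec, dotProduct, Matrix.map_apply, Units.coe_prod,
    Units.val_zpow_eq_zpow_val]
  rw [Finset.mul_sum, Complex.exp_sum]
  refine Finset.prod_congr rfl fun j _ => ?_
  rw [← Complex.exp_int_mul]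
  congr 1
  ring

theorem coverProj_coverLift {n : ℕ} (A : Matrix (Fin n) (Fin n) ℤ) (L : Lattice n)
    (u : FiniteCover (L.comap (intAct A))) :
    (coverProj L (coverLift A L u)).toMul = powMap A (coverProj _ u).toMul := by
  induction u using QuotientAddGroup.induction_on with
  | H v => exact texp2_act A v

/-- The projection to `T` does not depend on the cover through which it is computed. -/
theorem proProj_eq {n : ℕ} {C : Set (Lattice n)} (L L' : C) (h : L.1 ≤ L'.1) (x : proCover C) :
    proProj L x = proProj L' x := by
  change coverProj L.1 (x.1 L) = coverProj L'.1 (x.1 L')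
  rw [← x.2 L L' h]
  generalize x.1 L = u
  induction u using QuotientAddGroup.induction_on with
  | H v => rfl

theorem proProj_lift {n : ℕ} {C : Set (Lattice n)} (A : Matrix (Fin n) (Fin n) ℤ)
    (hA : ∀ L ∈ C, L.comap (intAct A) ∈ C) (L : C) (hL : L.1 = ⊤) (x : proCover C) :
    (proProj L (proLift C A hA x)).toMul = powMap A (proProj L x).toMul := by
  rw [← proProj_eq ⟨_, hA L.1 L.2⟩ L (le_top.trans hL.ge) x]
  exact coverProj_coverLift A L.1 (x.1 ⟨_, hA L.1 L.2⟩)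

theorem finiteIndex_comap {n : ℕ} (A : Matrix (Fin n) (Fin n) ℤ) (L : Lattice n)
    (h : L.FiniteIndex) : (L.comap (intAct A)).FiniteIndex := by
  let f : (Fin n → ℤ) →+ (Fin n → ℤ) ⧸ L := (QuotientAddGroup.mk' L).comp (intAct A)
  have hf : L.comap (intAct A) = f.ker := by
    ext m
    simp [f, AddMonoidHom.mem_ker]
  have : Finite f.range := Finite.of_injective _ Subtype.val_injective
  rw [hf]
  exact AddSubgroup.finiteIndex_ker f

/-! ### The algebraic cover -/

/-- The index set of all connected finite covers. -/
def algLattices (n : ℕ) : Set (Lattice n) := {L | L.FiniteIndex}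

/-- The universal algebraic cover of the torus: the projective limit of all connected finite
covers. -/
abbrev AlgCover (n : ℕ) : Type := proCover (algLattices n)

def algTop (n : ℕ) : algLattices n := ⟨⊤, (inferInstance : (⊤ : Lattice n).FiniteIndex)⟩

/-- The covering homomorphism from the universal algebraic cover to the torus. -/
def algProj (n : ℕ) : AlgCover n →+ Additive (Torus n) := proProj (algTop n)

/-- The algebraic fundamental group. -/
def algPi1 (n : ℕ) : AddSubgroup (AlgCover n) := (algProj n).ker

/-- The quotient `∨T^Q` of the universal algebraic cover by a subgroup `K` of the algebraic
fundamental group, for `Q = π₁(∨T)^alg / K`. -/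
def QuotCover {n : ℕ} (K : AddSubgroup (AlgCover n)) : Type := AlgCover n ⧸ K

instance {n : ℕ} (K : AddSubgroup (AlgCover n)) : AddCommGroup (QuotCover K) :=
  inferInstanceAs (AddCommGroup (AlgCover n ⧸ K))

instance {n : ℕ} (K : AddSubgroup (AlgCover n)) : TopologicalSpace (QuotCover K) :=
  inferInstanceAs (TopologicalSpace (AlgCover n ⧸ K))

instance {n : ℕ} (K : AddSubgroup (AlgCover n)) : IsTopologicalAddGroup (QuotCover K) :=
  inferInstanceAs (IsTopologicalAddGroup (AlgCover n ⧸ K))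

/-- The quotient map from the universal algebraic cover. -/
def toQuotCover {n : ℕ} (K : AddSubgroup (AlgCover n)) : AlgCover n →+ QuotCover K :=
  QuotientAddGroup.mk' K

/-- The lift of an algebraic endomorphism to the universal algebraic cover. -/
def algLift {n : ℕ} (A : Matrix (Fin n) (Fin n) ℤ) : AlgCover n →+ AlgCover n :=
  proLift _ A fun L hL => finiteIndex_comap A L hL

theorem algProj_lift {n : ℕ} (A : Matrix (Fin n) (Fin n) ℤ) (x : AlgCover n) :
    (algProj n (algLift A x)).toMul = powMap A (algProj n x).toMul :=
  proProj_lift A _ (algTop n) rfl x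

/-- The largest lattice on which the rational vector `c` takes integral values. -/
def integralLattice {n : ℕ} (c : Fin n → ℚ) : Lattice n where
  carrier := {m | ∃ k : ℤ, c ⬝ᵥ (fun i => (m i : ℚ)) = k}
  zero_mem' := ⟨0, by simp [dotProduct]⟩
  add_mem' := by
    rintro x y ⟨k, hk⟩ ⟨l, hl⟩
    refine ⟨k + l, ?_⟩
    push_cast
    rw [← hk, ← hl]
    simp [dotProduct, mul_add, Finset.sum_add_distrib]
  neg_mem' := by
    rintro x ⟨k, hk⟩
    refine ⟨-k, ?_⟩
    push_cast
    rw [← hk]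
    simp [dotProduct]

theorem integralLattice_finiteIndex {n : ℕ} (c : Fin n → ℚ) :
    (integralLattice c).FiniteIndex := by
  classical
  set N : ℕ := ∏ i, (c i).den with hN
  have hN0 : N ≠ 0 := Finset.prod_ne_zero_iff.mpr fun i _ => (c i).den_nz
  have : NeZero N := ⟨hN0⟩
  let f : (Fin n → ℤ) →+ (Fin n → ZMod N) := (Int.castAddHom (ZMod N)).compLeft (Fin n)
  have : Finite f.range := Finite.of_injective _ Subtype.val_injective
  have : f.ker.FiniteIndex := AddSubgroup.finiteIndex_ker f
  refine AddSubgroup.finiteIndex_of_le (H := f.ker) ?_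
  intro m hm
  have hm' : ∀ i, (N : ℤ) ∣ m i := by
    intro i
    have := congrFun (AddMonoidHom.mem_ker.mp hm) i
    exact (ZMod.intCast_zmod_eq_zero_iff_dvd (m i) N).mp this
  have hi : ∀ i, ∃ k : ℤ, c i * (m i : ℚ) = k := by
    intro i
    obtain ⟨q, hq⟩ := hm' i
    obtain ⟨r, hr⟩ : (c i).den ∣ N := Finset.dvd_prod_of_mem _ (Finset.mem_univ i)
    refine ⟨(c i).num * r * q, ?_⟩
    rw [hq, hr]
    push_cast
    have := Rat.mul_den_eq_num (c i)
    rw [← this]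
    ring
  choose k hk using hi
  exact ⟨∑ i, k i, by simp [dotProduct, hk]⟩

/-- The inclusion `ℚⁿ → ℂⁿ`. -/
def ratVec {n : ℕ} (c : Fin n → ℚ) : Fin n → ℂ := fun i => (c i : ℂ)

/-- The algebraic character of the universal algebraic cover attached to a rational vector
`c ∈ X^* ⊗ ℚ`: it is `v ↦ exp (2 π i ⟨c, v⟩)` on a finite cover on which this makes sense. -/
def ratChar {n : ℕ} (c : Fin n → ℚ) (x : AlgCover n) : ℂ :=
  Quotient.liftOn' (x.1 ⟨integralLattice c, integralLattice_finiteIndex c⟩)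
    (fun v => Complex.exp (2 * (Real.pi : ℂ) * Complex.I * (ratVec c ⬝ᵥ v))) (by
      intro v w hvw
      obtain ⟨m, ⟨k, hk⟩, hm⟩ := QuotientAddGroup.leftRel_apply.mp hvw
      have hw : w = v + intCastHom n m := by rw [hm]; abel
      have hk' : ratVec c ⬝ᵥ intCastHom n m = (k : ℂ) := by
        have := congrArg (Rat.cast : ℚ → ℂ) hk
        simpa [dotProduct, ratVec, intCastHom] using this
      change Complex.exp _ = Complex.exp _
      rw [hw, dotProduct_add, hk', mul_add, Complex.exp_add]
      rw [show 2 * (Real.pi : ℂ) * Complex.I * (k : ℂ)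
        = (k : ℂ) * (2 * (Real.pi : ℂ) * Complex.I) by ring, Complex.exp_int_mul_two_pi_mul_I,
        mul_one])

/-! ### The canonical cover -/

/-- The distinguished finite covers, for the antiholomorphic involutions with matrix `a`: the
involution, which acts on the Lie algebra by `v ↦ - a (conj v)`, hence on `ℤⁿ` by `m ↦ - a m`,
lifts to the cover, and acts by inversion on the covering group `ℤⁿ / L`. -/
def canLattices {n : ℕ} (a : Matrix (Fin n) (Fin n) ℤ) : Set (Lattice n) :=
  {L | L.FiniteIndex ∧ (∀ m ∈ L, -(intAct a m) ∈ L) ∧ ∀ m, -(intAct a m) - (-m) ∈ L}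

/-- The canonical cover: the projective limit of the distinguished finite covers. -/
abbrev CanCover {n : ℕ} (a : Matrix (Fin n) (Fin n) ℤ) : Type := proCover (canLattices a)

def canTop {n : ℕ} (a : Matrix (Fin n) (Fin n) ℤ) : canLattices a :=
  ⟨⊤, (inferInstance : (⊤ : Lattice n).FiniteIndex), by simp, by simp⟩

/-- The covering homomorphism from the canonical cover to the torus. -/
def canProj {n : ℕ} (a : Matrix (Fin n) (Fin n) ℤ) : CanCover a →+ Additive (Torus n) :=
  proProj (canTop a)

theorem canLattices_comap {n : ℕ} {a A : Matrix (Fin n) (Fin n) ℤ} (h : A * a = a * A) :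
    ∀ L ∈ canLattices a, L.comap (intAct A) ∈ canLattices a := by
  have hc : ∀ m, intAct A (intAct a m) = intAct a (intAct A m) := by
    intro m
    simp [intAct, h]
  rintro L ⟨h1, h2, h3⟩
  refine ⟨finiteIndex_comap A L h1, ?_, ?_⟩
  · intro m hm
    have := h2 _ (AddSubgroup.mem_comap.mp hm)
    rw [AddSubgroup.mem_comap, map_neg, hc]
    exact this
  · intro m
    rw [AddSubgroup.mem_comap, map_sub, map_neg, map_neg, hc]
    exact h3 _

/-- The lift to the canonical cover of an algebraic endomorphism which commutes with `a`. -/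
def canLift {n : ℕ} {a A : Matrix (Fin n) (Fin n) ℤ} (h : A * a = a * A) :
    CanCover a →+ CanCover a :=
  proLift _ A (canLattices_comap h)

theorem canProj_lift {n : ℕ} {a A : Matrix (Fin n) (Fin n) ℤ} (hc : A * a = a * A)
    (x : CanCover a) :
    (canProj a (canLift hc x)).toMul = powMap A (canProj a x).toMul :=
  proProj_lift A _ (canTop a) rfl x

/-! ### Extended groups for a torus -/

/-- A weak extended group `T^Γ` containing `T = (ℂˣ)ⁿ`: an extension of `Γ = Gal(ℂ/ℝ)` by `T` in
which every element outside `T` acts on `T` by an antiholomorphic automorphism. As `T` is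
commutative, this automorphism is the same for all these elements; its matrix `a` on `X_*(T)` is the
first invariant. The Lie group structure is the one for which `T` is an open subgroup. -/
structure WeakExtendedGroup (n : ℕ) (E : Type*) [Group E] extends
    GroupExtension (Torus n) E Gal(ℂ/ℝ) where
  a : Matrix (Fin n) (Fin n) ℤ
  conj_eq : ∀ x : E, rightHom x ≠ 1 → ∀ t : Torus n, x * inl t * x⁻¹ = inl (antiMap a t)

/-- A strong real form: an element outside `T` whose square is central and of finite order. -/
def WeakExtendedGroup.IsStrongRealForm {n : ℕ} {E : Type*} [Group E]
    (S : WeakExtendedGroup n E) (δ : E) : Prop :=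
  S.rightHom δ ≠ 1 ∧ δ ^ 2 ∈ Subgroup.center E ∧ IsOfFinOrder (δ ^ 2)

/-- An extended group `(T^Γ, W)`. For a torus, the maximal unipotent subgroup and its character in
a Whittaker datum are trivial, so that the Whittaker datum is the `T`-conjugacy class `W` of a strong
real form. -/
structure ExtendedGroup (n : ℕ) (E : Type*) [Group E] extends WeakExtendedGroup n E where
  W : Set E
  exists_W : ∃ δ₀, toWeakExtendedGroup.IsStrongRealForm δ₀ ∧
    W = {x | ∃ t : Torus n, x = inl t * δ₀ * (inl t)⁻¹}

/-- An automorphism of the extended group `(T^Γ, W)`: a group automorphism whose restriction to `T`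
is an algebraic automorphism (with matrix `M` on `X_*(T)`), and which preserves `W`. -/
structure ExtendedGroup.Aut {n : ℕ} {E : Type*} [Group E] (S : ExtendedGroup n E) where
  toEquiv : E ≃* E
  M : GL (Fin n) ℤ
  restrict : ∀ t : Torus n, toEquiv (S.inl t) = S.inl (powMap M.1 t)
  image_W : toEquiv '' S.W = S.W

/-! ### E-groups for a torus -/

/-- An E-group `(∨T^Γ, D)`: an algebraic extension of `Γ` by the torus `∨T`, in which every element
outside `∨T` acts on `∨T` by an algebraic automorphism (the same for all these elements, with matrix
`θ` on `X_*(∨T)`), and a `∨T`-conjugacy class `D` of elements of finite order outside `∨T`. For a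
torus every automorphism preserves the splitting. -/
structure EGroup (n : ℕ) (E : Type*) [Group E] extends
    GroupExtension (Torus n) E Gal(ℂ/ℝ) where
  θ : Matrix (Fin n) (Fin n) ℤ
  conj_eq : ∀ x : E, rightHom x ≠ 1 → ∀ t : Torus n, x * inl t * x⁻¹ = inl (powMap θ t)
  D : Set E
  exists_D : ∃ d, rightHom d ≠ 1 ∧ IsOfFinOrder d ∧
    D = {x | ∃ t : Torus n, x = inl t * d * (inl t)⁻¹}

/-- `z` is the second invariant of the E-group. -/
def EGroup.IsSecondInvariant {n : ℕ} {E : Type*} [Group E] (S : EGroup n E) (z : Torus n) : Prop :=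
  ∀ d ∈ S.D, d ^ 2 = S.inl z

/-- The E-group is an E-group for the given extended group: the first invariants agree under the
identification of `X_*(∨T)` with `X^*(T)`. -/
def EGroup.IsFor {n : ℕ} {E E' : Type*} [Group E] [Group E'] (D : EGroup n E')
    (S : ExtendedGroup n E) : Prop :=
  D.θ = S.aᵀ

/-- An automorphism of the E-group `(∨T^Γ, D)`: an algebraic automorphism (with matrix `M` on
`X_*(∨T)`) which preserves `D`. -/
structure EGroup.Aut {n : ℕ} {E : Type*} [Group E] (S : EGroup n E) where
  toEquiv : E ≃* E
  M : GL (Fin n) ℤ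
  restrict : ∀ t : Torus n, toEquiv (S.inl t) = S.inl (powMap M.1 t)
  image_D : toEquiv '' S.D = S.D

/-- Compatibility: the automorphism of `∨T` is dual to that of `T`, that is, on
`X_*(∨T) = X^*(T)` it is `ν ↦ ν ∘ ϑ`. -/
def Compatible {n : ℕ} {E E' : Type*} [Group E] [Group E'] {S : ExtendedGroup n E}
    {D : EGroup n E'} (f : S.Aut) (f' : D.Aut) : Prop :=
  f'.M.1 = f.M.1ᵀ

/-! ### Canonical projective representations of strong real forms -/

namespace ExtendedGroup

variable {n : ℕ} {E : Type*} [Group E] (S : ExtendedGroup n E)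

theorem Aut.rightHom_ne {S : ExtendedGroup n E} (f : S.Aut) {x : E} (hx : S.rightHom x ≠ 1) :
    S.rightHom (f.toEquiv x) ≠ 1 := by
  intro h
  have h1 : f.toEquiv x ∈ S.inl.range := by
    rw [S.range_inl_eq_ker_rightHom]
    exact h
  obtain ⟨t, ht⟩ := h1
  have h2 : f.toEquiv x = f.toEquiv (S.inl (powMap f.M⁻¹.1 t)) := by
    rw [f.restrict, powMap_powMap, ← Units.val_mul, mul_inv_cancel, Units.val_one, powMap_one, ht]
  have h3 : x ∈ S.inl.range := ⟨_, (f.toEquiv.injective h2).symm⟩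
  rw [S.range_inl_eq_ker_rightHom] at h3
  exact hx h3

theorem Aut.rightHom_symm_ne {S : ExtendedGroup n E} (f : S.Aut) {x : E}
    (hx : S.rightHom x ≠ 1) : S.rightHom (f.toEquiv.symm x) ≠ 1 := by
  intro h
  have h1 : f.toEquiv.symm x ∈ S.inl.range := by
    rw [S.range_inl_eq_ker_rightHom]
    exact h
  obtain ⟨t, ht⟩ := h1
  apply hx
  have h2 : x = S.inl (powMap f.M.1 t) := by
    rw [← f.restrict, ht, MulEquiv.apply_symm_apply]
  have h3 : x ∈ S.inl.range := ⟨_, h2.symm⟩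
  rw [S.range_inl_eq_ker_rightHom] at h3
  exact h3

theorem Aut.commute {S : ExtendedGroup n E} (f : S.Aut) : f.M.1 * S.a = S.a * f.M.1 := by
  obtain ⟨δ, ⟨hδ, -⟩, -⟩ := S.exists_W
  apply antiMap_injective
  intro t
  have h1 := congrArg f.toEquiv (S.conj_eq δ hδ t)
  rw [map_mul, map_mul, map_inv, f.restrict, f.restrict,
    S.conj_eq _ (f.rightHom_ne hδ)] at h1
  have h2 := S.inl_injective h1
  simp only [antiMap, MonoidHom.comp_apply, powMap_conj, powMap_powMap] at h2 ⊢
  exact h2.symm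

/-- The real points `T(ℝ, δ)`: the fixed points of conjugation by `δ`. -/
def realPoints (δ : E) : Subgroup (Torus n) where
  carrier := {t | δ * S.inl t * δ⁻¹ = S.inl t}
  one_mem' := by simp
  mul_mem' := by
    intro s t hs ht
    have : δ * S.inl (s * t) * δ⁻¹ = (δ * S.inl s * δ⁻¹) * (δ * S.inl t * δ⁻¹) := by
      rw [map_mul]; group
    rw [Set.mem_ofPred_eq, this, hs, ht, map_mul]
  inv_mem' := by
    intro s hs
    have : δ * S.inl s⁻¹ * δ⁻¹ = (δ * S.inl s * δ⁻¹)⁻¹ := by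
      rw [map_inv]; group
    rw [Set.mem_ofPred_eq, this, hs, map_inv]

/-- The canonical cover `T(ℝ, δ)^can`: the preimage of `T(ℝ, δ)` in the canonical cover of `T`. -/
def realCan (δ : E) : AddSubgroup (CanCover S.a) :=
  (Subgroup.toAddSubgroup (S.realPoints δ)).comap (canProj S.a)

theorem mem_realCan {δ : E} {x : CanCover S.a} : x ∈ S.realCan δ ↔
    δ * S.inl (canProj S.a x).toMul * δ⁻¹ = S.inl (canProj S.a x).toMul := Iff.rfl

theorem mem_realCan_iff {δ : E} (hδ : S.rightHom δ ≠ 1) {x : CanCover S.a} : x ∈ S.realCan δ ↔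
    antiMap S.a (canProj S.a x).toMul = (canProj S.a x).toMul := by
  rw [mem_realCan, S.conj_eq δ hδ]
  exact S.inl_injective.eq_iff

theorem toPro_intCast_mem (δ : E) (m : Fin n → ℤ) :
    toPro (canLattices S.a) (intCastHom n m) ∈ S.realCan δ := by
  have h : (canProj S.a (toPro (canLattices S.a) (intCastHom n m))).toMul = 1 :=
    texp2_intCast m
  rw [mem_realCan, h]
  simp

/-- A canonical projective representation of a strong real form: a pair `(π, δ)` of a strong real
form `δ` and an irreducible admissible representation `π` of `T(ℝ, δ)^can`. As this group is
commutative, such a `π` is a quasicharacter, that is, a continuous homomorphism to the nonzero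
complex numbers, and infinitesimal equivalence is equality. -/
structure ProjRep where
  δ : E
  strong : S.IsStrongRealForm δ
  π : AddChar (S.realCan δ) ℂ
  continuous_π : Continuous π

/-- Equivalence of `(π, δ)` and `(π', δ')`: there is `g` in `T` with `g δ g⁻¹ = δ'` and
`π ∘ Int(g⁻¹) = π'`; here `Int(g)` is trivial on the canonical cover of the commutative group `T`. -/
instance projRepSetoid : Setoid S.ProjRep where
  r p q := (∃ g : Torus n, S.inl g * p.δ * (S.inl g)⁻¹ = q.δ) ∧
    ∀ (x : CanCover S.a) (hx : x ∈ S.realCan p.δ) (hx' : x ∈ S.realCan q.δ),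
      p.π ⟨x, hx⟩ = q.π ⟨x, hx'⟩
  iseqv := by
    refine ⟨fun p => ⟨⟨1, by simp⟩, fun _ _ _ => rfl⟩, ?_, ?_⟩
    · rintro p q ⟨⟨g, hg⟩, h⟩
      refine ⟨⟨g⁻¹, ?_⟩, fun x hx hx' => (h x hx' hx).symm⟩
      rw [← hg, map_inv]
      group
    · rintro p q r ⟨⟨g, hg⟩, h⟩ ⟨⟨g', hg'⟩, h'⟩
      refine ⟨⟨g' * g, ?_⟩, fun x hx hx' => ?_⟩
      · rw [← hg', ← hg, map_mul]
        group
      · have hy : x ∈ S.realCan q.δ :=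
          (S.mem_realCan_iff q.strong.1).mpr ((S.mem_realCan_iff p.strong.1).mp hx)
        exact (h x hx hy).trans (h' x hy hx')

/-- Equivalence classes of canonical projective representations of strong real forms. -/
def RepClass : Type _ := Quotient S.projRepSetoid

/-- `(π, δ)` is of type `z`, for `z` in `∨T` of finite order and fixed by the Galois action: the
restriction of `π` to `π₁(T)^can` is the character given by `z`, via
`∨T = Hom (X_*(T), ℂˣ)`. The group `π₁(T)^can` is a completion of `π₁(T) = X_*(T) = ℤⁿ`, so that it
is enough to prescribe the values of `π` on the image of `ℤⁿ`. -/
def IsOfType (z : Torus n) (p : S.ProjRep) : Prop :=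
  ∀ m : Fin n → ℤ, p.π ⟨toPro (canLattices S.a) (intCastHom n m), S.toPro_intCast_mem p.δ m⟩
    = ((∏ i, z i ^ m i : ℂˣ) : ℂ)

theorem Aut.lift_mem {S : ExtendedGroup n E} (f : S.Aut) {δ : E} (hδ : S.rightHom δ ≠ 1)
    {x : CanCover S.a} (hx : x ∈ S.realCan (f.toEquiv.symm δ)) :
    canLift f.commute x ∈ S.realCan δ := by
  rw [S.mem_realCan_iff hδ, canProj_lift]
  rw [S.mem_realCan_iff (f.rightHom_symm_ne hδ)] at hx
  have h : antiMap S.a (powMap f.M.1 (canProj S.a x).toMul)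
      = powMap f.M.1 (antiMap S.a (canProj S.a x).toMul) := by
    simp only [antiMap, MonoidHom.comp_apply, powMap_conj, powMap_powMap, f.commute]
  rw [h, hx]

/-- The lift of `ϑ` to the canonical cover, as a homomorphism from `T(ℝ, (ϑ^Γ)⁻¹ δ)^can` to
`T(ℝ, δ)^can`. -/
def Aut.realLift {S : ExtendedGroup n E} (f : S.Aut) {δ : E} (hδ : S.rightHom δ ≠ 1) :
    S.realCan (f.toEquiv.symm δ) →+ S.realCan δ :=
  ((canLift f.commute).comp (S.realCan (f.toEquiv.symm δ)).subtype).codRestrict _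
    fun x => f.lift_mem hδ x.2

/-- The action `(π, δ) ↦ (π ∘ ϑ, (ϑ^Γ)⁻¹ δ)`. -/
def Aut.actRep {S : ExtendedGroup n E} (f : S.Aut) (p : S.ProjRep) : S.ProjRep where
  δ := f.toEquiv.symm p.δ
  strong := by
    obtain ⟨h1, h2, h3⟩ := p.strong
    refine ⟨f.rightHom_symm_ne h1, ?_, ?_⟩
    · rw [← map_pow, Subgroup.mem_center_iff]
      intro g
      apply f.toEquiv.injective
      rw [map_mul, map_mul, MulEquiv.apply_symm_apply]
      exact Subgroup.mem_center_iff.mp h2 _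
    · rw [← map_pow]
      exact MonoidHom.isOfFinOrder f.toEquiv.symm.toMonoidHom h3
  π := p.π.compAddMonoidHom (f.realLift p.strong.1)
  continuous_π := by
    refine p.continuous_π.comp ?_
    exact ((proLift_continuous _ _ _).comp continuous_subtype_val).subtype_mk _

/-- The action of `ϑ^Γ` on equivalence classes. -/
def Aut.actPi {S : ExtendedGroup n E} (f : S.Aut) : S.RepClass → S.RepClass :=
  Quotient.map f.actRep (by
    rintro p q ⟨⟨g, hg⟩, h⟩
    refine ⟨⟨powMap f.M⁻¹.1 g, ?_⟩, ?_⟩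
    · change _ * f.toEquiv.symm p.δ * _ = f.toEquiv.symm q.δ
      apply f.toEquiv.injective
      rw [map_mul, map_mul, map_inv, f.restrict, powMap_powMap, ← Units.val_mul, mul_inv_cancel,
        Units.val_one, powMap_one, MulEquiv.apply_symm_apply, MulEquiv.apply_symm_apply, hg]
    · intro x hx hx'
      exact h _ _ _)

/-- The group of characters of `Q = π₁(∨T)^alg / K`, as a group of elements of finite order of `T`:
the element `exp (2 π i c)`, for `c` in `X_*(T) ⊗ ℚ = X^*(∨T) ⊗ ℚ`, is the character of `π₁(∨T)^alg`
obtained by restriction from the character `c` of the universal algebraic cover. -/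
def charGroup (K : AddSubgroup (AlgCover n)) : Set (Torus n) :=
  {j | ∃ c : Fin n → ℚ, j = texp2 (ratVec c) ∧ ∀ k ∈ K, ratChar c k = 1}

/-- The set `Π^z(T/ℝ)_J` with `J` the group of characters of `Q = π₁(∨T)^alg / K`: the classes of the
`(π, δ)` of type `z` such that `δ²` lies in `δ₀² J`, where `δ₀²`, for any `δ₀` in `W`, is the second
invariant of `(T^Γ, W)`. -/
def repSet (z : Torus n) (K : AddSubgroup (AlgCover n)) : Set S.RepClass :=
  {P | ∃ p : S.ProjRep, (Quotient.mk _ p : S.RepClass) = P ∧ S.IsOfType z p ∧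
    ∃ δ₀ ∈ S.W, ∃ j ∈ charGroup K, p.δ ^ 2 = δ₀ ^ 2 * S.inl j}

end ExtendedGroup

/-! ### Complete geometric parameters -/

namespace EGroup

variable {n : ℕ} {E : Type*} [Group E] (S : EGroup n E)

/-- The isotropy group in `∨T` of a geometric parameter `(y, Λ)`. (The action on `Λ` is trivial.) -/
def isotropy (y : E) : Subgroup (Torus n) where
  carrier := {t | S.inl t * y * (S.inl t)⁻¹ = y}
  one_mem' := by simp
  mul_mem' := by
    intro s t hs ht
    have : S.inl (s * t) * y * (S.inl (s * t))⁻¹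
        = S.inl s * (S.inl t * y * (S.inl t)⁻¹) * (S.inl s)⁻¹ := by
      rw [map_mul]; group
    rw [Set.mem_ofPred_eq, this, ht, hs]
  inv_mem' := by
    intro s hs
    have h2 : S.inl s * y * (S.inl s)⁻¹ = y := hs
    rw [Set.mem_ofPred_eq]
    nth_rewrite 1 [← h2]
    rw [map_inv]
    group

/-- The preimage of the isotropy group in the universal algebraic cover. -/
def isotropyAlg (y : E) : AddSubgroup (AlgCover n) :=
  (Subgroup.toAddSubgroup (S.isotropy y)).comap (algProj n)

/-- The preimage of the isotropy group in the cover `∨T^Q = ∨T^alg / K`. -/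
def isotropyQ (K : AddSubgroup (AlgCover n)) (y : E) : AddSubgroup (QuotCover K) :=
  (S.isotropyAlg y).map (toQuotCover K)

/-- The component group `A^{loc, Q}` of a geometric parameter. -/
abbrev CompGroup (K : AddSubgroup (AlgCover n)) (y : E) : Type :=
  S.isotropyQ K y ⧸ AddSubgroup.connectedComponentOfZero (S.isotropyQ K y)

/-- The map from the isotropy group in the universal algebraic cover to the component group. -/
def toComp (K : AddSubgroup (AlgCover n)) (y : E) : S.isotropyAlg y →+ S.CompGroup K y :=
  (QuotientAddGroup.mk' _).comp
    (((toQuotCover K).comp (S.isotropyAlg y).subtype).codRestrict (S.isotropyQ K y)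
      fun x => AddSubgroup.mem_map_of_mem _ x.2)

/-- A local complete geometric parameter `((y, Λ), τ)` of type `Q = π₁(∨T)^alg / K`. For a torus
the canonical flat `Λ` through a semisimple element `lam` of the Lie algebra is `{lam}`. As the
component group is a commutative profinite group, its irreducible representation `τ` is a
continuous character. -/
structure CompleteParam (K : AddSubgroup (AlgCover n)) where
  y : E
  lam : Fin n → ℂ
  rightHom_y : S.rightHom y ≠ 1
  sq_y : y ^ 2 = S.inl (texp2 lam)
  τ : AddChar (S.CompGroup K y) ℂ
  continuous_τ : Continuous τ

theorem mem_isotropyAlg_iff {y : E} (hy : S.rightHom y ≠ 1) {x : AlgCover n} :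
    x ∈ S.isotropyAlg y ↔ powMap S.θ (algProj n x).toMul = (algProj n x).toMul := by
  set t := (algProj n x).toMul with ht
  have h1 : x ∈ S.isotropyAlg y ↔ S.inl t * y * (S.inl t)⁻¹ = y := Iff.rfl
  have h2 := S.conj_eq y hy t
  rw [h1, ← S.inl_injective.eq_iff, ← h2]
  rw [mul_inv_eq_iff_eq_mul, mul_inv_eq_iff_eq_mul]
  exact eq_comm

/-- Conjugacy under `∨T^alg` of local complete geometric parameters; inner automorphisms are trivial
on the commutative group `∨T^alg`. -/
instance completeParamSetoid (K : AddSubgroup (AlgCover n)) : Setoid (S.CompleteParam K) where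
  r p q := (∃ g : Torus n, S.inl g * p.y * (S.inl g)⁻¹ = q.y) ∧ p.lam = q.lam ∧
    ∀ (x : AlgCover n) (hx : x ∈ S.isotropyAlg p.y) (hx' : x ∈ S.isotropyAlg q.y),
      p.τ (S.toComp K p.y ⟨x, hx⟩) = q.τ (S.toComp K q.y ⟨x, hx'⟩)
  iseqv := by
    refine ⟨fun p => ⟨⟨1, by simp⟩, rfl, fun _ _ _ => rfl⟩, ?_, ?_⟩
    · rintro p q ⟨⟨g, hg⟩, h0, h⟩
      refine ⟨⟨g⁻¹, ?_⟩, h0.symm, fun x hx hx' => (h x hx' hx).symm⟩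
      rw [← hg, map_inv]
      group
    · rintro p q r ⟨⟨g, hg⟩, h0, h⟩ ⟨⟨g', hg'⟩, h0', h'⟩
      refine ⟨⟨g' * g, ?_⟩, h0.trans h0', fun x hx hx' => ?_⟩
      · rw [← hg', ← hg, map_mul]
        group
      · have hy : x ∈ S.isotropyAlg q.y :=
          (S.mem_isotropyAlg_iff q.rightHom_y).mpr ((S.mem_isotropyAlg_iff p.rightHom_y).mp hx)
        exact (h x hx hy).trans (h' x hy hx')

/-- The set of complete geometric parameters of type `Q = π₁(∨T)^alg / K`. -/
def Xi (K : AddSubgroup (AlgCover n)) : Type _ := Quotient (S.completeParamSetoid K)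

theorem Aut.rightHom_ne {S : EGroup n E} (f : S.Aut) {x : E} (hx : S.rightHom x ≠ 1) :
    S.rightHom (f.toEquiv x) ≠ 1 := by
  intro h
  have h1 : f.toEquiv x ∈ S.inl.range := by
    rw [S.range_inl_eq_ker_rightHom]
    exact h
  obtain ⟨t, ht⟩ := h1
  have h2 : f.toEquiv x = f.toEquiv (S.inl (powMap f.M⁻¹.1 t)) := by
    rw [f.restrict, powMap_powMap, ← Units.val_mul, mul_inv_cancel, Units.val_one, powMap_one, ht]
  have h3 : x ∈ S.inl.range := ⟨_, (f.toEquiv.injective h2).symm⟩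
  rw [S.range_inl_eq_ker_rightHom] at h3
  exact hx h3

/-- The quotient `Q = π₁(∨T)^alg / K` is stable under (the lift of) the automorphism. -/
def Aut.Stabilizes {S : EGroup n E} (f : S.Aut) (K : AddSubgroup (AlgCover n)) : Prop :=
  K.map (algLift f.M.1) = K

theorem Aut.lift_inv_mem {S : EGroup n E} (f : S.Aut) {K : AddSubgroup (AlgCover n)}
    (hK : f.Stabilizes K) : K ≤ K.comap (algLift f.M⁻¹.1) := by
  intro x hx
  rw [← hK] at hx
  obtain ⟨k, hk, rfl⟩ := hx
  rw [AddSubgroup.mem_comap]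
  have : algLift f.M⁻¹.1 (algLift f.M.1 k) = k :=
    proLift_inv _ _ _ _ _ (by rw [← Units.val_mul, inv_mul_cancel, Units.val_one]) k
  rw [this]
  exact hk

theorem Aut.lift_inv_isotropy {S : EGroup n E} (f : S.Aut) (y : E) {x : AlgCover n}
    (hx : x ∈ S.isotropyAlg (f.toEquiv y)) : algLift f.M⁻¹.1 x ∈ S.isotropyAlg y := by
  change S.inl _ * y * (S.inl _)⁻¹ = y
  have hx' : S.inl (algProj n x).toMul * f.toEquiv y * (S.inl (algProj n x).toMul)⁻¹
    = f.toEquiv y := hx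
  apply f.toEquiv.injective
  rw [algProj_lift, map_mul, map_mul, map_inv, f.restrict, powMap_powMap, ← Units.val_mul,
    mul_inv_cancel, Units.val_one, powMap_one, hx']

/-- The map induced by the inverse of `∨ϑ` on the cover `∨T^Q`. -/
def Aut.quotInv {S : EGroup n E} (f : S.Aut) {K : AddSubgroup (AlgCover n)}
    (hK : f.Stabilizes K) : QuotCover K →+ QuotCover K :=
  QuotientAddGroup.map K K (algLift f.M⁻¹.1) (f.lift_inv_mem hK)

theorem Aut.quotInv_continuous {S : EGroup n E} (f : S.Aut) {K : AddSubgroup (AlgCover n)}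
    (hK : f.Stabilizes K) : Continuous (f.quotInv hK) :=
  continuous_quot_lift _ (continuous_quot_mk.comp (proLift_continuous _ _ _))

/-- The map induced by the inverse of `∨ϑ` on isotropy groups in the cover `∨T^Q`. -/
def Aut.isotropyInv {S : EGroup n E} (f : S.Aut) {K : AddSubgroup (AlgCover n)}
    (hK : f.Stabilizes K) (y : E) : S.isotropyQ K (f.toEquiv y) →+ S.isotropyQ K y :=
  ((f.quotInv hK).comp (S.isotropyQ K (f.toEquiv y)).subtype).codRestrict _ (by
    rintro ⟨_, x, hx, rfl⟩
    exact ⟨algLift f.M⁻¹.1 x, f.lift_inv_isotropy y hx, rfl⟩)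

theorem Aut.isotropyInv_continuous {S : EGroup n E} (f : S.Aut) {K : AddSubgroup (AlgCover n)}
    (hK : f.Stabilizes K) (y : E) : Continuous (f.isotropyInv hK y) :=
  ((f.quotInv_continuous hK).comp continuous_subtype_val).subtype_mk _

/-- The map induced by the inverse of `∨ϑ` on component groups. -/
def Aut.compInv {S : EGroup n E} (f : S.Aut) {K : AddSubgroup (AlgCover n)}
    (hK : f.Stabilizes K) (y : E) : S.CompGroup K (f.toEquiv y) →+ S.CompGroup K y :=
  QuotientAddGroup.map _ _ (f.isotropyInv hK y) (by
    intro x hx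
    have h := (f.isotropyInv_continuous hK y).image_connectedComponent_subset 0
      (Set.mem_image_of_mem _ hx)
    rw [map_zero] at h
    exact h)

theorem Aut.compInv_continuous {S : EGroup n E} (f : S.Aut) {K : AddSubgroup (AlgCover n)}
    (hK : f.Stabilizes K) (y : E) : Continuous (f.compInv hK y) :=
  continuous_quot_lift _ (continuous_quot_mk.comp (f.isotropyInv_continuous hK y))

/-- The action `((y, Λ), τ) ↦ ((∨ϑ^Γ y, d∨ϑ Λ), τ ∘ ∨ϑ⁻¹)`. -/
def Aut.actParam {S : EGroup n E} (f : S.Aut) {K : AddSubgroup (AlgCover n)}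
    (hK : f.Stabilizes K) (q : S.CompleteParam K) : S.CompleteParam K where
  y := f.toEquiv q.y
  lam := act f.M.1 q.lam
  rightHom_y := f.rightHom_ne q.rightHom_y
  sq_y := by rw [← map_pow, q.sq_y, f.restrict, texp2_act]
  τ := q.τ.compAddMonoidHom (f.compInv hK q.y)
  continuous_τ := q.continuous_τ.comp (f.compInv_continuous hK q.y)

/-- The action of `∨ϑ^Γ` on complete geometric parameters. -/
def Aut.actXi {S : EGroup n E} (f : S.Aut) {K : AddSubgroup (AlgCover n)}
    (hK : f.Stabilizes K) : S.Xi K → S.Xi K :=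
  Quotient.map (f.actParam hK) (by
    rintro p q ⟨⟨g, hg⟩, h0, h⟩
    refine ⟨⟨powMap f.M.1 g, ?_⟩, ?_, ?_⟩
    · change _ * f.toEquiv p.y * _ = f.toEquiv q.y
      rw [← f.restrict, ← map_mul, ← map_inv, ← map_mul, hg]
    · exact congrArg (act f.M.1) h0
    · intro x hx hx'
      exact h (algLift f.M⁻¹.1 x) (f.lift_inv_isotropy _ hx) (f.lift_inv_isotropy _ hx'))

end EGroup

/-! ### The local Langlands correspondence for tori -/

section LLC

variable {n : ℕ} {E E' : Type*} [Group E] [Group E']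

/-- The differential of `π` is `lam` in the dual `X^*(T) ⊗ ℂ = ℂⁿ` of the Lie algebra of `T`: for each
one-parameter subgroup `s ↦ exp (2 π i s v)` of `T(ℝ, δ)`. -/
def HasDifferential (S : ExtendedGroup n E) (p : S.ProjRep) (lam : Fin n → ℂ) : Prop :=
  ∀ (v : Fin n → ℂ) (hv : ∀ s : ℝ, toPro (canLattices S.a) (s • v) ∈ S.realCan p.δ) (s : ℝ),
    p.π ⟨toPro (canLattices S.a) (s • v), hv s⟩
      = Complex.exp (s * (lam ⬝ᵥ ((2 * (Real.pi : ℂ) * Complex.I) • v)))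

/-- The restriction of `π` to the (cover of the) maximal compact subgroup of `T(ℝ, δ)`, which consists
of the `exp (2 π i v)` in `T(ℝ, δ)` with `v` real, is the character `ν`. -/
def HasCompactRestriction (S : ExtendedGroup n E) (p : S.ProjRep) (ν : Fin n → ℂ) : Prop :=
  ∀ (v : Fin n → ℝ)
    (hv : toPro (canLattices S.a) (fun i => (v i : ℂ)) ∈ S.realCan p.δ),
    p.π ⟨toPro (canLattices S.a) (fun i => (v i : ℂ)), hv⟩
      = Complex.exp (2 * (Real.pi : ℂ) * Complex.I * (ν ⬝ᵥ fun i => (v i : ℂ)))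

/-- The correspondence between `π` and `(y, Λ)`, with `Λ = {lam}`. The Langlands parameter `φ` of
`(y, lam)` has `φ(j) = exp (- π i lam) y`. Writing this as `exp (2 π i X) d` with `d` in `D`, one has
`ν = (lam - θ lam) / 2 - (X + θ X)`, which lies in a coset of `X_*(∨T) = X^*(T)` and is well defined
modulo `(1 + θ) X_*(∨T)`. Then `π` is the quasicharacter attached to the pair `(ν, lam)`: its
restriction to the maximal compact subgroup is `ν` and its differential is `lam`. -/
def CorrespondsChar (S : ExtendedGroup n E) (D : EGroup n E') {K : AddSubgroup (AlgCover n)}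
    (p : S.ProjRep) (q : D.CompleteParam K) : Prop :=
  ∃ d ∈ D.D, ∃ X : Fin n → ℂ,
    D.inl (texp (-((Real.pi : ℂ) * Complex.I) • q.lam)) * q.y = D.inl (texp2 X) * d ∧
    HasDifferential S p q.lam ∧
    HasCompactRestriction S p ((1 / 2 : ℂ) • (q.lam - act D.θ q.lam) - (X + act D.θ X))

/-- The correspondence between `δ` and `τ`: there is `μ` in `(X_*(T) ⊗ ℚ)^{-a}` such that `δ` is
equivalent to `exp (π i μ) δ₀`, with `δ₀` in `W`, and such that `τ` is the restriction of the character
`μ` of `∨T^alg`, via `X_*(T) ⊗ ℚ = X^*(∨T) ⊗ ℚ = X^*(∨T^alg)`. -/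
def CorrespondsForm (S : ExtendedGroup n E) (D : EGroup n E') {K : AddSubgroup (AlgCover n)}
    (p : S.ProjRep) (q : D.CompleteParam K) : Prop :=
  ∃ δ₀ ∈ S.W, ∃ μ : Fin n → ℚ,
    -act S.a (ratVec μ) = ratVec μ ∧
    (∃ g : Torus n, S.inl g * p.δ * (S.inl g)⁻¹
      = S.inl (texp (((Real.pi : ℂ) * Complex.I) • ratVec μ)) * δ₀) ∧
    ∀ (x : AlgCover n) (hx : x ∈ D.isotropyAlg q.y), q.τ (D.toComp K q.y ⟨x, hx⟩) = ratChar μ x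

/-- The local Langlands correspondence for tori, as a relation between equivalence classes. -/
def LLC (S : ExtendedGroup n E) (D : EGroup n E') {K : AddSubgroup (AlgCover n)}
    (P : S.RepClass) (x : D.Xi K) : Prop :=
  ∃ (p : S.ProjRep) (q : D.CompleteParam K),
    (Quotient.mk _ p : S.RepClass) = P ∧ (Quotient.mk _ q : D.Xi K) = x ∧
    CorrespondsChar S D p q ∧ CorrespondsForm S D p q

end LLC

end RealTori

end

/-! Everything is linearised by `v ↦ exp (2 π i v)`. With `θ = aᵀ`, the real points become the `v`
with `v + a (conj v)` integral, and the isotropy group of `y` becomes the `v` with `v - θ v`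
integral. A continuous character of a subgroup of a projective limit of covers is trivial on the
elements that vanish in some finite cover, because `ℂˣ` has no small subgroups
(`exists_lattice_trivial`). It is therefore determined by its values at exponentials.

Both halves of the correspondence rest on two facts about an integral involution `b`, and both facts
hold because the `b`-fixed lattice is a direct summand. A character of the `x` (real or complex)
with `x + b x` integral, trivial where `x + b x = 0`, has the form `x ↦ exp (2 π i ⟨w, x + b x⟩)`
(`exists_character_of_trivial`). A linear form that is integral on the fixed lattice lies in `(1 -
bᵀ) ℂⁿ + ℤⁿ` (`exists_of_integral_on_fixed`).

For `π` and `(y, lam)`, take `b = a`. The differential of `π` gives `lam`. After removal of its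
contribution, the restriction to the compact part gives `X`, with indeterminacy `(1 - θ) ℂⁿ + ℤⁿ`.
This is the indeterminacy of `X` in `y = exp (2 π i (lam / 2 + X)) d` up to conjugacy. The equation
`y² = exp (2 π i lam)` says that `exp (2 π i ν) = z`, that is, that `π` has type `z`
(`EGroup.sq_iff`, `isOfType_iff`).

For `δ` and `τ`, take `b = -θ`. Strong real forms with `δ²` in `δ₀² J` are conjugate to `exp (π i μ)
δ₀` with `μ` rational and `a μ = -μ`; characters of the component group are restrictions of such
`μ`. In both cases `μ` is determined exactly modulo `(1 - a) ℤⁿ` (`conj_forms_iff`,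
`ratChar_eq_iff`). Since `δ² = δ₀² exp (2 π i μ)`, the condition on `δ²` matches triviality of `μ`
on `K`.

Equivariance holds because automorphisms transport the whole witness `(d, X, δ₀, μ)` of a
correspondence to a witness for the images. -/

namespace RealTori

/-! ### Exponentials -/

/-- `z ↦ exp (2 π i z)`. -/
noncomputable def cexp2 (z : ℂ) : ℂ := Complex.exp (2 * (Real.pi : ℂ) * Complex.I * z)

theorem two_pi_I_ne : 2 * (Real.pi : ℂ) * Complex.I ≠ 0 := Complex.two_pi_I_ne_zero

theorem cexp2_add (z w : ℂ) : cexp2 (z + w) = cexp2 z * cexp2 w := by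
  simp [cexp2, mul_add, Complex.exp_add]

theorem cexp2_ne_zero (z : ℂ) : cexp2 z ≠ 0 := Complex.exp_ne_zero _

theorem cexp2_zero : cexp2 0 = 1 := by simp [cexp2]

theorem cexp2_neg (z : ℂ) : cexp2 (-z) = (cexp2 z)⁻¹ := by
  simp [cexp2, Complex.exp_neg]

theorem cexp2_sub (z w : ℂ) : cexp2 (z - w) = cexp2 z / cexp2 w := by
  rw [sub_eq_add_neg, cexp2_add, cexp2_neg, div_eq_mul_inv]

theorem cexp2_eq_one_iff {z : ℂ} : cexp2 z = 1 ↔ ∃ k : ℤ, z = k := by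
  rw [cexp2, Complex.exp_eq_one_iff]
  refine exists_congr fun k => ?_
  rw [mul_comm (k : ℂ)]
  exact mul_right_inj' two_pi_I_ne

theorem cexp2_intCast (k : ℤ) : cexp2 k = 1 := cexp2_eq_one_iff.mpr ⟨k, rfl⟩

theorem cexp2_eq_iff {z w : ℂ} : cexp2 z = cexp2 w ↔ ∃ k : ℤ, z = w + k := by
  rw [← div_eq_one_iff_eq (cexp2_ne_zero w), ← cexp2_sub, cexp2_eq_one_iff]
  exact exists_congr fun k => by rw [sub_eq_iff_eq_add']

theorem cexp2_surjective {u : ℂ} (hu : u ≠ 0) : ∃ z, cexp2 z = u := by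
  refine ⟨Complex.log u / (2 * (Real.pi : ℂ) * Complex.I), ?_⟩
  rw [cexp2, mul_div_cancel₀ _ two_pi_I_ne, Complex.exp_log hu]

theorem cexp2_int_mul (k : ℤ) (z : ℂ) : cexp2 (k * z) = cexp2 z ^ k := by
  rw [cexp2, cexp2, ← Complex.exp_int_mul]
  congr 1
  ring

theorem cexp2_sum {ι : Type*} (s : Finset ι) (f : ι → ℂ) :
    cexp2 (∑ i ∈ s, f i) = ∏ i ∈ s, cexp2 (f i) := by
  rw [cexp2, Finset.mul_sum, Complex.exp_sum]
  rfl

theorem continuous_cexp2 : Continuous cexp2 := by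
  unfold cexp2
  fun_prop

theorem eq_zero_of_cexp2_real_mul {c : ℂ} (h : ∀ s : ℝ, cexp2 (s * c) = 1) : c = 0 := by
  by_contra hc
  have h2 : ∀ s : ℝ, ∃ k : ℤ, (s : ℂ) * c = k := fun s => cexp2_eq_one_iff.mp (h s)
  obtain ⟨k, hk⟩ := h2 1
  have hk0 : (k : ℝ) ≠ 0 := by
    rintro h0
    apply hc
    have : (k : ℂ) = 0 := by exact_mod_cast h0
    simpa [this] using hk
  -- At `s = 1` the value `c` is a nonzero integer `k`; at `s = 1 / (2 k)` the integer would be one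
  -- half.
  obtain ⟨l, hl⟩ := h2 (1 / (2 * k))
  have hc2 : c = k := by simpa using hk
  have h3 : (k : ℂ) ≠ 0 := by exact_mod_cast hk0
  rw [hc2] at hl
  push_cast at hl
  field_simp at hl
  have h4 : ((1 : ℤ) : ℂ) = ((2 * l : ℤ) : ℂ) := by
    push_cast
    exact hl
  have h5 : (1 : ℤ) = 2 * l := Int.cast_injective h4
  omega

/-- A complex number is determined by the restriction of its exponential to the real line. -/
theorem eq_of_cexp2_real_mul {c d : ℂ} (h : ∀ s : ℝ, cexp2 (s * c) = cexp2 (s * d)) : c = d := by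
  rw [← sub_eq_zero]
  apply eq_zero_of_cexp2_real_mul
  intro s
  rw [mul_sub, cexp2_sub, h, div_self (cexp2_ne_zero _)]

/-! ### Matrices acting on the Lie algebra -/

variable {n : ℕ}

@[simp] theorem act_add (A : Matrix (Fin n) (Fin n) ℤ) (v w : Fin n → ℂ) :
    act A (v + w) = act A v + act A w := (actHom A).map_add v w

@[simp] theorem act_zero (A : Matrix (Fin n) (Fin n) ℤ) : act A 0 = 0 := (actHom A).map_zero

@[simp] theorem act_sub (A : Matrix (Fin n) (Fin n) ℤ) (v w : Fin n → ℂ) :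
    act A (v - w) = act A v - act A w := (actHom A).map_sub v w

@[simp] theorem act_neg (A : Matrix (Fin n) (Fin n) ℤ) (v : Fin n → ℂ) :
    act A (-v) = -act A v := (actHom A).map_neg v

@[simp] theorem act_smul (A : Matrix (Fin n) (Fin n) ℤ) (c : ℂ) (v : Fin n → ℂ) :
    act A (c • v) = c • act A v := by simp [act, Matrix.mulVec_smul]

theorem act_one (v : Fin n → ℂ) : act 1 v = v := by simp [act]

theorem act_neg_left (A : Matrix (Fin n) (Fin n) ℤ) (v : Fin n → ℂ) :
    act (-A) v = -act A v := by
  ext i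
  simp [act, Matrix.mulVec, dotProduct]

theorem act_involutive {A : Matrix (Fin n) (Fin n) ℤ} (h : A * A = 1) (v : Fin n → ℂ) :
    act A (act A v) = v := by rw [act_act, h, act_one]

theorem dotProduct_act (A : Matrix (Fin n) (Fin n) ℤ) (u v : Fin n → ℂ) :
    u ⬝ᵥ act A v = act Aᵀ u ⬝ᵥ v := by
  rw [act, act, Matrix.dotProduct_mulVec, Matrix.transpose_map, Matrix.mulVec_transpose]

theorem act_star (A : Matrix (Fin n) (Fin n) ℤ) (v : Fin n → ℂ) :
    act A (star v) = star (act A v) := by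
  ext i
  simp [act, Matrix.mulVec, dotProduct]

theorem star_intCastHom (m : Fin n → ℤ) : star (intCastHom n m) = intCastHom n m := by
  ext i
  simp [intCastHom]

theorem star_ratVec (c : Fin n → ℚ) : star (ratVec c) = ratVec c := by
  ext i
  simp [ratVec]

theorem intCastHom_injective : Function.Injective (intCastHom n) := by
  intro x y h
  ext i
  exact Int.cast_injective (α := ℂ) (congrFun h i)

theorem ratVec_add (c d : Fin n → ℚ) : ratVec (c + d) = ratVec c + ratVec d := by
  ext i
  simp [ratVec]

theorem ratVec_act (A : Matrix (Fin n) (Fin n) ℤ) (c : Fin n → ℚ) :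
    ratVec ((A.map (Int.cast : ℤ → ℚ)) *ᵥ c) = act A (ratVec c) := by
  ext i
  simp [ratVec, act, Matrix.mulVec, dotProduct]

theorem exists_ratVec_of_nsmul {v : Fin n → ℂ} {N : ℕ} (hN : N ≠ 0)
    (h : ∀ i, ∃ k : ℤ, (N : ℂ) * v i = k) : ∃ c : Fin n → ℚ, v = ratVec c := by
  choose k hk using h
  refine ⟨fun i => k i / N, ?_⟩
  ext i
  have : (N : ℂ) ≠ 0 := by exact_mod_cast hN
  simp only [ratVec, Rat.cast_div, Rat.cast_intCast, Rat.cast_natCast]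
  rw [← hk]
  field_simp

theorem exists_common_den (c : Fin n → ℚ) :
    ∃ N : ℕ, N ≠ 0 ∧ ∃ m : Fin n → ℤ, (N : ℂ) • ratVec c = intCastHom n m := by
  refine ⟨∏ i, (c i).den, Finset.prod_ne_zero_iff.mpr fun i _ => (c i).den_nz, ?_⟩
  refine ⟨fun i => (c i).num * ∏ j ∈ Finset.univ.erase i, ((c j).den : ℤ), ?_⟩
  ext i
  rw [← Finset.mul_prod_erase Finset.univ _ (Finset.mem_univ i)]
  have h : ((c i : ℚ) : ℂ) * ((c i).den : ℂ) = ((c i).num : ℂ) := by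
    exact_mod_cast congrArg (Rat.cast : ℚ → ℂ) (Rat.mul_den_eq_num (c i))
  simp only [ratVec, intCastHom, Pi.smul_apply, smul_eq_mul, AddMonoidHom.coe_mk, ZeroHom.coe_mk]
  push_cast
  rw [← h]
  ring

theorem intCast_dotProduct (m k : Fin n → ℤ) :
    intCastHom n m ⬝ᵥ intCastHom n k = ((m ⬝ᵥ k : ℤ) : ℂ) := by
  simp [intCastHom, dotProduct]

/-- The standard basis vector, in the lattice. -/
theorem dotProduct_single_int (u : Fin n → ℂ) (j : Fin n) :
    u ⬝ᵥ intCastHom n (Pi.single j 1) = u j := by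
  have : intCastHom n (Pi.single j 1) = Pi.single j 1 := by
    ext i
    by_cases h : i = j
    · subst h; simp [intCastHom]
    · simp [intCastHom, h]
  rw [this]
  simp

/-! ### The exponential map of the torus -/

theorem texp2_apply (v : Fin n → ℂ) (i : Fin n) : ((texp2 v i : ℂˣ) : ℂ) = cexp2 (v i) := rfl

theorem texp2_zero : texp2 (0 : Fin n → ℂ) = 1 := by
  simpa using texp2_intCast (0 : Fin n → ℤ)

theorem texp2_neg (v : Fin n → ℂ) : texp2 (-v) = (texp2 v)⁻¹ := by
  rw [eq_inv_iff_mul_eq_one, ← texp2_add, neg_add_cancel, texp2_zero]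

theorem texp2_sub (v w : Fin n → ℂ) : texp2 (v - w) = texp2 v * (texp2 w)⁻¹ := by
  rw [sub_eq_add_neg, texp2_add, texp2_neg]

theorem texp2_nsmul (N : ℕ) (v : Fin n → ℂ) : texp2 ((N : ℂ) • v) = texp2 v ^ N := by
  induction N with
  | zero => simp [texp2_zero]
  | succ k ih => rw [Nat.cast_succ, add_smul, one_smul, texp2_add, ih, pow_succ]

theorem texp2_eq_one_iff {v : Fin n → ℂ} : texp2 v = 1 ↔ ∃ m, v = intCastHom n m := by
  constructor
  · intro h
    have h1 : ∀ i, ∃ k : ℤ, v i = k := by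
      intro i
      rw [← cexp2_eq_one_iff, ← texp2_apply, h]
      rfl
    choose k hk using h1
    exact ⟨k, funext hk⟩
  · rintro ⟨m, rfl⟩
    exact texp2_intCast m

theorem texp2_eq_iff {v w : Fin n → ℂ} : texp2 v = texp2 w ↔ ∃ m, v = w + intCastHom n m := by
  rw [← mul_inv_eq_one, ← texp2_sub, texp2_eq_one_iff]
  exact exists_congr fun m => by rw [sub_eq_iff_eq_add']

theorem texp2_surjective (t : Torus n) : ∃ v, texp2 v = t := by
  choose v hv using fun i => cexp2_surjective (t i).ne_zero
  exact ⟨v, by ext i; exact hv i⟩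

theorem texp_pi (v : Fin n → ℂ) : texp (((Real.pi : ℂ) * Complex.I) • v)
    = texp2 ((1 / 2 : ℂ) • v) := by
  rw [texp2, smul_smul]
  congr 2
  ring

theorem texp_neg_pi (v : Fin n → ℂ) : texp (-((Real.pi : ℂ) * Complex.I) • v)
    = texp2 (-((1 / 2 : ℂ) • v)) := by
  rw [texp2, smul_neg, smul_smul, ← neg_smul]
  congr 2
  ring

theorem conjTorus_texp2 (v : Fin n → ℂ) : conjTorus (texp2 v) = texp2 (-star v) := by
  ext i
  change (starRingEnd ℂ) (cexp2 (v i)) = cexp2 (-(starRingEnd ℂ) (v i))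
  rw [cexp2, cexp2, ← Complex.exp_conj]
  congr 1
  simp [Complex.conj_ofNat]

theorem antiMap_texp2 (a : Matrix (Fin n) (Fin n) ℤ) (v : Fin n → ℂ) :
    antiMap a (texp2 v) = texp2 (-act a (star v)) := by
  rw [antiMap, MonoidHom.comp_apply, ← texp2_act, conjTorus_texp2, act_star]

theorem prod_texp2_zpow (v : Fin n → ℂ) (m : Fin n → ℤ) :
    ((∏ i, texp2 v i ^ m i : ℂˣ) : ℂ) = cexp2 (v ⬝ᵥ intCastHom n m) := by
  rw [dotProduct, cexp2_sum, Units.coe_prod]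
  refine Finset.prod_congr rfl fun i _ => ?_
  rw [Units.val_zpow_eq_zpow_val, texp2_apply, ← cexp2_int_mul, mul_comm]
  rfl

theorem fixed_iff_powMap {θ : Matrix (Fin n) (Fin n) ℤ} {v : Fin n → ℂ} :
    powMap θ (texp2 v) = texp2 v ↔ ∃ m, v - act θ v = intCastHom n m := by
  rw [← texp2_act, eq_comm, texp2_eq_iff]
  exact exists_congr fun m => by rw [sub_eq_iff_eq_add']

theorem fixed_iff_antiMap {a : Matrix (Fin n) (Fin n) ℤ} {v : Fin n → ℂ} :
    antiMap a (texp2 v) = texp2 v ↔ ∃ m, v + act a (star v) = intCastHom n m := by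
  rw [antiMap_texp2, eq_comm, texp2_eq_iff]
  exact exists_congr fun m => by rw [← sub_eq_iff_eq_add', sub_neg_eq_add]

theorem eq_one_of_powMap {A : Matrix (Fin n) (Fin n) ℤ} (h : ∀ t : Torus n, powMap A t = t) :
    A = 1 := by
  apply powMap_injective
  intro t
  rw [h, powMap_one]

/-! ### Characters of lattices -/

theorem eq_of_dotProduct_intCast {u v : Fin n → ℂ}
    (h : ∀ m, u ⬝ᵥ intCastHom n m = v ⬝ᵥ intCastHom n m) : u = v := by
  ext j
  rw [← dotProduct_single_int u, h, dotProduct_single_int]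

theorem sum_zsmul_single (m : Fin n → ℤ) : m = ∑ j, m j • (Pi.single j 1 : Fin n → ℤ) := by
  ext i
  simp [Finset.sum_apply, Pi.single_apply]

theorem addChar_sum {G ι : Type*} [AddCommGroup G] (g : AddChar G ℂ) (s : Finset ι) (f : ι → G) :
    g (∑ j ∈ s, f j) = ∏ j ∈ s, g (f j) := by
  classical
  induction s using Finset.induction_on with
  | empty => simp
  | insert j s hj ih => rw [Finset.sum_insert hj, Finset.prod_insert hj, g.map_add_eq_mul, ih]

/-- The characters of `ℤⁿ`. -/
theorem exists_addChar_lattice (g : AddChar (Fin n → ℤ) ℂ) :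
    ∃ w : Fin n → ℂ, ∀ m, g m = cexp2 (w ⬝ᵥ intCastHom n m) := by
  have h1 : ∀ m, g m ≠ 0 := by
    intro m h0
    have := g.map_add_eq_mul m (-m)
    rw [h0, zero_mul, add_neg_cancel, g.map_zero_eq_one] at this
    exact one_ne_zero this
  choose w hw using fun j => cexp2_surjective (h1 (Pi.single j 1))
  refine ⟨w, fun m => ?_⟩
  conv_lhs => rw [sum_zsmul_single m]
  rw [addChar_sum, dotProduct, cexp2_sum]
  refine Finset.prod_congr rfl fun j _ => ?_
  rw [AddChar.map_zsmul_eq_zpow, ← hw, ← cexp2_int_mul, mul_comm]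
  rfl

/-- The kernel of an endomorphism of `ℤⁿ` is a direct summand. -/
theorem exists_projection_ker (f : (Fin n → ℤ) →ₗ[ℤ] (Fin n → ℤ)) :
    ∃ P : (Fin n → ℤ) →ₗ[ℤ] (Fin n → ℤ), (∀ m, f (P m) = 0) ∧ ∀ m, f m = 0 → P m = m := by
  -- The image of `f` is a subgroup of a free abelian group of finite rank, hence projective, so `f`
  -- splits over its image.
  obtain ⟨s, hs⟩ := Module.projective_lifting_property f.rangeRestrict
    (LinearMap.id : LinearMap.range f →ₗ[ℤ] LinearMap.range f) f.surjective_rangeRestrict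
  have hs' : ∀ y, f (s y) = y := fun y => congrArg Subtype.val (LinearMap.congr_fun hs y)
  refine ⟨LinearMap.id - s.comp f.rangeRestrict, fun m => ?_, fun m hm => ?_⟩
  · simp [hs']
  · have : f.rangeRestrict m = 0 := Subtype.ext hm
    simp [this]

/-- The sublattice fixed by an integral matrix is a direct summand. -/
theorem exists_projection_fixed (b : Matrix (Fin n) (Fin n) ℤ) :
    ∃ P : (Fin n → ℤ) →+ (Fin n → ℤ),
      (∀ m, act b (intCastHom n (P m)) = intCastHom n (P m)) ∧
      ∀ m, act b (intCastHom n m) = intCastHom n m → P m = m := by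
  obtain ⟨P, h1, h2⟩ := exists_projection_ker (b.mulVecLin - LinearMap.id)
  refine ⟨P.toAddMonoidHom, fun m => ?_, fun m hm => h2 m ?_⟩
  · rw [act_intCast]
    exact congrArg _ (sub_eq_zero.mp (h1 m))
  · rw [act_intCast] at hm
    exact sub_eq_zero.mpr (intCastHom_injective hm)

/-- The value of `χ` at `x` depends only on the `b`-fixed integral vector `m = x + b x`, and `m / 2`
is an element with the same image. So `χ` comes from a character of the fixed lattice; a projection
onto this summand extends it to `ℤⁿ`, where characters are exponentials. It serves for `π` (with `b
= a`) and for `τ` (with `b = -θ`). -/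
theorem exists_character_of_trivial {b : Matrix (Fin n) (Fin n) ℤ}
    (hb : b * b = 1) (U : AddSubgroup (Fin n → ℂ))
    (hU : ∀ x ∈ U, ∃ m, x + act b x = intCastHom n m)
    (hU' : ∀ m, act b (intCastHom n m) = intCastHom n m → (1 / 2 : ℂ) • intCastHom n m ∈ U)
    (χ : AddChar U ℂ) (hχ : ∀ x : U, x.1 + act b x.1 = 0 → χ x = 1) :
    ∃ w : Fin n → ℂ, ∀ x : U, χ x = cexp2 (w ⬝ᵥ (x.1 + act b x.1)) := by
  obtain ⟨P, h1, h2⟩ := exists_projection_fixed b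
  let h : (Fin n → ℤ) →+ U :=
    { toFun := fun m => ⟨(1 / 2 : ℂ) • intCastHom n (P m), hU' _ (h1 m)⟩
      map_zero' := by simp
      map_add' := fun x y => by simp }
  obtain ⟨w, hw⟩ := exists_addChar_lattice (χ.compAddMonoidHom h)
  refine ⟨w, fun x => ?_⟩
  obtain ⟨m, hm⟩ := hU x.1 x.2
  have hbm : act b (intCastHom n m) = intCastHom n m := by
    rw [← hm, act_add, act_involutive hb, add_comm]
  rw [hm, ← hw]
  have hx : x = (x - h m) + h m := by abel
  rw [AddChar.compAddMonoidHom_apply]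
  conv_lhs => rw [hx, χ.map_add_eq_mul]
  rw [hχ, one_mul]
  have : ((x - h m : U) : Fin n → ℂ) = x.1 - (1 / 2 : ℂ) • intCastHom n m := by
    simp [h, h2 m hbm]
  rw [this, act_sub, act_smul, hbm, ← hm]
  module

/-- Some integral form `k` agrees with `u` on the `b`-fixed lattice. As every `m + b m` is fixed,
the difference `e = u - k` satisfies `e + bᵀ e = 0`, and so `e = (1 - bᵀ) (e / 2)`. This measures
the ambiguity of `X` and of `μ`. -/
theorem exists_of_integral_on_fixed {b : Matrix (Fin n) (Fin n) ℤ} (hb : b * b = 1)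
    (u : Fin n → ℂ)
    (hu : ∀ m, act b (intCastHom n m) = intCastHom n m → ∃ k : ℤ, u ⬝ᵥ intCastHom n m = k) :
    ∃ (w : Fin n → ℂ) (k : Fin n → ℤ), u = w - act bᵀ w + intCastHom n k := by
  obtain ⟨P, h1, h2⟩ := exists_projection_fixed b
  choose k hk using fun j => hu _ (h1 (Pi.single j 1))
  have h3 : ∀ m, u ⬝ᵥ intCastHom n (P m) = intCastHom n k ⬝ᵥ intCastHom n m := by
    intro m
    conv_lhs => rw [sum_zsmul_single m]
    rw [map_sum, map_sum, dotProduct_sum, dotProduct]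
    refine Finset.sum_congr rfl fun j _ => ?_
    rw [map_zsmul, map_zsmul, dotProduct_smul, hk]
    simp [intCastHom, mul_comm]
  set e := u - intCastHom n k with he
  have h4 : e + act bᵀ e = 0 := by
    apply eq_of_dotProduct_intCast
    intro m
    have hbm : act b (intCastHom n (m + intAct b m)) = intCastHom n (m + intAct b m) := by
      rw [map_add, act_add, ← act_intCast, act_involutive hb, add_comm]
    have h5 := h3 (m + intAct b m)
    rw [h2 _ hbm, ← sub_eq_zero, ← sub_dotProduct, ← he, map_add, ← act_intCast,
      dotProduct_add, dotProduct_act] at h5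
    rw [add_dotProduct, h5, zero_dotProduct]
  refine ⟨(1 / 2 : ℂ) • e, k, ?_⟩
  rw [act_smul, eq_neg_of_add_eq_zero_right h4]
  have : u = e + intCastHom n k := by rw [he]; abel
  rw [this]
  module

/-! ### Continuous characters -/

/-- The absence of small subgroups in `ℂˣ`: while `ζ ^ 2 ^ j` stays within `1 / 2` of `1`, each
squaring multiplies the distance to `1` by `|ζ ^ 2 ^ j + 1| ≥ 3 / 2`. -/
theorem eq_one_of_pow_near {ζ : ℂ} (h : ∀ k : ℕ, ‖ζ ^ k - 1‖ ≤ 1 / 2) : ζ = 1 := by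
  have h1 : ∀ j : ℕ, (3 / 2 : ℝ) ^ j * ‖ζ - 1‖ ≤ ‖ζ ^ 2 ^ j - 1‖ := by
    intro j
    induction j with
    | zero => simp
    | succ j ih =>
      have h2 : ζ ^ 2 ^ (j + 1) - 1 = (ζ ^ 2 ^ j + 1) * (ζ ^ 2 ^ j - 1) := by ring
      have h3 : (3 / 2 : ℝ) ≤ ‖ζ ^ 2 ^ j + 1‖ := by
        have h4 : (2 : ℂ) = (ζ ^ 2 ^ j + 1) - (ζ ^ 2 ^ j - 1) := by ring
        have h5 := norm_sub_le (ζ ^ 2 ^ j + 1) (ζ ^ 2 ^ j - 1)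
        rw [← h4] at h5
        have h6 : ‖(2 : ℂ)‖ = 2 := by simp
        linarith [h (2 ^ j)]
      rw [h2, norm_mul, pow_succ', mul_assoc]
      exact mul_le_mul h3 ih (by positivity) (by positivity)
  by_contra hne
  have hpos : 0 < ‖ζ - 1‖ := norm_pos_iff.mpr (sub_ne_zero.mpr hne)
  obtain ⟨j, hj⟩ := pow_unbounded_of_one_lt (1 / ‖ζ - 1‖) (by norm_num : (1 : ℝ) < 3 / 2)
  rw [div_lt_iff₀ hpos] at hj
  linarith [h1 j, h (2 ^ j)]

/-- A continuous character of the real line is an exponential. -/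
theorem exists_addChar_real (χ : AddChar ℝ ℂ) (hχ : Continuous χ) :
    ∃ c : ℂ, ∀ s : ℝ, χ s = cexp2 (s * c) := by
  -- If all these integrals vanished, so would their derivative at `0`, which is `χ 0 = 1`. Dividing
  -- by a nonzero integral `A` then writes `χ` as an integral of itself, which makes it
  -- differentiable.
  obtain ⟨r, hr⟩ : ∃ r : ℝ, (∫ t in (0 : ℝ)..r, χ t) ≠ 0 := by
    by_contra! h
    have h1 : HasDerivAt (fun r : ℝ => ∫ t in (0 : ℝ)..r, χ t) (χ 0) 0 :=
      intervalIntegral.integral_hasDerivAt_right (hχ.intervalIntegrable _ _)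
        (hχ.stronglyMeasurableAtFilter _ _) hχ.continuousAt
    simp only [h, χ.map_zero_eq_one] at h1
    exact zero_ne_one ((hasDerivAt_const (0 : ℝ) (0 : ℂ)).unique h1)
  set A := ∫ t in (0 : ℝ)..r, χ t with hA
  have h2 : ∀ s, χ s = (∫ t in s..(s + r), χ t) / A := by
    intro s
    rw [eq_div_iff hr, hA, ← intervalIntegral.integral_const_mul]
    have := intervalIntegral.integral_comp_add_left (a := 0) (b := r) χ s
    rw [add_zero] at this
    rw [← this]
    simp_rw [χ.map_add_eq_mul]
  have h3 : ∀ s, χ s = ((∫ t in (0 : ℝ)..(s + r), χ t) - ∫ t in (0 : ℝ)..s, χ t) / A := by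
    intro s
    rw [h2, intervalIntegral.integral_interval_sub_left (hχ.intervalIntegrable _ _)
      (hχ.intervalIntegrable _ _)]
  have h4 : ∀ u, HasDerivAt (fun u : ℝ => ∫ t in (0 : ℝ)..u, χ t) (χ u) u := fun u =>
    intervalIntegral.integral_hasDerivAt_right (hχ.intervalIntegrable _ _)
        (hχ.stronglyMeasurableAtFilter _ _) hχ.continuousAt
  set c := (χ r - 1) / A with hc
  have h5 : ∀ s, HasDerivAt χ (c * χ s) s := by
    intro s
    have h6 := (((h4 (s + r)).comp_add_const s r).sub (h4 s)).div_const A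
    have h7 : c * χ s = (χ (s + r) - χ s) / A := by
      rw [χ.map_add_eq_mul, hc]
      ring
    rw [h7]
    exact h6.congr_of_eventuallyEq (Filter.Eventually.of_forall h3)
  -- The equation `χ' = c χ` makes this product constant.
  have h8 : ∀ s : ℝ, χ s * Complex.exp (-(s * c)) = 1 := by
    have h9 : ∀ s : ℝ, HasDerivAt (fun s : ℝ => χ s * Complex.exp (-(s * c))) 0 s := by
      intro s
      have h10 : HasDerivAt (fun s : ℝ => Complex.exp (-(s * c)))
          (Complex.exp (-(s * c)) * (-(1 * c))) s :=
        (((hasDerivAt_id s).ofReal_comp).mul_const c).neg.cexp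
      have h11 := (h5 s).mul h10
      have h12 : c * χ s * Complex.exp (-(s * c))
          + χ s * (Complex.exp (-(s * c)) * -(1 * c)) = 0 := by ring
      rw [h12] at h11
      exact h11
    intro s
    have := is_const_of_deriv_eq_zero (fun s => (h9 s).differentiableAt)
      (fun s => (h9 s).deriv) s 0
    simpa [χ.map_zero_eq_one] using this
  refine ⟨c / (2 * (Real.pi : ℂ) * Complex.I), fun s => ?_⟩
  have h11 : cexp2 (s * (c / (2 * (Real.pi : ℂ) * Complex.I))) = Complex.exp (s * c) := by
    rw [cexp2]
    congr 1
    field_simp [two_pi_I_ne]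
  rw [h11, ← mul_one (Complex.exp _), ← h8 s, mul_left_comm, ← Complex.exp_add]
  simp

/-! ### Projective limits -/

theorem proProj_eq_of_apply_eq {C : Set (Lattice n)} {L L' : C} (h : L.1 ≤ L'.1)
    {x y : proCover C} (hxy : x.1 L = y.1 L) : proProj L' x = proProj L' y := by
  rw [← proProj_eq L L' h, ← proProj_eq L L' h]
  exact congrArg (coverProj L.1) hxy

theorem exists_toPro_apply_eq {C : Set (Lattice n)} (L : C) (x : proCover C) :
    ∃ v, x.1 L = (toPro C v).1 L := by
  obtain ⟨v, hv⟩ := QuotientAddGroup.mk_surjective (x.1 L)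
  exact ⟨v, hv.symm⟩

theorem toPro_apply_eq_zero_iff {C : Set (Lattice n)} (L : C) {v : Fin n → ℂ} :
    (toPro C v).1 L = 0 ↔ ∃ m ∈ L.1, intCastHom n m = v :=
  QuotientAddGroup.eq_zero_iff v

theorem proCover_apply_eq {C : Set (Lattice n)} {L L' : C} (h : L.1 ≤ L'.1)
    {x y : proCover C} (hxy : x.1 L = y.1 L) : x.1 L' = y.1 L' := by
  rw [← x.2 L L' h, ← y.2 L L' h, hxy]

theorem toPro_continuous (C : Set (Lattice n)) : Continuous (toPro C) :=
  (continuous_pi fun _ => continuous_quot_mk).subtype_mk _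

/-- A continuous character of a subgroup of a projective limit of covers is trivial on the elements
whose component in a suitable cover is trivial. -/
theorem exists_lattice_trivial {C : Set (Lattice n)} (htop : ⊤ ∈ C)
    (hinf : ∀ L ∈ C, ∀ L' ∈ C, L ⊓ L' ∈ C) (H : AddSubgroup (proCover C)) (χ : AddChar H ℂ)
    (hχ : Continuous χ) : ∃ L : C, ∀ x : H, x.1.1 L = 0 → χ x = 1 := by
  have hind : Topology.IsInducing (fun x : H => x.1.1) :=
    Topology.IsInducing.subtypeVal.comp Topology.IsInducing.subtypeVal
  have h1 : χ ⁻¹' Metric.ball 1 (1 / 2) ∈ nhds (0 : H) := by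
    apply hχ.continuousAt
    rw [χ.map_zero_eq_one]
    exact Metric.ball_mem_nhds _ (by norm_num)
  rw [hind.nhds_eq_comap] at h1
  obtain ⟨t, ht, hts⟩ := h1
  obtain ⟨s, hst, hs, h0⟩ := mem_nhds_iff.mp ht
  obtain ⟨I, u, hu, hIu⟩ := isOpen_pi_iff.mp hs _ h0
  -- A basic neighbourhood of the product topology constrains finitely many covers only, and one
  -- cover dominates them.
  have h2 : ∃ L : C, ∀ i ∈ I, L.1 ≤ i.1 := by
    classical
    clear hu hIu
    induction I using Finset.induction_on with
    | empty => exact ⟨⟨⊤, htop⟩, by simp⟩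
    | insert i I _ ih =>
      obtain ⟨L, hL⟩ := ih
      refine ⟨⟨L.1 ⊓ i.1, hinf _ L.2 _ i.2⟩, fun j hj => ?_⟩
      rcases Finset.mem_insert.mp hj with rfl | hj
      · exact inf_le_right
      · exact inf_le_left.trans (hL j hj)
  obtain ⟨L, hL⟩ := h2
  -- All multiples of `x` vanish in the covers that matter, so all powers of `χ x` stay near `1`.
  refine ⟨L, fun x hx => eq_one_of_pow_near fun k => ?_⟩
  rw [← χ.map_nsmul_eq_pow]
  have h3 : k • x ∈ χ ⁻¹' Metric.ball 1 (1 / 2) := by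
    apply hts
    apply hst
    apply hIu
    intro i hi
    have h4 : (k • x).1.1 i = 0 := by
      have h5 : x.1.1 i = (0 : proCover C).1 i :=
        proCover_apply_eq (hL i hi) (x := x.1) (y := 0) hx
      have h6 : (k • x).1.1 i = k • x.1.1 i := rfl
      rw [h6, h5]
      exact smul_zero k
    change (k • x).1.1 i ∈ u i
    rw [h4]
    exact (hu i hi).2
  have h7 : dist (χ (k • x)) 1 < 1 / 2 := h3
  rw [dist_eq_norm] at h7
  exact h7.le

/-! ### Rational characters of the algebraic cover -/

theorem algLattices_inf : ∀ L ∈ algLattices n, ∀ L' ∈ algLattices n, L ⊓ L' ∈ algLattices n := by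
  intro L hL L' hL'
  have : L.FiniteIndex := hL
  have : L'.FiniteIndex := hL'
  exact (inferInstance : (L ⊓ L').FiniteIndex)

theorem canLattices_inf (a : Matrix (Fin n) (Fin n) ℤ) :
    ∀ L ∈ canLattices a, ∀ L' ∈ canLattices a, L ⊓ L' ∈ canLattices a := by
  rintro L ⟨h1, h2, h3⟩ L' ⟨h1', h2', h3'⟩
  exact ⟨algLattices_inf L h1 L' h1', fun m hm => ⟨h2 m hm.1, h2' m hm.2⟩,
    fun m => ⟨h3 m, h3' m⟩⟩

noncomputable def ratLattice (c : Fin n → ℚ) : algLattices n := ⟨integralLattice c, integralLattice_finiteIndex c⟩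

theorem ratChar_toPro (c : Fin n → ℚ) (v : Fin n → ℂ) :
    ratChar c (toPro (algLattices n) v) = cexp2 (ratVec c ⬝ᵥ v) := rfl

theorem ratChar_congr (c : Fin n → ℚ) {x y : AlgCover n}
    (h : x.1 (ratLattice c) = y.1 (ratLattice c)) : ratChar c x = ratChar c y := by
  unfold ratChar
  exact congrArg (fun u => Quotient.liftOn' u _ _) h

/-- Elements of the projective limit need not be exponentials. On a cover that dominates `L` and the
covers on which `c` and `d` are defined, a single `v` represents `x` for all purposes at hand. -/
theorem exists_toPro_ratChar_eq (c d : Fin n → ℚ) (L : algLattices n) (x : AlgCover n) :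
    ∃ v, x.1 L = (toPro _ v).1 L ∧ ratChar c x = cexp2 (ratVec c ⬝ᵥ v) ∧
      ratChar d x = cexp2 (ratVec d ⬝ᵥ v) := by
  set L' : algLattices n := ⟨L.1 ⊓ ((ratLattice c).1 ⊓ (ratLattice d).1),
    algLattices_inf _ L.2 _ (algLattices_inf _ (ratLattice c).2 _ (ratLattice d).2)⟩
  obtain ⟨v, hv⟩ := exists_toPro_apply_eq L' x
  refine ⟨v, proCover_apply_eq (L := L') inf_le_left hv,
    ratChar_congr c (proCover_apply_eq (L := L') ?_ hv),
    ratChar_congr d (proCover_apply_eq (L := L') ?_ hv)⟩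
  · exact inf_le_right.trans inf_le_left
  · exact inf_le_right.trans inf_le_right

theorem ratChar_add (c : Fin n → ℚ) (x y : AlgCover n) :
    ratChar c (x + y) = ratChar c x * ratChar c y := by
  obtain ⟨v, hv⟩ := exists_toPro_apply_eq (ratLattice c) x
  obtain ⟨w, hw⟩ := exists_toPro_apply_eq (ratLattice c) y
  have h : (x + y).1 (ratLattice c) = (toPro _ (v + w)).1 (ratLattice c) := by
    rw [map_add]
    exact congrArg₂ (· + ·) hv hw
  rw [ratChar_congr c h, ratChar_congr c hv, ratChar_congr c hw, ratChar_toPro, ratChar_toPro,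
    ratChar_toPro, dotProduct_add, cexp2_add]

/-- `ratChar c` as an additive character. -/
noncomputable def ratAddChar (c : Fin n → ℚ) : AddChar (AlgCover n) ℂ where
  toFun := ratChar c
  map_zero_eq_one' := by
    have := ratChar_toPro c 0
    rwa [map_zero, dotProduct_zero, cexp2_zero] at this
  map_add_eq_mul' := ratChar_add c

theorem ratChar_continuous (c : Fin n → ℚ) : Continuous (ratChar (n := n) c) := by
  have h1 : Continuous fun x : AlgCover n => x.1 (ratLattice c) :=
    (continuous_apply _).comp continuous_subtype_val
  have h2 : Continuous fun v : Fin n → ℂ => cexp2 (ratVec c ⬝ᵥ v) :=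
    continuous_cexp2.comp (continuous_const.dotProduct continuous_id)
  exact (Continuous.quotient_liftOn' h2 _).comp h1

theorem algProj_eq_of_apply_eq {L : algLattices n} {x y : AlgCover n} (h : x.1 L = y.1 L) :
    algProj n x = algProj n y := proProj_eq_of_apply_eq (L' := algTop n) le_top h

/-- An integral vector is a character of the torus itself, hence trivial on the fundamental group.
Thus triviality on `K` depends only on the element `exp (2 π i c)`. -/
theorem ratChar_eq_of_sub_int {c d : Fin n → ℚ} {m : Fin n → ℤ}
    (h : ratVec c = ratVec d + intCastHom n m) {x : AlgCover n} (hx : x ∈ algPi1 n) :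
    ratChar c x = ratChar d x := by
  obtain ⟨v, hv, hc, hd⟩ := exists_toPro_ratChar_eq c d (algTop n) x
  have h1 : texp2 v = 1 := by
    have := algProj_eq_of_apply_eq hv
    rw [AddMonoidHom.mem_ker.mp hx] at this
    exact this.symm
  obtain ⟨k, rfl⟩ := texp2_eq_one_iff.mp h1
  rw [hc, hd, h, add_dotProduct, intCast_dotProduct, cexp2_add, cexp2_intCast, mul_one]

theorem ratChar_algLift (A : Matrix (Fin n) (Fin n) ℤ) {c d : Fin n → ℚ}
    (h : ratVec d = act Aᵀ (ratVec c)) (x : AlgCover n) :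
    ratChar c (algLift A x) = ratChar d x := by
  obtain ⟨v, hv, -, hd⟩ := exists_toPro_ratChar_eq c d
    ⟨_, finiteIndex_comap A _ (ratLattice c).2⟩ x
  have h1 : (algLift A x).1 (ratLattice c) = (toPro _ (act A v)).1 (ratLattice c) :=
    congrArg (coverLift A (ratLattice c).1) hv
  rw [ratChar_congr c h1, ratChar_toPro, hd, h, dotProduct_act]

/-! ### The Galois group and the first invariants -/

/-- As there is only one nontrivial Galois element, all elements outside the torus form a single
coset. -/
theorem gal_eq {g h : Gal(ℂ/ℝ)} (hg : g ≠ 1) (hh : h ≠ 1) : g = h := by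
  have key : ∀ f : Gal(ℂ/ℝ), f ≠ 1 → f.toAlgHom = Complex.conjAe := by
    intro f hf
    rcases Complex.real_algHom_eq_id_or_conj f.toAlgHom with h1 | h1
    · exact absurd (AlgEquiv.ext fun x => AlgHom.congr_fun h1 x) hf
    · exact h1
  exact AlgEquiv.ext fun x => AlgHom.congr_fun ((key g hg).trans (key h hh).symm) x

section Extension

variable {E : Type*} [Group E]

theorem exists_inl_mul (S : GroupExtension (Torus n) E Gal(ℂ/ℝ)) {x y : E}
    (h : S.rightHom x = S.rightHom y) : ∃ t, x = S.inl t * y := by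
  have h1 : x * y⁻¹ ∈ S.inl.range := by
    rw [S.range_inl_eq_ker_rightHom, MonoidHom.mem_ker, map_mul, h, map_inv, mul_inv_cancel]
  obtain ⟨t, ht⟩ := h1
  exact ⟨t, by rw [ht, inv_mul_cancel_right]⟩

theorem exists_inl_mul_of_ne (S : GroupExtension (Torus n) E Gal(ℂ/ℝ)) {x y : E}
    (hx : S.rightHom x ≠ 1) (hy : S.rightHom y ≠ 1) : ∃ t, x = S.inl t * y :=
  exists_inl_mul S (gal_eq hx hy)

theorem exists_inl_of_eq_one (S : GroupExtension (Torus n) E Gal(ℂ/ℝ)) {x : E}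
    (hx : S.rightHom x = 1) : ∃ t, x = S.inl t := by
  obtain ⟨t, ht⟩ := exists_inl_mul S (y := 1) (hx.trans (map_one _).symm)
  exact ⟨t, by rw [ht, mul_one]⟩

theorem rightHom_inl_mul (S : GroupExtension (Torus n) E Gal(ℂ/ℝ)) (t : Torus n) (x : E) :
    S.rightHom (S.inl t * x) = S.rightHom x := by
  rw [map_mul, S.rightHom_inl, one_mul]

theorem rightHom_sq (S : GroupExtension (Torus n) E Gal(ℂ/ℝ)) (x : E) :
    S.rightHom (x ^ 2) = 1 := by
  by_contra h
  have h1 : S.rightHom x ≠ 1 := by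
    intro h0
    rw [map_pow, h0, one_pow] at h
    exact h rfl
  have h2 := gal_eq h h1
  rw [map_pow, pow_two, mul_eq_left] at h2
  exact h1 h2

/-- The square of `x` lies in the commutative torus. Hence both first invariants `a` and `θ` are
involutions. -/
theorem conj_sq (S : GroupExtension (Torus n) E Gal(ℂ/ℝ)) (x : E) (t : Torus n) :
    x * (x * S.inl t * x⁻¹) * x⁻¹ = S.inl t := by
  obtain ⟨s, hs⟩ := exists_inl_of_eq_one S (rightHom_sq S x)
  have h : x * (x * S.inl t * x⁻¹) * x⁻¹ = x ^ 2 * S.inl t * (x ^ 2)⁻¹ := by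
    rw [pow_two]
    group
  rw [h, hs, ← map_inv, ← map_mul, ← map_mul, mul_comm s t, mul_inv_cancel_right]

theorem antiMap_antiMap (a b : Matrix (Fin n) (Fin n) ℤ) (t : Torus n) :
    antiMap a (antiMap b t) = powMap (a * b) t := by
  obtain ⟨v, rfl⟩ := texp2_surjective t
  rw [antiMap_texp2, antiMap_texp2, ← texp2_act, ← act_act]
  simp [act_star]

theorem ExtendedGroup.a_mul_a (S : ExtendedGroup n E) : S.a * S.a = 1 := by
  obtain ⟨δ, ⟨hδ, -⟩, -⟩ := S.exists_W
  apply eq_one_of_powMap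
  intro t
  have h := conj_sq S.toGroupExtension δ t
  rw [S.conj_eq δ hδ, S.conj_eq δ hδ] at h
  rw [← antiMap_antiMap]
  exact S.inl_injective h

theorem EGroup.θ_mul_θ (S : EGroup n E) : S.θ * S.θ = 1 := by
  obtain ⟨δ, hδ, -⟩ := S.exists_D
  apply eq_one_of_powMap
  intro t
  have h := conj_sq S.toGroupExtension δ t
  rw [S.conj_eq δ hδ, S.conj_eq δ hδ] at h
  rw [← powMap_powMap]
  exact S.inl_injective h

theorem ExtendedGroup.mul_inl (S : ExtendedGroup n E) {x : E} (hx : S.rightHom x ≠ 1)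
    (v : Fin n → ℂ) : x * S.inl (texp2 v) = S.inl (texp2 (-act S.a (star v))) * x := by
  rw [← antiMap_texp2, ← S.conj_eq x hx, inv_mul_cancel_right]

theorem EGroup.mul_inl (S : EGroup n E) {x : E} (hx : S.rightHom x ≠ 1)
    (v : Fin n → ℂ) : x * S.inl (texp2 v) = S.inl (texp2 (act S.θ v)) * x := by
  rw [texp2_act, ← S.conj_eq x hx, inv_mul_cancel_right]

theorem ExtendedGroup.sq_inl_mul (S : ExtendedGroup n E) {x : E} (hx : S.rightHom x ≠ 1)
    (v : Fin n → ℂ) :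
    (S.inl (texp2 v) * x) ^ 2 = S.inl (texp2 (v - act S.a (star v))) * x ^ 2 := by
  rw [pow_two, mul_assoc, ← mul_assoc x, S.mul_inl hx, sub_eq_add_neg, texp2_add, map_mul, pow_two]
  simp only [mul_assoc]

theorem EGroup.sq_inl_mul (S : EGroup n E) {x : E} (hx : S.rightHom x ≠ 1)
    (v : Fin n → ℂ) :
    (S.inl (texp2 v) * x) ^ 2 = S.inl (texp2 (v + act S.θ v)) * x ^ 2 := by
  rw [pow_two, mul_assoc, ← mul_assoc x, S.mul_inl hx, texp2_add, map_mul, pow_two]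
  simp only [mul_assoc]

theorem ExtendedGroup.conj_inl_mul (S : ExtendedGroup n E) {x : E} (hx : S.rightHom x ≠ 1)
    (w v : Fin n → ℂ) : S.inl (texp2 w) * (S.inl (texp2 v) * x) * (S.inl (texp2 w))⁻¹
      = S.inl (texp2 (v + (w + act S.a (star w)))) * x := by
  rw [← map_inv, ← texp2_neg, mul_assoc, mul_assoc, S.mul_inl hx, ← mul_assoc, ← mul_assoc,
    ← map_mul, ← map_mul, ← texp2_add, ← texp2_add]
  congr 3
  simp
  abel

theorem EGroup.conj_inl_mul (S : EGroup n E) {x : E} (hx : S.rightHom x ≠ 1)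
    (w v : Fin n → ℂ) : S.inl (texp2 w) * (S.inl (texp2 v) * x) * (S.inl (texp2 w))⁻¹
      = S.inl (texp2 (v + (w - act S.θ w))) * x := by
  rw [← map_inv, ← texp2_neg, mul_assoc, mul_assoc, S.mul_inl hx, ← mul_assoc, ← mul_assoc,
    ← map_mul, ← map_mul, ← texp2_add, ← texp2_add]
  congr 3
  simp
  abel

theorem ExtendedGroup.W_strong (S : ExtendedGroup n E) {δ : E} (h : δ ∈ S.W) :
    S.IsStrongRealForm δ := by
  obtain ⟨δ₀, ⟨h1, h2, h3⟩, hW⟩ := S.exists_W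
  rw [hW] at h
  obtain ⟨t, rfl⟩ := h
  have h4 : (S.inl t * δ₀ * (S.inl t)⁻¹) ^ 2 = δ₀ ^ 2 := by
    rw [conj_pow, Subgroup.mem_center_iff.mp h2, mul_inv_cancel_right]
  refine ⟨?_, by rwa [h4], by rwa [h4]⟩
  rw [map_mul, map_mul, S.rightHom_inl, map_inv, S.rightHom_inl]
  simpa using h1

theorem ExtendedGroup.W_nonempty (S : ExtendedGroup n E) : ∃ δ, δ ∈ S.W := by
  obtain ⟨δ₀, -, hW⟩ := S.exists_W
  exact ⟨δ₀, by rw [hW]; exact ⟨1, by simp⟩⟩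

theorem ExtendedGroup.W_conj (S : ExtendedGroup n E) {δ δ' : E} (h : δ ∈ S.W) (h' : δ' ∈ S.W) :
    ∃ t, S.inl t * δ * (S.inl t)⁻¹ = δ' := by
  obtain ⟨δ₀, -, hW⟩ := S.exists_W
  rw [hW] at h h'
  obtain ⟨t, rfl⟩ := h
  obtain ⟨s, rfl⟩ := h'
  refine ⟨s * t⁻¹, ?_⟩
  rw [map_mul, map_inv]
  group

theorem EGroup.D_rightHom (S : EGroup n E) {d : E} (h : d ∈ S.D) :
    S.rightHom d ≠ 1 := by
  obtain ⟨δ₀, h1, h3, hW⟩ := S.exists_D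
  rw [hW] at h
  obtain ⟨t, rfl⟩ := h
  rw [map_mul, map_mul, S.rightHom_inl, map_inv, S.rightHom_inl]
  simpa using h1

theorem EGroup.D_nonempty (S : EGroup n E) : ∃ d ∈ S.D, IsOfFinOrder d := by
  obtain ⟨δ₀, -, h, hW⟩ := S.exists_D
  exact ⟨δ₀, by rw [hW]; exact ⟨1, by simp⟩, h⟩

theorem EGroup.D_conj (S : EGroup n E) {δ δ' : E} (h : δ ∈ S.D) (h' : δ' ∈ S.D) :
    ∃ t, S.inl t * δ * (S.inl t)⁻¹ = δ' := by
  obtain ⟨δ₀, -, -, hW⟩ := S.exists_D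
  rw [hW] at h h'
  obtain ⟨t, rfl⟩ := h
  obtain ⟨s, rfl⟩ := h'
  refine ⟨s * t⁻¹, ?_⟩
  rw [map_mul, map_inv]
  group

theorem EGroup.conj_mem_D (S : EGroup n E) {d : E} (h : d ∈ S.D) (t : Torus n) :
    S.inl t * d * (S.inl t)⁻¹ ∈ S.D := by
  obtain ⟨δ₀, -, -, hW⟩ := S.exists_D
  rw [hW] at h ⊢
  obtain ⟨s, rfl⟩ := h
  refine ⟨t * s, ?_⟩
  rw [map_mul]
  group

/-! ### Membership of exponentials -/

theorem ExtendedGroup.toPro_mem_realCan (S : ExtendedGroup n E) {δ : E} (hδ : S.rightHom δ ≠ 1)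
    {v : Fin n → ℂ} : toPro (canLattices S.a) v ∈ S.realCan δ ↔
      ∃ m, v + act S.a (star v) = intCastHom n m := by
  rw [S.mem_realCan_iff hδ]
  exact fixed_iff_antiMap

theorem EGroup.toPro_mem_isotropyAlg (S : EGroup n E) {y : E} (hy : S.rightHom y ≠ 1)
    {v : Fin n → ℂ} : toPro (algLattices n) v ∈ S.isotropyAlg y ↔
      ∃ m, v - act S.θ v = intCastHom n m := by
  rw [S.mem_isotropyAlg_iff hy]
  exact fixed_iff_powMap

end Extension

/-! ### Lattices of finite index and logarithms of quasicharacters -/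

theorem finiteIndex_of_nsmul_mem {L : Lattice n} {N : ℕ} (hN : N ≠ 0) (h : ∀ m, N • m ∈ L) :
    L.FiniteIndex := by
  have : NeZero N := ⟨hN⟩
  let f : (Fin n → ℤ) →+ (Fin n → ZMod N) := (Int.castAddHom (ZMod N)).compLeft (Fin n)
  have : Finite f.range := Finite.of_injective _ Subtype.val_injective
  have : f.ker.FiniteIndex := AddSubgroup.finiteIndex_ker f
  refine AddSubgroup.finiteIndex_of_le (H := f.ker) fun m hm => ?_
  have hm' : ∀ i, (N : ℤ) ∣ m i := fun i =>
    (ZMod.intCast_zmod_eq_zero_iff_dvd (m i) N).mp (congrFun (AddMonoidHom.mem_ker.mp hm) i)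
  choose k hk using hm'
  have : m = N • k := by
    ext i
    simp [hk]
  rw [this]
  exact h k

theorem real_smul_vec (s : ℝ) (v : Fin n → ℂ) : s • v = (s : ℂ) • v := by
  ext i
  simp

theorem dotProduct_add_transpose (a : Matrix (Fin n) (Fin n) ℤ) (u v : Fin n → ℂ) :
    (u + act aᵀ u) ⬝ᵥ v = u ⬝ᵥ (v + act a v) := by
  rw [add_dotProduct, dotProduct_add, dotProduct_act]

theorem dotProduct_sub_transpose (a : Matrix (Fin n) (Fin n) ℤ) (u v : Fin n → ℂ) :
    (u - act aᵀ u) ⬝ᵥ v = u ⬝ᵥ (v - act a v) := by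
  rw [sub_dotProduct, dotProduct_sub, dotProduct_act]

/-- The logarithm of the quasicharacter with restriction `ν` to the maximal compact subgroup and
differential `lam`. -/
noncomputable def realPairing (ν lam v : Fin n → ℂ) : ℂ :=
  ν ⬝ᵥ ((1 / 2 : ℂ) • (v + star v)) + lam ⬝ᵥ ((1 / 2 : ℂ) • (v - star v))

theorem realPairing_add (ν lam v w : Fin n → ℂ) :
    realPairing ν lam (v + w) = realPairing ν lam v + realPairing ν lam w := by
  simp only [realPairing, star_add, dotProduct_smul, dotProduct_add, dotProduct_sub, smul_eq_mul]
  ring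

theorem realPairing_of_star {ν lam v : Fin n → ℂ} (hv : star v = v) :
    realPairing ν lam v = ν ⬝ᵥ v := by
  rw [realPairing, hv, sub_self, smul_zero, dotProduct_zero, add_zero]
  congr 1
  module

theorem continuous_realPairing (ν lam : Fin n → ℂ) : Continuous (realPairing ν lam) := by
  have h : ∀ i, Continuous fun v : Fin n → ℂ => star (v i) := fun i =>
    continuous_star.comp (continuous_apply i)
  unfold realPairing dotProduct
  refine (continuous_finsetSum _ fun i _ => ?_).add (continuous_finsetSum _ fun i _ => ?_)
  · exact continuous_const.mul (continuous_const.mul ((continuous_apply i).add (h i)))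
  · exact continuous_const.mul (continuous_const.mul ((continuous_apply i).sub (h i)))

/-- On vectors with `v + a (conj v) = 0`, the pairing only depends on the differential. -/
theorem realPairing_of_fixed {a : Matrix (Fin n) (Fin n) ℤ} (ha : a * a = 1)
    (lam X : Fin n → ℂ) {v : Fin n → ℂ} (hv : v + act a (star v) = 0) :
    realPairing ((1 / 2 : ℂ) • (lam - act aᵀ lam) - (X + act aᵀ X)) lam v = lam ⬝ᵥ v := by
  have h1 : act a (star v) = -v := eq_neg_of_add_eq_zero_right hv
  have h2 : act a v = -star v := by
    have := congrArg (act a) h1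
    rw [act_involutive ha, act_neg] at this
    rw [this, neg_neg]
  rw [realPairing, sub_dotProduct, smul_dotProduct, dotProduct_add_transpose,
    dotProduct_sub_transpose]
  have h3 : act a ((1 / 2 : ℂ) • (v + star v)) = -((1 / 2 : ℂ) • (v + star v)) := by
    rw [act_smul, act_add, h1, h2]
    module
  rw [h3, add_neg_cancel, dotProduct_zero, sub_zero, sub_neg_eq_add, ← dotProduct_smul,
    ← dotProduct_add]
  congr 1
  module

namespace ExtendedGroup

variable {E : Type*} [Group E] {S : ExtendedGroup n E}

/-! ### Quasicharacters of the canonical cover of the real points -/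

theorem canTop_mem (a : Matrix (Fin n) (Fin n) ℤ) : ⊤ ∈ canLattices a := (canTop a).2

/-- A quasicharacter is determined by its values at the exponentials. -/
theorem ProjRep.apply_eq_of_toPro (p q : S.ProjRep)
    (h : ∀ v hv hv', p.π ⟨toPro (canLattices S.a) v, hv⟩ = q.π ⟨toPro (canLattices S.a) v, hv'⟩)
    (x : CanCover S.a) (hx : x ∈ S.realCan p.δ) (hx' : x ∈ S.realCan q.δ) :
    p.π ⟨x, hx⟩ = q.π ⟨x, hx'⟩ := by
  obtain ⟨L, hL⟩ := exists_lattice_trivial (canTop_mem S.a) (canLattices_inf S.a) _ p.π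
    p.continuous_π
  obtain ⟨L', hL'⟩ := exists_lattice_trivial (canTop_mem S.a) (canLattices_inf S.a) _ q.π
    q.continuous_π
  -- On the cover attached to `L ⊓ L'` both characters see only the component of `x`, which is that
  -- of an exponential.
  set M : canLattices S.a := ⟨L.1 ⊓ L'.1, canLattices_inf S.a _ L.2 _ L'.2⟩ with hM
  obtain ⟨v, hv⟩ := exists_toPro_apply_eq M x
  have hproj : canProj S.a x = canProj S.a (toPro _ v) :=
    proProj_eq_of_apply_eq (L := M) le_top hv
  have hvp : toPro _ v ∈ S.realCan p.δ := by
    rw [S.mem_realCan, ← hproj]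
    exact hx
  have hvq : toPro _ v ∈ S.realCan q.δ := by
    rw [S.mem_realCan, ← hproj]
    exact hx'
  have key : ∀ (r : S.ProjRep) (N : canLattices S.a), M.1 ≤ N.1 →
      (∀ y : S.realCan r.δ, y.1.1 N = 0 → r.π y = 1) → ∀ hr hr', r.π ⟨x, hr⟩ = r.π ⟨toPro _ v, hr'⟩ := by
    intro r N hMN hN hr hr'
    have h1 : (⟨x, hr⟩ : S.realCan r.δ) = (⟨x, hr⟩ - ⟨toPro _ v, hr'⟩) + ⟨toPro _ v, hr'⟩ := by
      abel
    rw [h1, r.π.map_add_eq_mul, hN, one_mul]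
    exact sub_eq_zero.mpr (proCover_apply_eq hMN hv)
  rw [key p L inf_le_left hL hx hvp, key q L' inf_le_right hL' hx' hvq, h]

theorem exp_eq_cexp2 (s : ℝ) (lam v : Fin n → ℂ) :
    Complex.exp (s * (lam ⬝ᵥ ((2 * (Real.pi : ℂ) * Complex.I) • v))) = cexp2 (s * (lam ⬝ᵥ v)) := by
  rw [cexp2, dotProduct_smul, smul_eq_mul]
  congr 1
  ring

theorem mem_realCan_of_fixed {δ : E} (hδ : S.rightHom δ ≠ 1) {v : Fin n → ℂ}
    (hv : v + act S.a (star v) = 0) : toPro (canLattices S.a) v ∈ S.realCan δ :=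
  (S.toPro_mem_realCan hδ).mpr ⟨0, by rw [hv, map_zero]⟩

theorem smul_fixed {a : Matrix (Fin n) (Fin n) ℤ} {v : Fin n → ℂ} (s : ℝ)
    (hv : v + act a (star v) = 0) : s • v + act a (star (s • v)) = 0 := by
  have : star ((s : ℂ) • v) = (s : ℂ) • star v := by
    ext i
    simp
  rw [real_smul_vec, this, act_smul, ← smul_add, hv, smul_zero]

/-- The vector `s (v + a (conj v))` is integral for every real `s`, which forces it to vanish. -/
theorem fixed_of_forall_mem {δ : E} (hδ : S.rightHom δ ≠ 1) {v : Fin n → ℂ}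
    (hv : ∀ s : ℝ, toPro (canLattices S.a) (s • v) ∈ S.realCan δ) : v + act S.a (star v) = 0 := by
  ext i
  apply eq_zero_of_cexp2_real_mul
  intro s
  obtain ⟨m, hm⟩ := (S.toPro_mem_realCan hδ).mp (hv s)
  have h1 : star ((s : ℂ) • v) = (s : ℂ) • star v := by
    ext i
    simp
  rw [real_smul_vec, h1, act_smul, ← smul_add] at hm
  rw [cexp2_eq_one_iff]
  exact ⟨m i, congrFun hm i⟩

/-- A real point is the product of its real and imaginary parts. Since `v + a (conj v)` is integral,
it equals its own conjugate, and this puts `y = (v - conj v) / 2` in the space where `y + a (conj y)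
= 0`. There the differential gives the value, and the compact restriction gives it on the remaining
factor. -/
theorem pairing_of_hasDifferential {p : S.ProjRep} {lam ν : Fin n → ℂ}
    (h1 : HasDifferential S p lam) (h2 : HasCompactRestriction S p ν) (v : Fin n → ℂ)
    (hv : toPro (canLattices S.a) v ∈ S.realCan p.δ) :
    p.π ⟨toPro (canLattices S.a) v, hv⟩ = cexp2 (realPairing ν lam v) := by
  have hδ := p.strong.1
  obtain ⟨m, hm⟩ := (S.toPro_mem_realCan hδ).mp hv
  have hm' : star v + act S.a v = intCastHom n m := by
    have := congrArg star hm
    rwa [star_intCastHom, star_add, ← act_star, star_star] at this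
  set x : Fin n → ℝ := fun i => (v i).re with hx
  have hxv : (fun i => (x i : ℂ)) = (1 / 2 : ℂ) • (v + star v) := by
    ext i
    simp [hx, Complex.re_eq_add_conj]
    ring
  set y : Fin n → ℂ := (1 / 2 : ℂ) • (v - star v) with hy
  have hy0 : y + act S.a (star y) = 0 := by
    have : star y = -y := by
      ext i
      simp [hy]
      ring
    rw [this, act_neg, hy, act_smul, act_sub, ← smul_neg, ← smul_add]
    have e : v - star v + -(act S.a v - act S.a (star v)) = 0 := by
      rw [eq_sub_of_add_eq' hm, eq_sub_of_add_eq' hm']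
      abel
    rw [e, smul_zero]
  have hy1 := fun s : ℝ => mem_realCan_of_fixed hδ (smul_fixed s hy0)
  have hvxy : v = (fun i => (x i : ℂ)) + y := by
    rw [hxv, hy]
    module
  have hx1 : toPro (canLattices S.a) (fun i => (x i : ℂ)) ∈ S.realCan p.δ := by
    have : (fun i => (x i : ℂ)) = v - y := by
      rw [hvxy]
      abel
    rw [this, map_sub]
    exact sub_mem hv (mem_realCan_of_fixed hδ hy0)
  have h3 := h1 y hy1 1
  have h4 := h2 x hx1
  have h5 : (⟨toPro (canLattices S.a) v, hv⟩ : S.realCan p.δ)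
      = ⟨_, hx1⟩ + ⟨_, hy1 1⟩ := by
    apply Subtype.ext
    change _ = toPro (canLattices S.a) _ + toPro (canLattices S.a) _
    rw [one_smul, ← map_add, ← hvxy]
  rw [h5, p.π.map_add_eq_mul, h3, h4, exp_eq_cexp2, realPairing, cexp2_add, hxv, ← hy]
  simp [cexp2]

theorem hasDifferential_of_pairing {p : S.ProjRep} (lam X : Fin n → ℂ)
    (h : ∀ v (hv : toPro (canLattices S.a) v ∈ S.realCan p.δ),
      p.π ⟨toPro (canLattices S.a) v, hv⟩
        = cexp2 (realPairing ((1 / 2 : ℂ) • (lam - act S.aᵀ lam) - (X + act S.aᵀ X)) lam v)) :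
    HasDifferential S p lam ∧
      HasCompactRestriction S p ((1 / 2 : ℂ) • (lam - act S.aᵀ lam) - (X + act S.aᵀ X)) := by
  constructor
  · intro v hv s
    have h0 := fixed_of_forall_mem p.strong.1 hv
    rw [h, realPairing_of_fixed S.a_mul_a _ _ (smul_fixed s h0), exp_eq_cexp2, real_smul_vec,
      dotProduct_smul, smul_eq_mul]
  · intro v hv
    rw [h, realPairing_of_star]
    · rfl
    · ext i
      simp

/-- Construction of a quasicharacter from its logarithm. -/
theorem exists_projRep {δ : E} (hδ : S.IsStrongRealForm δ) (ν lam : Fin n → ℂ) {N : ℕ}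
    (hN : N ≠ 0) (hNν : ∀ m, cexp2 (ν ⬝ᵥ intCastHom n m) ^ N = 1)
    (ha : ∀ m, cexp2 (ν ⬝ᵥ act S.a (intCastHom n m)) = cexp2 (ν ⬝ᵥ intCastHom n m)) :
    ∃ p : S.ProjRep, p.δ = δ ∧ ∀ v (hv : toPro (canLattices S.a) v ∈ S.realCan p.δ),
      p.π ⟨toPro (canLattices S.a) v, hv⟩ = cexp2 (realPairing ν lam v) := by
  -- The character lives on the cover given by the kernel of `exp (2 π i ν)` on `ℤⁿ`. The bound `N`
  -- on the order gives finite index, and invariance under `a` says that the involution acts by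
  -- inversion on `ℤⁿ / L`, so this cover is distinguished.
  let L : Lattice n :=
    { carrier := {m | cexp2 (ν ⬝ᵥ intCastHom n m) = 1}
      zero_mem' := by simp [cexp2_zero]
      add_mem' := by
        intro x y hx hy
        rw [Set.mem_ofPred_eq] at hx hy ⊢
        rw [map_add, dotProduct_add, cexp2_add, hx, hy, one_mul]
      neg_mem' := by
        intro x hx
        rw [Set.mem_ofPred_eq] at hx ⊢
        rw [map_neg, dotProduct_neg, cexp2_neg, hx, inv_one] }
  have hL1 : L.FiniteIndex := by
    refine finiteIndex_of_nsmul_mem hN fun m => ?_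
    change cexp2 _ = 1
    rw [← hNν m, map_nsmul, dotProduct_smul, nsmul_eq_mul, ← zpow_natCast, ← cexp2_int_mul]
    simp
  have hL2 : ∀ m, -(intAct S.a m) - (-m) ∈ L := by
    intro m
    change cexp2 _ = 1
    rw [map_sub, map_neg, map_neg, ← act_intCast, dotProduct_sub, dotProduct_neg, dotProduct_neg,
      cexp2_sub, cexp2_neg, cexp2_neg, ha, div_self (inv_ne_zero (cexp2_ne_zero _))]
  have hL3 : ∀ m ∈ L, -(intAct S.a m) ∈ L := by
    intro m hm
    have : -(intAct S.a m) = (-(intAct S.a m) - (-m)) - m := by abel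
    rw [this]
    exact sub_mem (hL2 m) hm
  let L' : canLattices S.a := ⟨L, hL1, hL3, hL2⟩
  let F : FiniteCover L → ℂ := fun u => Quotient.liftOn' u (fun v => cexp2 (realPairing ν lam v)) (by
    intro v w hvw
    obtain ⟨m, hm, hmv⟩ := QuotientAddGroup.leftRel_apply.mp hvw
    have hw : w = v + intCastHom n m := by rw [hmv]; abel
    have hm' : cexp2 (ν ⬝ᵥ intCastHom n m) = 1 := hm
    change cexp2 _ = cexp2 _
    rw [hw, realPairing_add, cexp2_add, realPairing_of_star (star_intCastHom m), hm', mul_one])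
  have hF : Continuous F :=
    Continuous.quotient_liftOn' (continuous_cexp2.comp (continuous_realPairing ν lam)) _
  have hF0 : F 0 = 1 := by
    change cexp2 (realPairing ν lam 0) = 1
    simp [realPairing, cexp2_zero]
  have hF1 : ∀ u w, F (u + w) = F u * F w := by
    intro u w
    induction u using QuotientAddGroup.induction_on with
    | H u =>
      induction w using QuotientAddGroup.induction_on with
      | H w =>
        change cexp2 (realPairing ν lam (u + w)) = _
        rw [realPairing_add, cexp2_add]
        rfl
  refine ⟨{ δ := δ, strong := hδ, π := ⟨fun x => F (x.1.1 L'), hF0, fun x y => hF1 _ _⟩,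
            continuous_π := hF.comp ?_ }, rfl, fun v hv => rfl⟩
  exact (continuous_apply L').comp (continuous_subtype_val.comp continuous_subtype_val)

/-- A real linear form on `ℂⁿ` is, on the fixed vectors of an antilinear involution, the restriction
of a complex linear form. -/
theorem exists_linear_form {a : Matrix (Fin n) (Fin n) ℤ}
    (g : (Fin n → ℂ) → ℂ) (hadd : ∀ u v, g (u + v) = g u + g v)
    (hsmul : ∀ (s : ℝ) u, g ((s : ℂ) • u) = s * g u)
    (h0 : ∀ v, v + act a (star v) = 0 → g (Complex.I • v) = 0) :
    ∃ lam : Fin n → ℂ, ∀ v, v + act a (star v) = 0 → g v = lam ⬝ᵥ v := by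
  have hc : ∀ (r : ℂ) u, g (r • u) = r.re * g u + r.im * g (Complex.I • u) := by
    intro r u
    have : r • u = (r.re : ℂ) • u + (r.im : ℂ) • (Complex.I • u) := by
      rw [smul_smul, ← add_smul, Complex.re_add_im]
    rw [this, hadd, hsmul, hsmul]
  -- The combination `g u - i g (i u)` is complex linear for any real linear `g`, and it agrees with
  -- `g` wherever `g (i v) = 0`.
  let T : (Fin n → ℂ) →ₗ[ℂ] ℂ :=
    { toFun := fun u => g u - Complex.I * g (Complex.I • u)
      map_add' := fun u v => by
        rw [smul_add, hadd, hadd]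
        ring
      map_smul' := fun r u => by
        have h1 : Complex.I • (r • u) = (Complex.I * r) • u := smul_smul _ _ _
        rw [h1, hc r, hc (Complex.I * r), RingHom.id_apply, smul_eq_mul]
        conv_rhs => rw [← Complex.re_add_im r]
        simp only [Complex.mul_re, Complex.mul_im, Complex.I_re, Complex.I_im]
        push_cast
        linear_combination ((r.im : ℂ) * g (Complex.I • u)) * Complex.I_mul_I }
  refine ⟨fun j => T (Pi.single j 1), fun v hv => ?_⟩
  have h1 : T v = g v := by
    change g v - Complex.I * g (Complex.I • v) = g v
    rw [h0 v hv, mul_zero, sub_zero]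
  rw [← h1, LinearMap.pi_apply_eq_sum_univ T v, dotProduct]
  refine Finset.sum_congr rfl fun j _ => ?_
  rw [smul_eq_mul, mul_comm]
  congr 2
  ext i
  simp [Pi.single_apply, eq_comm]

/-- The differential of a quasicharacter. -/
theorem ProjRep.exists_differential (p : S.ProjRep) : ∃ lam : Fin n → ℂ,
    ∀ v, v + act S.a (star v) = 0 → ∀ hv, p.π ⟨toPro (canLattices S.a) v, hv⟩ = cexp2 (lam ⬝ᵥ v) := by
  -- The real linear projection onto the Lie algebra of the real points. It kills `i v` for `v` in
  -- that Lie algebra, which gives the vanishing needed by `exists_linear_form`.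
  let pr : (Fin n → ℂ) → (Fin n → ℂ) := fun u => (1 / 2 : ℂ) • (u - act S.a (star u))
  have hpr : ∀ u, pr u + act S.a (star (pr u)) = 0 := by
    intro u
    have : star (pr u) = (1 / 2 : ℂ) • (star u - act S.a u) := by
      ext i
      simp [pr, act_star]
    rw [this, act_smul, act_sub, act_involutive S.a_mul_a]
    simp only [pr]
    module
  have hpr_add : ∀ u v, pr (u + v) = pr u + pr v := by
    intro u v
    simp only [pr, star_add, act_add]
    module
  have hpr_smul : ∀ (s : ℝ) u, pr ((s : ℂ) • u) = s • pr u := by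
    intro s u
    have : star ((s : ℂ) • u) = (s : ℂ) • star u := by
      ext i
      simp
    simp only [pr]
    rw [this, act_smul, real_smul_vec]
    module
  have hmem : ∀ u, toPro (canLattices S.a) (pr u) ∈ S.realCan p.δ := fun u =>
    mem_realCan_of_fixed p.strong.1 (hpr u)
  have hmem' : ∀ (s : ℝ) u, toPro (canLattices S.a) (s • pr u) ∈ S.realCan p.δ := fun s u =>
    mem_realCan_of_fixed p.strong.1 (smul_fixed s (hpr u))
  have hex : ∀ u, ∃ c : ℂ, ∀ s : ℝ,
      p.π ⟨toPro (canLattices S.a) (s • pr u), hmem' s u⟩ = cexp2 (s * c) := by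
    intro u
    let h : ℝ →+ S.realCan p.δ :=
      { toFun := fun s => ⟨_, hmem' s u⟩
        map_zero' := by simp
        map_add' := fun s t => by
          apply Subtype.ext
          change toPro _ ((s + t) • pr u) = toPro _ _ + toPro _ _
          rw [add_smul, map_add] }
    refine exists_addChar_real (p.π.compAddMonoidHom h) (p.continuous_π.comp ?_)
    exact ((toPro_continuous _).comp (continuous_id.smul continuous_const)).subtype_mk _
  choose g hg using hex
  have hadd : ∀ u v, g (u + v) = g u + g v := by
    intro u v
    apply eq_of_cexp2_real_mul
    intro s
    rw [← hg, mul_add, cexp2_add, ← hg, ← hg, ← p.π.map_add_eq_mul]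
    congr 1
    apply Subtype.ext
    change toPro _ (s • pr (u + v)) = toPro _ _ + toPro _ _
    rw [hpr_add, smul_add, map_add]
  have hsmul : ∀ (r : ℝ) u, g ((r : ℂ) • u) = r * g u := by
    intro r u
    apply eq_of_cexp2_real_mul
    intro s
    rw [← hg, ← mul_assoc, ← Complex.ofReal_mul, ← hg]
    congr 2
    rw [hpr_smul, smul_smul]
  have h0 : ∀ v, v + act S.a (star v) = 0 → g (Complex.I • v) = 0 := by
    intro v hv
    apply eq_zero_of_cexp2_real_mul
    intro s
    have h1 : pr (Complex.I • v) = 0 := by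
      have : star (Complex.I • v) = -Complex.I • star v := by
        ext i
        simp
      simp only [pr]
      rw [this, act_smul, eq_neg_of_add_eq_zero_right hv]
      module
    rw [← hg, ← p.π.map_zero_eq_one]
    congr 1
    apply Subtype.ext
    change toPro _ (s • pr (Complex.I • v)) = 0
    rw [h1, smul_zero, map_zero]
  obtain ⟨lam, hlam⟩ := exists_linear_form g hadd hsmul h0
  refine ⟨lam, fun v hv hv' => ?_⟩
  have h1 : pr v = v := by
    simp only [pr]
    rw [eq_neg_of_add_eq_zero_right hv]
    module
  rw [← hlam v hv, ← one_mul (g v), ← Complex.ofReal_one, ← hg]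
  congr 2
  rw [h1, one_smul]

/-- On the real `x` with `x + a x` integral, division by the exponential of `(lam - θ lam) / 2`
leaves a character that is trivial where `x + a x = 0`: there this form and `lam` agree on `x`. What
is left is an exponential in `x + a x`, which supplies `X`. -/
theorem ProjRep.exists_log (p : S.ProjRep) : ∃ lam X : Fin n → ℂ, HasDifferential S p lam ∧
    HasCompactRestriction S p ((1 / 2 : ℂ) • (lam - act S.aᵀ lam) - (X + act S.aᵀ X)) := by
  obtain ⟨lam, hlam⟩ := p.exists_differential
  let U : AddSubgroup (Fin n → ℂ) :=
    { carrier := {x | star x = x ∧ ∃ m, x + act S.a x = intCastHom n m}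
      zero_mem' := ⟨star_zero _, 0, by simp⟩
      add_mem' := by
        rintro x y ⟨hx, m, hm⟩ ⟨hy, k, hk⟩
        refine ⟨by rw [star_add, hx, hy], m + k, ?_⟩
        rw [map_add, ← hm, ← hk, act_add]
        abel
      neg_mem' := by
        rintro x ⟨hx, m, hm⟩
        refine ⟨by rw [star_neg, hx], -m, ?_⟩
        rw [map_neg, ← hm, act_neg]
        abel }
  have hmem : ∀ x ∈ U, toPro (canLattices S.a) x ∈ S.realCan p.δ := by
    rintro x ⟨hx, m, hm⟩
    exact (S.toPro_mem_realCan p.strong.1).mpr ⟨m, by rw [hx, hm]⟩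
  let χ : AddChar U ℂ :=
    { toFun := fun x => p.π ⟨_, hmem x.1 x.2⟩
        * cexp2 (-(((1 / 2 : ℂ) • (lam - act S.aᵀ lam)) ⬝ᵥ x.1))
      map_zero_eq_one' := by
        have : (⟨_, hmem (0 : U).1 (0 : U).2⟩ : S.realCan p.δ) = 0 := by simp
        rw [this]
        simp [cexp2_zero]
      map_add_eq_mul' := fun x y => by
        have : (⟨_, hmem (x + y).1 (x + y).2⟩ : S.realCan p.δ)
            = ⟨_, hmem x.1 x.2⟩ + ⟨_, hmem y.1 y.2⟩ := by
          apply Subtype.ext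
          exact map_add _ _ _
        rw [this, p.π.map_add_eq_mul, AddSubgroup.coe_add, dotProduct_add, neg_add, cexp2_add]
        ring }
  obtain ⟨w, hw⟩ := exists_character_of_trivial S.a_mul_a U (fun x hx => hx.2)
    (fun m hm => ⟨by
      ext i
      simp [intCastHom], m, by
        rw [act_smul, hm]
        module⟩) χ (by
      intro x hx
      have h1 : x.1 + act S.a (star x.1) = 0 := by rw [x.2.1, hx]
      change p.π ⟨_, _⟩ * _ = 1
      rw [hlam _ h1, ← cexp2_add, smul_dotProduct, dotProduct_sub_transpose,
        eq_neg_of_add_eq_zero_right hx, sub_neg_eq_add, dotProduct_add, smul_eq_mul]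
      rw [show ∀ z : ℂ, z + -(1 / 2 * (z + z)) = 0 by intro z; ring]
      exact cexp2_zero)
  -- The sign of `w` is changed because `X + θ X` is subtracted in `ν`.
  refine ⟨lam, -w, fun v hv s => ?_, fun v hv => ?_⟩
  · rw [hlam _ (smul_fixed s (fixed_of_forall_mem p.strong.1 hv)), exp_eq_cexp2, real_smul_vec,
      dotProduct_smul, smul_eq_mul]
  · have hs : star (fun i => (v i : ℂ)) = fun i => (v i : ℂ) := by
      ext i
      simp
    obtain ⟨m, hm⟩ := (S.toPro_mem_realCan p.strong.1).mp hv
    rw [hs] at hm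
    have h1 := hw ⟨_, hs, m, hm⟩
    change p.π ⟨_, _⟩ * _ = _ at h1
    rw [cexp2_neg, ← div_eq_mul_inv, div_eq_iff (cexp2_ne_zero _), ← cexp2_add] at h1
    rw [h1, act_neg, ← neg_add, sub_neg_eq_add, add_dotProduct _ (w + _), dotProduct_add_transpose,
      add_comm]
    rfl

end ExtendedGroup

theorem finite_setOf_pow_eq_one {N : ℕ} (hN : N ≠ 0) : {ζ : ℂ | ζ ^ N = 1}.Finite := by
  refine (Polynomial.nthRootsFinset N (1 : ℂ)).finite_toSet.subset fun ζ hζ => ?_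
  exact (Polynomial.mem_nthRootsFinset (Nat.pos_of_ne_zero hN) 1).mpr hζ

theorem eq_half_sub {a : Matrix (Fin n) (Fin n) ℤ} {u : Fin n → ℂ} (hu : -act a u = u) :
    u = (1 / 2 : ℂ) • (u - act a u) := by
  rw [sub_eq_add_neg, hu]
  module

namespace EGroup

variable {E : Type*} [Group E] {D : EGroup n E} {K : AddSubgroup (AlgCover n)}

/-! ### Characters of the component group -/

theorem algPi1_le_isotropyAlg (y : E) : algPi1 n ≤ D.isotropyAlg y := by
  intro x hx
  change D.inl (algProj n x).toMul * y * (D.inl (algProj n x).toMul)⁻¹ = y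
  rw [AddMonoidHom.mem_ker.mp hx]
  simp

theorem toComp_continuous (y : E) : Continuous (D.toComp K y) := by
  have h1 : Continuous fun x : D.isotropyAlg y => toQuotCover K x.1 :=
    continuous_quot_mk.comp continuous_subtype_val
  exact continuous_quot_mk.comp (h1.subtype_mk _)

/-- The pull-back of `τ` to the isotropy group in the algebraic cover. -/
noncomputable def CompleteParam.char (q : D.CompleteParam K) : AddChar (D.isotropyAlg q.y) ℂ :=
  q.τ.compAddMonoidHom (D.toComp K q.y)

theorem CompleteParam.char_continuous (q : D.CompleteParam K) : Continuous q.char :=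
  q.continuous_τ.comp (toComp_continuous q.y)

theorem toPro_mem_of_fixed {y : E} (hy : D.rightHom y ≠ 1) {v : Fin n → ℂ}
    (hv : v - act D.θ v = 0) : toPro (algLattices n) v ∈ D.isotropyAlg y :=
  (D.toPro_mem_isotropyAlg hy).mpr ⟨0, by rw [hv, map_zero]⟩

/-- The path `s ↦ s v` stays in the isotropy group and joins `0` to `v`. -/
theorem toComp_toPro_of_fixed {y : E} (hy : D.rightHom y ≠ 1) {v : Fin n → ℂ}
    (hv : v - act D.θ v = 0) (h : toPro (algLattices n) v ∈ D.isotropyAlg y) :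
    D.toComp K y ⟨_, h⟩ = 0 := by
  have hs : ∀ s : ℝ, s • v - act D.θ (s • v) = 0 := by
    intro s
    rw [real_smul_vec, act_smul, ← smul_sub, hv, smul_zero]
  let path : ℝ → D.isotropyQ K y := fun s =>
    ⟨toQuotCover K (toPro (algLattices n) (s • v)),
      AddSubgroup.mem_map_of_mem _ (toPro_mem_of_fixed hy (hs s))⟩
  have hcont : Continuous path :=
    (continuous_quot_mk.comp ((toPro_continuous _).comp
      (continuous_id.smul continuous_const))).subtype_mk _
  have h0 : path 0 = 0 := by
    apply Subtype.ext
    change toQuotCover K (toPro (algLattices n) ((0 : ℝ) • v)) = 0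
    rw [zero_smul, map_zero, map_zero]
  refine (QuotientAddGroup.eq_zero_iff _).mpr ?_
  have h1 : path 1 ∈ connectedComponent (0 : D.isotropyQ K y) :=
    (isPreconnected_range hcont).subset_connectedComponent ⟨0, h0⟩ ⟨1, rfl⟩
  have h2 : path 1 = ((toQuotCover K).comp (D.isotropyAlg y).subtype).codRestrict (D.isotropyQ K y)
      (fun x => AddSubgroup.mem_map_of_mem _ x.2) ⟨_, h⟩ := by
    apply Subtype.ext
    change toQuotCover K (toPro (algLattices n) ((1 : ℝ) • v)) = toQuotCover K _
    rw [one_smul]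
    rfl
  rw [← h2]
  exact h1

theorem neg_θ_mul (D : EGroup n E) : -D.θ * -D.θ = 1 := by
  rw [neg_mul_neg, D.θ_mul_θ]

/-- A character of the component group is the restriction of a rational character. -/
theorem CompleteParam.exists_ratChar (q : D.CompleteParam K) :
    ∃ μ : Fin n → ℚ, -act D.θᵀ (ratVec μ) = ratVec μ ∧
      ∀ (x : AlgCover n) (hx : x ∈ D.isotropyAlg q.y),
        q.τ (D.toComp K q.y ⟨x, hx⟩) = ratChar μ x := by
  have hy := q.rightHom_y
  obtain ⟨L, hL⟩ := exists_lattice_trivial (algTop n).2 algLattices_inf _ q.char q.char_continuous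
  let U : AddSubgroup (Fin n → ℂ) := (D.isotropyAlg q.y).comap (toPro (algLattices n))
  have hU : ∀ x, x ∈ U ↔ ∃ m, x + act (-D.θ) x = intCastHom n m := by
    intro x
    rw [act_neg_left, ← sub_eq_add_neg]
    exact D.toPro_mem_isotropyAlg hy
  let j : U →+ D.isotropyAlg q.y := ((toPro (algLattices n)).comp U.subtype).codRestrict _ fun x => x.2
  obtain ⟨w, hw⟩ := exists_character_of_trivial D.neg_θ_mul U (fun x hx => (hU x).mp hx)
    (fun m hm => (hU _).mpr ⟨m, by
      rw [act_smul, hm]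
      module⟩) (q.char.compAddMonoidHom j) (by
      intro x hx
      rw [act_neg_left, ← sub_eq_add_neg] at hx
      exact (congrArg q.τ (toComp_toPro_of_fixed hy hx x.2)).trans q.τ.map_zero_eq_one)
  -- Moving `1 - θ` across the pairing turns `⟨w, v - θ v⟩` into `⟨u, v⟩`, with `u` in the
  -- eigenspace required of `μ`.
  set u := w - act D.θᵀ w with hu
  have hu1 : -act D.θᵀ u = u := by
    have h1 : D.θᵀ * D.θᵀ = 1 := by rw [← Matrix.transpose_mul, D.θ_mul_θ, Matrix.transpose_one]
    rw [hu, act_sub, act_involutive h1, neg_sub]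
  have hw' : ∀ v (hv : toPro (algLattices n) v ∈ D.isotropyAlg q.y),
      q.char ⟨_, hv⟩ = cexp2 (u ⬝ᵥ v) := by
    intro v hv
    have := hw ⟨v, hv⟩
    rw [act_neg_left, ← sub_eq_add_neg, ← dotProduct_sub_transpose] at this
    exact this
  have hLfin : L.1.FiniteIndex := L.2
  -- Multiples of basis vectors by the index of `L` lie in `L`, where the character is trivial. So
  -- the index is a common denominator of `u`.
  obtain ⟨μ, hμ⟩ := exists_ratVec_of_nsmul (v := u) hLfin.index_ne_zero (by
    intro i
    rw [← cexp2_eq_one_iff]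
    have h1 : L.1.index • (Pi.single i 1 : Fin n → ℤ) ∈ L.1 := AddSubgroup.nsmul_index_mem _ _
    have h2 : intCastHom n (L.1.index • (Pi.single i 1 : Fin n → ℤ))
        - act D.θ (intCastHom n (L.1.index • (Pi.single i 1 : Fin n → ℤ)))
        = intCastHom n (L.1.index • (Pi.single i 1 : Fin n → ℤ)
          - intAct D.θ (L.1.index • (Pi.single i 1 : Fin n → ℤ))) := by
      rw [act_intCast, map_sub]
    have h3 := hw' _ ((D.toPro_mem_isotropyAlg hy).mpr ⟨_, h2⟩)
    rw [hL _ ((toPro_apply_eq_zero_iff L).mpr ⟨_, h1, rfl⟩), map_nsmul, dotProduct_smul,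
      dotProduct_single_int, nsmul_eq_mul] at h3
    exact h3.symm)
  refine ⟨μ, by rw [← hμ, hu1], fun x hx => ?_⟩
  obtain ⟨v, hv, hc, -⟩ := exists_toPro_ratChar_eq μ μ L x
  have hv' : toPro (algLattices n) v ∈ D.isotropyAlg q.y := by
    rw [D.mem_isotropyAlg_iff hy, ← algProj_eq_of_apply_eq hv]
    exact (D.mem_isotropyAlg_iff hy).mp hx
  have h1 : (⟨x, hx⟩ : D.isotropyAlg q.y) = (⟨x, hx⟩ - ⟨_, hv'⟩) + ⟨_, hv'⟩ := by abel
  change q.char ⟨x, hx⟩ = _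
  rw [h1, q.char.map_add_eq_mul, hL, one_mul, hw', hc, hμ]
  exact sub_eq_zero.mpr hv

/-- The pull-back of `τ` factors through `∨T^alg / K`, where `K` has become trivial. -/
theorem CompleteParam.ratChar_eq_one (q : D.CompleteParam K) (hK : K ≤ algPi1 n) {μ : Fin n → ℚ}
    (hμ : ∀ (x : AlgCover n) (hx : x ∈ D.isotropyAlg q.y),
        q.τ (D.toComp K q.y ⟨x, hx⟩) = ratChar μ x) : ∀ k ∈ K, ratChar μ k = 1 := by
  intro k hk
  rw [← hμ k (algPi1_le_isotropyAlg _ (hK hk)), ← q.τ.map_zero_eq_one]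
  congr 1
  have h : (⟨k, algPi1_le_isotropyAlg _ (hK hk)⟩ : D.isotropyAlg q.y)
      ∈ ((toQuotCover K).comp (D.isotropyAlg q.y).subtype).ker :=
    (QuotientAddGroup.eq_zero_iff k).mpr hk
  refine (congrArg (QuotientAddGroup.mk' _) ?_).trans (map_zero _)
  exact Subtype.ext h

/-- From `μ = (1 - θᵀ) (μ / 2)` one gets `⟨μ, v⟩ = ⟨μ, v - θ v⟩ / 2` with `v - θ v` integral, so
twice a common denominator of `μ` kills the character. Finiteness of its values makes it trivial on
the identity component. -/
theorem ratChar_pow_eq_one {y : E} (hy : D.rightHom y ≠ 1) {μ : Fin n → ℚ}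
    (hμ : -act D.θᵀ (ratVec μ) = ratVec μ) :
    ∃ N : ℕ, N ≠ 0 ∧ ∀ x ∈ D.isotropyAlg y, ratChar μ x ^ N = 1 := by
  obtain ⟨N, hN, k, hk⟩ := exists_common_den μ
  refine ⟨2 * N, by positivity, fun x hx => ?_⟩
  obtain ⟨v, hv, hc, -⟩ := exists_toPro_ratChar_eq μ μ (algTop n) x
  have hv' : toPro (algLattices n) v ∈ D.isotropyAlg y := by
    rw [D.mem_isotropyAlg_iff hy, ← algProj_eq_of_apply_eq hv]
    exact (D.mem_isotropyAlg_iff hy).mp hx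
  obtain ⟨m, hm⟩ := (D.toPro_mem_isotropyAlg hy).mp hv'
  rw [hc, ← zpow_natCast, ← cexp2_int_mul, eq_half_sub hμ, smul_dotProduct,
    dotProduct_sub_transpose, hm]
  have : (((2 * N : ℕ) : ℤ) : ℂ) * ((1 / 2 : ℂ) • (ratVec μ ⬝ᵥ intCastHom n m))
      = ((k ⬝ᵥ m : ℤ) : ℂ) := by
    rw [← intCast_dotProduct, ← hk, smul_dotProduct]
    push_cast
    simp only [smul_eq_mul]
    ring
  rw [this, cexp2_intCast]

/-- Construction of a complete geometric parameter from a rational character. -/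
theorem exists_completeParam {y : E} {lam : Fin n → ℂ} (hy : D.rightHom y ≠ 1)
    (hsq : y ^ 2 = D.inl (texp2 lam)) {μ : Fin n → ℚ}
    (hμ : -act D.θᵀ (ratVec μ) = ratVec μ) (hμK : ∀ k ∈ K, ratChar μ k = 1) :
    ∃ q : D.CompleteParam K, q.y = y ∧ q.lam = lam ∧
      ∀ (x : AlgCover n) (hx : x ∈ D.isotropyAlg q.y),
        q.τ (D.toComp K q.y ⟨x, hx⟩) = ratChar μ x := by
  let G : AlgCover n ⧸ K → ℂ := fun u => Quotient.liftOn' u (ratChar μ) (by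
    intro x x' hxx
    have h1 := hμK _ (QuotientAddGroup.leftRel_apply.mp hxx)
    have h2 : x' = x + (-x + x') := by abel
    rw [h2, ratChar_add, h1, mul_one])
  have hGcont : Continuous G := Continuous.quotient_liftOn' (ratChar_continuous μ) _
  have hG0 : G 0 = 1 := (ratAddChar μ).map_zero_eq_one
  have hGadd : ∀ u w, G (u + w) = G u * G w := by
    intro u w
    induction u using QuotientAddGroup.induction_on with
    | H u =>
      induction w using QuotientAddGroup.induction_on with
      | H w => exact ratChar_add μ u w
  let G' : AddChar (D.isotropyQ K y) ℂ := ⟨fun x => G x.1, hG0, fun x x' => hGadd _ _⟩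
  have hG'cont : Continuous G' := hGcont.comp continuous_subtype_val
  -- The image of the identity component is connected and contained in a finite set of roots of
  -- unity, hence a point.
  have hG' : ∀ x ∈ AddSubgroup.connectedComponentOfZero (D.isotropyQ K y), G' x = 1 := by
    intro x hx
    obtain ⟨N, hN, hNx⟩ := ratChar_pow_eq_one hy hμ
    have h1 : IsPreconnected (G' '' connectedComponent 0) :=
      isPreconnected_connectedComponent.image _ hG'cont.continuousOn
    have h2 : G' '' connectedComponent 0 ⊆ {ζ : ℂ | ζ ^ N = 1} := by
      rintro _ ⟨⟨_, z, hz, rfl⟩, -, rfl⟩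
      exact hNx z hz
    have h3 := (finite_setOf_pow_eq_one hN).countable.isTotallyDisconnected _ h2 h1
    have h4 := h3 ⟨x, hx, rfl⟩ ⟨0, mem_connectedComponent, rfl⟩
    rw [h4, G'.map_zero_eq_one]
  let T : D.CompGroup K y → ℂ := fun c => Quotient.liftOn' c G' (by
    intro x x' hxx
    have h1 := hG' _ (QuotientAddGroup.leftRel_apply.mp hxx)
    have h2 : x' = x + (-x + x') := by abel
    rw [h2, G'.map_add_eq_mul, h1, mul_one])
  have hTadd : ∀ u w, T (u + w) = T u * T w := by
    intro u w
    induction u using QuotientAddGroup.induction_on with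
    | H u =>
      induction w using QuotientAddGroup.induction_on with
      | H w => exact G'.map_add_eq_mul u w
  exact ⟨⟨y, lam, hy, hsq, ⟨T, G'.map_zero_eq_one, hTadd⟩,
    Continuous.quotient_liftOn' hG'cont _⟩, rfl, rfl, fun x hx => rfl⟩

/-- For the direct implication, the test elements are the halves `m / 2` with `θ m = -m`, which lie
in the isotropy group. They show that half the difference of `μ` and `μ'` is integral on the fixed
lattice of `-θ`. Applying `1 - θᵀ` to the resulting decomposition kills the complex part and
recovers the difference. -/
theorem ratChar_eq_iff {y : E} (hy : D.rightHom y ≠ 1) {μ μ' : Fin n → ℚ}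
    (hμ : -act D.θᵀ (ratVec μ) = ratVec μ) (hμ' : -act D.θᵀ (ratVec μ') = ratVec μ') :
    (∀ x ∈ D.isotropyAlg y, ratChar μ x = ratChar μ' x) ↔
      ∃ m, ratVec μ = ratVec μ' + (intCastHom n m - act D.θᵀ (intCastHom n m)) := by
  constructor
  · intro h
    set η := ratVec μ - ratVec μ' with hη
    have hη1 : -act D.θᵀ η = η := by
      rw [hη, act_sub, neg_sub', hμ, hμ']
    obtain ⟨w, k, hwk⟩ := exists_of_integral_on_fixed D.neg_θ_mul ((1 / 2 : ℂ) • η) (by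
      intro m hm
      have h1 : (1 / 2 : ℂ) • intCastHom n m - act D.θ ((1 / 2 : ℂ) • intCastHom n m)
          = intCastHom n m := by
        rw [sub_eq_add_neg, ← act_neg_left, act_smul, hm]
        module
      have h2 := h _ ((D.toPro_mem_isotropyAlg hy).mpr ⟨m, h1⟩)
      rw [ratChar_toPro, ratChar_toPro, cexp2_eq_iff] at h2
      obtain ⟨l, hl⟩ := h2
      refine ⟨l, ?_⟩
      rw [smul_dotProduct, ← dotProduct_smul, hη, sub_dotProduct, hl]
      ring)
    refine ⟨k, ?_⟩
    have h1 : D.θᵀ * D.θᵀ = 1 := by rw [← Matrix.transpose_mul, D.θ_mul_θ, Matrix.transpose_one]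
    rw [Matrix.transpose_neg, act_neg_left] at hwk
    have h2 : η = (1 / 2 : ℂ) • η - act D.θᵀ ((1 / 2 : ℂ) • η) := by
      rw [act_smul, ← smul_sub]
      exact eq_half_sub hη1
    rw [← sub_eq_iff_eq_add', ← hη, h2, hwk]
    simp only [act_add, act_sub, act_neg, act_involutive h1]
    abel
  · rintro ⟨m, hm⟩ x hx
    obtain ⟨v, hv, hc, hc'⟩ := exists_toPro_ratChar_eq μ μ' (algTop n) x
    have hv' : toPro (algLattices n) v ∈ D.isotropyAlg y := by
      rw [D.mem_isotropyAlg_iff hy, ← algProj_eq_of_apply_eq hv]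
      exact (D.mem_isotropyAlg_iff hy).mp hx
    obtain ⟨k, hk⟩ := (D.toPro_mem_isotropyAlg hy).mp hv'
    rw [hc, hc', hm, add_dotProduct, dotProduct_sub_transpose, hk, intCast_dotProduct, cexp2_add,
      cexp2_intCast, mul_one]

end EGroup

variable {E E' : Type*} [Group E] [Group E']

/-! ### Strong real forms up to conjugacy -/

namespace ExtendedGroup

variable {S : ExtendedGroup n E}

/-- Forms over different base points of `W` can be compared over a single one. -/
theorem conj_inl_mul_W {δ₀ δ₁ : E} (h₀ : δ₀ ∈ S.W) (h₁ : δ₁ ∈ S.W) (v : Fin n → ℂ) :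
    ∃ w : Fin n → ℂ, S.inl (texp2 v) * δ₁
      = S.inl (texp2 w) * (S.inl (texp2 v) * δ₀) * (S.inl (texp2 w))⁻¹ := by
  obtain ⟨t, rfl⟩ := S.W_conj h₀ h₁
  obtain ⟨w, rfl⟩ := texp2_surjective t
  have h := S.conj_inl_mul (S.W_strong h₀).1 w 0
  rw [texp2_zero, map_one, one_mul, zero_add] at h
  exact ⟨w, by rw [S.conj_inl_mul (S.W_strong h₀).1, h, texp2_add v, map_mul, mul_assoc]⟩

/-- Conjugation by `exp (2 π i u)` adds `u + a (conj u)` to the exponent. When `1 - a` is applied to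
the resulting equation, one side is real and the other is purely imaginary, because it is the image
of `u - conj u`. Both vanish, and only the integral ambiguity of the exponent remains. -/
theorem conj_forms_iff {δ₀ δ₁ : E} (h₀ : δ₀ ∈ S.W) (h₁ : δ₁ ∈ S.W) {μ μ' : Fin n → ℚ}
    (hμ : -act S.a (ratVec μ) = ratVec μ) (hμ' : -act S.a (ratVec μ') = ratVec μ') :
    (∃ g : Torus n, S.inl g * (S.inl (texp2 ((1 / 2 : ℂ) • ratVec μ)) * δ₀) * (S.inl g)⁻¹
        = S.inl (texp2 ((1 / 2 : ℂ) • ratVec μ')) * δ₁) ↔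
      ∃ m, ratVec μ' = ratVec μ + (intCastHom n m - act S.a (intCastHom n m)) := by
  have hδ := (S.W_strong h₀).1
  obtain ⟨w, hw⟩ := conj_inl_mul_W h₀ h₁ ((1 / 2 : ℂ) • ratVec μ')
  constructor
  · rintro ⟨g, hg⟩
    obtain ⟨u, rfl⟩ := texp2_surjective g
    rw [hw, S.conj_inl_mul hδ, S.conj_inl_mul hδ, mul_left_inj] at hg
    obtain ⟨m, hm⟩ := texp2_eq_iff.mp (S.inl_injective hg)
    refine ⟨-m, ?_⟩
    set r := (u - w) - star (u - w) with hr
    have h1 : (1 / 2 : ℂ) • (ratVec μ' - ratVec μ) + intCastHom n m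
        = (u - w) + act S.a (star (u - w)) := by
      rw [star_sub, act_sub, smul_sub]
      have : (1 / 2 : ℂ) • ratVec μ = (1 / 2 : ℂ) • ratVec μ' + (w + act S.a (star w))
          + intCastHom n m - (u + act S.a (star u)) := eq_sub_of_add_eq hm
      rw [this]
      abel
    have h2 := congrArg (act S.a) h1
    simp only [act_add, act_smul, act_sub S.a (ratVec μ'), act_involutive S.a_mul_a] at h2
    have h3 : act S.a (ratVec μ) = -ratVec μ := neg_eq_iff_eq_neg.mp hμ
    have h3' : act S.a (ratVec μ') = -ratVec μ' := neg_eq_iff_eq_neg.mp hμ'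
    rw [h3, h3'] at h2
    have h4 : ratVec μ' - ratVec μ + (intCastHom n m - act S.a (intCastHom n m))
        = r - act S.a r := by
      have e : ratVec μ' - ratVec μ + (intCastHom n m - act S.a (intCastHom n m))
        = ((1 / 2 : ℂ) • (ratVec μ' - ratVec μ) + intCastHom n m)
          - ((1 / 2 : ℂ) • (-ratVec μ' - -ratVec μ) + act S.a (intCastHom n m)) := by
        module
      rw [e, h1, h2, hr, act_sub S.a (u - w)]
      abel
    have h5 : star (r - act S.a r) = -(r - act S.a r) := by
      have : star r = -r := by rw [hr, star_sub, star_star, neg_sub]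
      rw [star_sub, ← act_star, this, act_neg]
      abel
    have h6 : star (r - act S.a r) = r - act S.a r := by
      rw [← h4, star_add, star_sub, star_sub, star_ratVec, star_ratVec, ← act_star, star_intCastHom]
    rw [h6] at h5
    have h7 : r - act S.a r = 0 := self_eq_neg.mp h5
    rw [h7] at h4
    rw [map_neg, act_neg, ← sub_eq_iff_eq_add', eq_neg_of_add_eq_zero_left h4]
    abel
  · rintro ⟨m, hm⟩
    -- Conjugation by `exp (-π i m)` adds `-(m + a m) / 2`, which differs from the wanted `(m - a m)
    -- / 2` by the integral vector `m`.
    refine ⟨texp2 w * texp2 ((1 / 2 : ℂ) • (-intCastHom n m)), ?_⟩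
    have h1 := S.conj_inl_mul hδ ((1 / 2 : ℂ) • (-intCastHom n m)) ((1 / 2 : ℂ) • ratVec μ)
    have h2 : texp2 ((1 / 2 : ℂ) • ratVec μ') = texp2 ((1 / 2 : ℂ) • ratVec μ +
        ((1 / 2 : ℂ) • (-intCastHom n m) + act S.a (star ((1 / 2 : ℂ) • (-intCastHom n m))))) := by
      rw [texp2_eq_iff]
      refine ⟨m, ?_⟩
      have : star ((1 / 2 : ℂ) • (-intCastHom n m)) = (1 / 2 : ℂ) • (-intCastHom n m) := by
        ext i
        simp [intCastHom]
      rw [hm, this, act_smul, act_neg]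
      module
    rw [hw, h2, ← h1, map_mul]
    group

theorem inl_mem_center {μ : Fin n → ℚ} (hμ : -act S.a (ratVec μ) = ratVec μ) :
    S.inl (texp2 (ratVec μ)) ∈ Subgroup.center E := by
  rw [Subgroup.mem_center_iff]
  intro g
  by_cases hg : S.rightHom g = 1
  · obtain ⟨t, rfl⟩ := exists_inl_of_eq_one S.toGroupExtension hg
    rw [← map_mul, ← map_mul, mul_comm]
  · rw [S.mul_inl hg, star_ratVec, hμ]

theorem form_sq {δ₀ : E} (h₀ : δ₀ ∈ S.W) {μ : Fin n → ℚ} (hμ : -act S.a (ratVec μ) = ratVec μ) :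
    (S.inl (texp2 ((1 / 2 : ℂ) • ratVec μ)) * δ₀) ^ 2 = S.inl (texp2 (ratVec μ)) * δ₀ ^ 2 := by
  have hs : star ((1 / 2 : ℂ) • ratVec μ) = (1 / 2 : ℂ) • ratVec μ := by
    ext i
    simp [ratVec]
  rw [S.sq_inl_mul (S.W_strong h₀).1, hs, act_smul, neg_eq_iff_eq_neg.mp hμ]
  congr 3
  module

theorem isOfFinOrder_texp2 (μ : Fin n → ℚ) : IsOfFinOrder (texp2 (ratVec μ)) := by
  obtain ⟨N, hN, m, hm⟩ := exists_common_den μ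
  rw [isOfFinOrder_iff_pow_eq_one]
  exact ⟨N, Nat.pos_of_ne_zero hN, by rw [← texp2_nsmul, hm, texp2_intCast]⟩

theorem form_strong {δ₀ : E} (h₀ : δ₀ ∈ S.W) {μ : Fin n → ℚ}
    (hμ : -act S.a (ratVec μ) = ratVec μ) :
    S.IsStrongRealForm (S.inl (texp2 ((1 / 2 : ℂ) • ratVec μ)) * δ₀) := by
  obtain ⟨h1, h2, h3⟩ := S.W_strong h₀
  refine ⟨?_, ?_, ?_⟩
  · rw [rightHom_inl_mul]
    exact h1
  · rw [form_sq h₀ hμ]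
    exact mul_mem (inl_mem_center hμ) h2
  · rw [form_sq h₀ hμ]
    have hc : Commute (S.inl (texp2 (ratVec μ))) (δ₀ ^ 2) := Subgroup.mem_center_iff.mp h2 _
    exact hc.isOfFinOrder_mul (S.inl.isOfFinOrder (isOfFinOrder_texp2 μ)) h3

/-- Write `δ = exp (2 π i v) δ₀`. Squaring shows that `μ = v - a (conj v)` is congruent to `c`
modulo `ℤⁿ`, so it is rational. Being real, it equals its conjugate `conj v - a v`, whence `a μ =
-μ`. Conjugation by `exp (-π i v)` then replaces `v` by `μ / 2`. -/
theorem exists_form {δ δ₀ : E} (hδ : S.rightHom δ ≠ 1) (h₀ : δ₀ ∈ S.W) {c : Fin n → ℚ}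
    (hc : δ ^ 2 = δ₀ ^ 2 * S.inl (texp2 (ratVec c))) :
    ∃ (μ : Fin n → ℚ) (m : Fin n → ℤ), ratVec μ = ratVec c + intCastHom n m ∧
      -act S.a (ratVec μ) = ratVec μ ∧
      ∃ g : Torus n, S.inl g * δ * (S.inl g)⁻¹
        = S.inl (texp2 ((1 / 2 : ℂ) • ratVec μ)) * δ₀ := by
  obtain ⟨h1, h2, h3⟩ := S.W_strong h₀
  obtain ⟨t, rfl⟩ := exists_inl_mul_of_ne S.toGroupExtension hδ h1
  obtain ⟨v, rfl⟩ := texp2_surjective t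
  rw [S.sq_inl_mul h1, ← Subgroup.mem_center_iff.mp h2, mul_left_inj] at hc
  obtain ⟨m, hm⟩ := texp2_eq_iff.mp (S.inl_injective hc)
  have hμ : ratVec (c + fun i => (m i : ℚ)) = v - act S.a (star v) := by
    rw [hm, ratVec_add]
    congr 1
  refine ⟨c + fun i => (m i : ℚ), m, hμ.trans hm, ?_,
    texp2 ((1 / 2 : ℂ) • (-v)), ?_⟩
  · have h4 := star_ratVec (c + fun i => (m i : ℚ))
    rw [hμ, star_sub, ← act_star, star_star] at h4
    rw [hμ]
    nth_rewrite 1 [← h4]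
    rw [act_sub, act_involutive S.a_mul_a, neg_sub]
  · rw [S.conj_inl_mul h1, hμ]
    have : star ((1 / 2 : ℂ) • (-v)) = (1 / 2 : ℂ) • (-star v) := by
      ext i
      simp
    rw [this, act_smul, act_neg]
    congr 3
    module

end ExtendedGroup

/-! ### Parameters in exponential form -/

namespace EGroup

variable {D : EGroup n E'}

theorem eq_of_langlands {y d : E'} {lam X : Fin n → ℂ}
    (h : D.inl (texp (-((Real.pi : ℂ) * Complex.I) • lam)) * y = D.inl (texp2 X) * d) :
    y = D.inl (texp2 ((1 / 2 : ℂ) • lam + X)) * d := by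
  rw [texp_neg_pi, texp2_neg, map_inv, inv_mul_eq_iff_eq_mul] at h
  rw [h, texp2_add, map_mul, mul_assoc]

theorem langlands_of_eq {y d : E'} {lam X : Fin n → ℂ}
    (h : y = D.inl (texp2 ((1 / 2 : ℂ) • lam + X)) * d) :
    D.inl (texp (-((Real.pi : ℂ) * Complex.I) • lam)) * y = D.inl (texp2 X) * d := by
  rw [texp_neg_pi, texp2_neg, map_inv, inv_mul_eq_iff_eq_mul, h, texp2_add, map_mul, mul_assoc]

/-- This ties the two sides together: with `y` written over `d`, the equation `y² = exp (2 π i lam)`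
is equivalent to `exp (2 π i ν) = z`. -/
theorem sq_iff {d : E'} (hd : d ∈ D.D) {z : Torus n} (hz : D.IsSecondInvariant z)
    (lam X : Fin n → ℂ) :
    (D.inl (texp2 ((1 / 2 : ℂ) • lam + X)) * d) ^ 2 = D.inl (texp2 lam) ↔
      texp2 ((1 / 2 : ℂ) • (lam - act D.θ lam) - (X + act D.θ X)) = z := by
  obtain ⟨w, rfl⟩ := texp2_surjective z
  rw [D.sq_inl_mul (D.D_rightHom hd), hz d hd, ← map_mul, D.inl_injective.eq_iff, ← texp2_add,
    texp2_eq_iff, texp2_eq_iff]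
  constructor
  · rintro ⟨m, hm⟩
    refine ⟨-m, ?_⟩
    rw [← sub_eq_zero] at hm ⊢
    rw [← neg_eq_zero, ← hm, map_neg, act_add, act_smul]
    module
  · rintro ⟨m, hm⟩
    refine ⟨-m, ?_⟩
    rw [← sub_eq_zero] at hm ⊢
    rw [← neg_eq_zero, ← hm, map_neg, act_add, act_smul]
    module

theorem θ_second (D : EGroup n E') {z : Torus n} (hz : D.IsSecondInvariant z) :
    powMap D.θ z = z := by
  obtain ⟨d, hd, -⟩ := D.D_nonempty
  apply D.inl_injective
  rw [← D.conj_eq d (D.D_rightHom hd), ← hz d hd]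
  group

theorem finOrder_second (D : EGroup n E') {z : Torus n} (hz : D.IsSecondInvariant z) :
    IsOfFinOrder z := by
  obtain ⟨d, hd, hfin⟩ := D.D_nonempty
  rw [← D.inl_injective.isOfFinOrder_iff, ← hz d hd]
  exact hfin.pow

/-- A change of base point in `D` costs a term in the image of `1 - θ`. -/
theorem langlands_conj {y d d' : E'} (hd : d ∈ D.D) (hd' : d' ∈ D.D) {c : Fin n → ℂ}
    (h : y = D.inl (texp2 c) * d') :
    ∃ w, y = D.inl (texp2 (c + (w - act D.θ w))) * d := by
  obtain ⟨t, rfl⟩ := D.D_conj hd hd'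
  obtain ⟨w, rfl⟩ := texp2_surjective t
  refine ⟨w, ?_⟩
  have h1 := D.conj_inl_mul (D.D_rightHom hd) w 0
  rw [texp2_zero, map_one, one_mul, zero_add] at h1
  rw [h, h1, texp2_add, map_mul, mul_assoc]

end EGroup

variable {S : ExtendedGroup n E} {D : EGroup n E'} {K : AddSubgroup (AlgCover n)}

/-! ### Invariance of the correspondence under equivalence -/

theorem realCan_eq {δ δ' : E} (h : S.rightHom δ ≠ 1) (h' : S.rightHom δ' ≠ 1) :
    S.realCan δ = S.realCan δ' := by
  ext x
  rw [S.mem_realCan_iff h, S.mem_realCan_iff h']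

theorem isotropyAlg_eq {y y' : E'} (h : D.rightHom y ≠ 1) (h' : D.rightHom y' ≠ 1) :
    D.isotropyAlg y = D.isotropyAlg y' := by
  ext x
  rw [D.mem_isotropyAlg_iff h, D.mem_isotropyAlg_iff h']

theorem CorrespondsChar.congr {p p' : S.ProjRep} {q q' : D.CompleteParam K} (hp : p ≈ p')
    (hq : q ≈ q') (h : CorrespondsChar S D p q) : CorrespondsChar S D p' q' := by
  obtain ⟨d, hd, X, h1, h2, h3⟩ := h
  obtain ⟨-, hπ⟩ := hp
  obtain ⟨⟨g, hg⟩, hlam, -⟩ := hq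
  have hr := realCan_eq (S := S) p.strong.1 p'.strong.1
  refine ⟨_, D.conj_mem_D hd g, X, ?_, fun v hv s => ?_, fun v hv => ?_⟩
  · rw [← hg, ← hlam]
    have hc : ∀ s t : Torus n, ∀ y : E', D.inl s * (D.inl t * y * (D.inl t)⁻¹)
        = D.inl t * (D.inl s * y) * (D.inl t)⁻¹ := by
      intro s t y
      rw [← mul_assoc, ← mul_assoc, ← map_mul, mul_comm s t, map_mul, mul_assoc (D.inl t)]
    rw [hc, hc, h1]
  · rw [← hπ _ (hr ▸ hv s) (hv s), h2 v (fun s => hr ▸ hv s) s, hlam]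
  · rw [← hπ _ (hr ▸ hv) hv, h3 v (hr ▸ hv), hlam]

theorem CorrespondsForm.congr {p p' : S.ProjRep} {q q' : D.CompleteParam K} (hp : p ≈ p')
    (hq : q ≈ q') (h : CorrespondsForm S D p q) : CorrespondsForm S D p' q' := by
  obtain ⟨δ₀, h₀, μ, h1, ⟨g, hg⟩, h3⟩ := h
  obtain ⟨⟨t, ht⟩, -⟩ := hp
  obtain ⟨-, -, hτ⟩ := hq
  have hr := isotropyAlg_eq (D := D) q.rightHom_y q'.rightHom_y
  refine ⟨δ₀, h₀, μ, h1, ⟨g * t⁻¹, ?_⟩, fun x hx => ?_⟩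
  · rw [← hg, ← ht, map_mul, map_inv]
    group
  · rw [← hτ x (hr ▸ hx) hx, h3]

theorem LLC_mk_iff {p : S.ProjRep} {q : D.CompleteParam K} :
    LLC S D (Quotient.mk _ p : S.RepClass) (Quotient.mk _ q : D.Xi K) ↔
      CorrespondsChar S D p q ∧ CorrespondsForm S D p q := by
  constructor
  · rintro ⟨p', q', hp, hq, h1, h2⟩
    exact ⟨h1.congr (Quotient.exact hp) (Quotient.exact hq),
      h2.congr (Quotient.exact hp) (Quotient.exact hq)⟩
  · exact fun h => ⟨p, q, rfl, rfl, h⟩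

/-! ### Injectivity of the correspondence -/

/-- The Lie algebra of the real points spans `ℂⁿ` over `ℂ`: for integral `u` it contains `u - a u`
and `i (u + a u)`. -/
theorem eq_of_forall_fixed {a : Matrix (Fin n) (Fin n) ℤ} (ha : a * a = 1) {lam lam' : Fin n → ℂ}
    (h : ∀ v, v + act a (star v) = 0 → lam ⬝ᵥ v = lam' ⬝ᵥ v) : lam = lam' := by
  apply eq_of_dotProduct_intCast
  intro m
  set u := intCastHom n m with hu
  have hs : star u = u := star_intCastHom m
  have h1 := h (u - act a u) (by
    rw [star_sub, ← act_star, hs, act_sub, act_involutive ha]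
    abel)
  have h2 := h (Complex.I • (u + act a u)) (by
    have : star (Complex.I • (u + act a u)) = -Complex.I • (u + act a u) := by
      have h3 : star (Complex.I • (u + act a u)) = -Complex.I • star (u + act a u) := by
        ext i
        simp
        ring
      rw [h3, star_add, ← act_star, hs]
    rw [this, act_smul, act_add, act_involutive ha]
    module)
  rw [dotProduct_smul, dotProduct_smul, smul_eq_mul, smul_eq_mul,
    mul_right_inj' Complex.I_ne_zero, dotProduct_add, dotProduct_add] at h2
  rw [dotProduct_sub, dotProduct_sub] at h1
  linear_combination (1 / 2 : ℂ) * h1 + (1 / 2 : ℂ) * h2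

theorem HasDifferential.unique {p : S.ProjRep} {lam lam' : Fin n → ℂ}
    (h : HasDifferential S p lam) (h' : HasDifferential S p lam') : lam = lam' := by
  refine eq_of_forall_fixed S.a_mul_a fun v hv => eq_of_cexp2_real_mul fun s => ?_
  have hm := fun s : ℝ => ExtendedGroup.mem_realCan_of_fixed p.strong.1
    (ExtendedGroup.smul_fixed s hv)
  rw [← ExtendedGroup.exp_eq_cexp2, ← ExtendedGroup.exp_eq_cexp2, ← h v hm, ← h' v hm]

/-- The test point is `exp (π i m)` with `a m = m`: for `x = m / 2` one has `x + a x = m`, so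
comparing the two formulas isolates `⟨X - X', m⟩`. -/
theorem HasCompactRestriction.integral {p : S.ProjRep} {lam X X' : Fin n → ℂ}
    (h : HasCompactRestriction S p ((1 / 2 : ℂ) • (lam - act S.aᵀ lam) - (X + act S.aᵀ X)))
    (h' : HasCompactRestriction S p ((1 / 2 : ℂ) • (lam - act S.aᵀ lam) - (X' + act S.aᵀ X')))
    {m : Fin n → ℤ} (hm : act S.a (intCastHom n m) = intCastHom n m) :
    ∃ k : ℤ, (X - X') ⬝ᵥ intCastHom n m = k := by
  set x : Fin n → ℝ := fun i => (1 / 2 : ℝ) * m i with hx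
  have hxm : (fun i => (x i : ℂ)) = (1 / 2 : ℂ) • intCastHom n m := by
    ext i
    simp [hx, intCastHom]
  have hxs : star (fun i => (x i : ℂ)) = fun i => (x i : ℂ) := by
    ext i
    simp
  have hx2 : (fun i => (x i : ℂ)) + act S.a (fun i => (x i : ℂ)) = intCastHom n m := by
    rw [hxm, act_smul, hm]
    module
  have hmem : toPro (canLattices S.a) (fun i => (x i : ℂ)) ∈ S.realCan p.δ :=
    (S.toPro_mem_realCan p.strong.1).mpr ⟨m, by rw [hxs, hx2]⟩
  have h1 := (h x hmem).symm.trans (h' x hmem)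
  change cexp2 _ = cexp2 _ at h1
  obtain ⟨k, hk⟩ := cexp2_eq_iff.mp h1
  refine ⟨-k, ?_⟩
  rw [sub_dotProduct, sub_dotProduct, dotProduct_add_transpose, dotProduct_add_transpose, hx2] at hk
  rw [sub_dotProduct]
  push_cast
  linear_combination -hk

theorem isSecond_of_corresponds (hD : D.IsFor S) {z : Torus n} (hz : D.IsSecondInvariant z)
    {q : D.CompleteParam K} {d : E'} (hd : d ∈ D.D) {X : Fin n → ℂ}
    (h : q.y = D.inl (texp2 ((1 / 2 : ℂ) • q.lam + X)) * d) :
    texp2 ((1 / 2 : ℂ) • (q.lam - act S.aᵀ q.lam) - (X + act S.aᵀ X)) = z := by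
  have hθ : D.θ = S.aᵀ := hD
  rw [← hθ, ← EGroup.sq_iff hd hz, ← h, q.sq_y]

theorem param_unique (hD : D.IsFor S) {p : S.ProjRep} {q q' : D.CompleteParam K}
    (h : CorrespondsChar S D p q) (hf : CorrespondsForm S D p q)
    (h' : CorrespondsChar S D p q') (hf' : CorrespondsForm S D p q') : q ≈ q' := by
  have hθ : D.θ = S.aᵀ := hD
  have hθ' : D.θᵀ = S.a := by rw [hθ, Matrix.transpose_transpose]
  obtain ⟨d, hd, X, h1, h2, h3⟩ := h
  obtain ⟨d', hd', X', h1', h2', h3'⟩ := h'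
  obtain ⟨δ₀, h₀, μ, hμ, ⟨g, hg⟩, hτ⟩ := hf
  obtain ⟨δ₁, h₀', μ', hμ', ⟨g', hg'⟩, hτ'⟩ := hf'
  have hlam : q.lam = q'.lam := h2.unique h2'
  have hr := isotropyAlg_eq (D := D) q.rightHom_y q'.rightHom_y
  refine ⟨?_, hlam, fun x hx hx' => ?_⟩
  · rw [hθ] at h3 h3'
    have hy := EGroup.eq_of_langlands h1
    obtain ⟨w, hy'⟩ := EGroup.langlands_conj hd hd' (EGroup.eq_of_langlands h1')
    rw [← hlam] at hy' h3'
    -- The part `u - θ u` of the difference is absorbed by conjugation and `k` by the kernel of the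
    -- exponential.
    obtain ⟨u, k, huk⟩ := exists_of_integral_on_fixed S.a_mul_a (X' - X)
      fun m hm => h3'.integral h3 hm
    refine ⟨texp2 (u + w), ?_⟩
    rw [hy, hy', D.conj_inl_mul (D.D_rightHom hd)]
    congr 2
    rw [texp2_eq_iff]
    refine ⟨-k, ?_⟩
    rw [map_neg, hθ, act_add, eq_add_of_sub_eq huk]
    abel
  · rw [hτ x hx, hτ' x hx']
    rw [← hθ'] at hμ hμ'
    refine (EGroup.ratChar_eq_iff q.rightHom_y hμ hμ').mpr ?_ x hx
    rw [hθ'] at hμ hμ' ⊢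
    refine (ExtendedGroup.conj_forms_iff h₀' h₀ hμ' hμ).mp ⟨g * g'⁻¹, ?_⟩
    rw [texp_pi] at hg hg'
    rw [← hg, ← hg', map_mul, map_inv]
    group

/-- The two values of `X` obtained from the same `y` differ by an element of `(1 - θ) ℂⁿ + ℤⁿ`. The
first summand does not affect `X + θ X`. The integral one pairs with the real part of `v` through an
integral vector, so the logarithms differ by an integer. -/
theorem rep_unique (hD : D.IsFor S) {p p' : S.ProjRep} {q : D.CompleteParam K}
    (h : CorrespondsChar S D p q) (hf : CorrespondsForm S D p q)
    (h' : CorrespondsChar S D p' q) (hf' : CorrespondsForm S D p' q) : p ≈ p' := by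
  have hθ : D.θ = S.aᵀ := hD
  have hθ' : D.θᵀ = S.a := by rw [hθ, Matrix.transpose_transpose]
  obtain ⟨d, hd, X, h1, h2, h3⟩ := h
  obtain ⟨d', hd', X', h1', h2', h3'⟩ := h'
  obtain ⟨δ₀, h₀, μ, hμ, ⟨g, hg⟩, hτ⟩ := hf
  obtain ⟨δ₁, h₀', μ', hμ', ⟨g', hg'⟩, hτ'⟩ := hf'
  constructor
  · rw [texp_pi] at hg hg'
    have h4 : ∃ m, ratVec μ' = ratVec μ + (intCastHom n m - act S.a (intCastHom n m)) := by
      rw [← hθ'] at hμ hμ' ⊢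
      exact (EGroup.ratChar_eq_iff q.rightHom_y hμ' hμ).mp fun x hx =>
        (hτ' x hx).symm.trans (hτ x hx)
    obtain ⟨t, ht⟩ := (ExtendedGroup.conj_forms_iff h₀ h₀' hμ hμ').mpr h4
    refine ⟨g'⁻¹ * t * g, ?_⟩
    have h5 : p'.δ = (S.inl g')⁻¹ * (S.inl g' * p'.δ * (S.inl g')⁻¹) * S.inl g' := by group
    rw [h5, hg', ← ht, ← hg, map_mul, map_mul, map_inv]
    group
  · refine p.apply_eq_of_toPro p' fun v hv hv' => ?_
    rw [hθ] at h3 h3'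
    rw [ExtendedGroup.pairing_of_hasDifferential h2 h3,
      ExtendedGroup.pairing_of_hasDifferential h2' h3']
    have hy := EGroup.eq_of_langlands h1
    obtain ⟨w, hy'⟩ := EGroup.langlands_conj hd hd' (EGroup.eq_of_langlands h1')
    rw [hy, mul_left_inj, D.inl_injective.eq_iff] at hy'
    obtain ⟨k, hk⟩ := texp2_eq_iff.mp hy'
    have hX : X = X' + (w - act S.aᵀ w) + intCastHom n k := by
      rw [hθ, add_assoc, add_assoc, add_right_inj] at hk
      rw [hk, add_assoc]
    have ht : S.aᵀ * S.aᵀ = 1 := by rw [← Matrix.transpose_mul, S.a_mul_a, Matrix.transpose_one]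
    have hXX : X + act S.aᵀ X = (X' + act S.aᵀ X')
        + (intCastHom n k + act S.aᵀ (intCastHom n k)) := by
      rw [hX, act_add, act_add, act_sub, act_involutive ht]
      abel
    obtain ⟨m, hm⟩ := (S.toPro_mem_realCan p.strong.1).mp hv
    have hm' : star v + act S.a v = intCastHom n m := by
      have := congrArg star hm
      rwa [star_intCastHom, star_add, ← act_star, star_star] at this
    have hx : (1 / 2 : ℂ) • (v + star v) + act S.a ((1 / 2 : ℂ) • (v + star v))
        = intCastHom n m := by
      have : (1 / 2 : ℂ) • (v + star v) + act S.a ((1 / 2 : ℂ) • (v + star v))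
          = (1 / 2 : ℂ) • ((v + act S.a (star v)) + (star v + act S.a v)) := by
        rw [act_smul, act_add]
        module
      rw [this, hm, hm']
      module
    rw [cexp2_eq_iff]
    refine ⟨-(k ⬝ᵥ m), ?_⟩
    rw [Int.cast_neg, ← intCast_dotProduct, ← hx, ← dotProduct_add_transpose, realPairing,
      realPairing, hXX]
    simp only [sub_dotProduct, add_dotProduct]
    ring

/-! ### Existence -/

/-- Lattice vectors are real, so the compact restriction already computes `π` on the image of
`π₁(T)`. -/
theorem isOfType_iff {z : Torus n} {p : S.ProjRep} {ν : Fin n → ℂ}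
    (h : HasCompactRestriction S p ν) : S.IsOfType z p ↔ texp2 ν = z := by
  obtain ⟨ζ, rfl⟩ := texp2_surjective z
  have h1 : ∀ m, p.π ⟨toPro (canLattices S.a) (intCastHom n m), S.toPro_intCast_mem p.δ m⟩
      = cexp2 (ν ⬝ᵥ intCastHom n m) := by
    intro m
    have hm : (fun i => (((m i : ℝ)) : ℂ)) = intCastHom n m := by
      ext i
      simp [intCastHom]
    have h2 := h (fun i => m i) (by
      rw [hm]
      exact S.toPro_intCast_mem p.δ m)
    simp only [hm] at h2
    exact h2
  unfold ExtendedGroup.IsOfType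
  simp only [h1, prod_texp2_zpow]
  constructor
  · intro h2
    ext i
    have := h2 (Pi.single i 1)
    rwa [dotProduct_single_int, dotProduct_single_int] at this
  · intro h2 m
    rw [← prod_texp2_zpow, ← prod_texp2_zpow, h2]

theorem exists_param (hD : D.IsFor S) {z : Torus n} (hz : D.IsSecondInvariant z)
    (hK : K ≤ algPi1 n) {P : S.RepClass} (hP : P ∈ S.repSet z K) : ∃ x : D.Xi K, LLC S D P x := by
  have hθ : D.θ = S.aᵀ := hD
  have hθ' : D.θᵀ = S.a := by rw [hθ, Matrix.transpose_transpose]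
  obtain ⟨p, rfl, htype, δ₀, h₀, j, ⟨c, rfl, hc⟩, hsq⟩ := hP
  obtain ⟨lam, X, h1, h2⟩ := p.exists_log
  obtain ⟨d, hd, -⟩ := D.D_nonempty
  have hz' := (isOfType_iff h2).mp htype
  rw [← hθ] at hz' h2
  obtain ⟨μ, m, hμc, hμ, hg⟩ := ExtendedGroup.exists_form p.strong.1 h₀ hsq
  have hμK : ∀ k ∈ K, ratChar μ k = 1 := fun k hk => by
    rw [ratChar_eq_of_sub_int hμc (hK hk), hc k hk]
  obtain ⟨q, hqy, hqlam, hq⟩ := EGroup.exists_completeParam (K := K)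
    (by rw [rightHom_inl_mul]; exact D.D_rightHom hd) ((EGroup.sq_iff hd hz lam X).mpr hz')
    (by rw [hθ']; exact hμ) hμK
  refine ⟨(Quotient.mk _ q : D.Xi K), LLC_mk_iff.mpr ⟨⟨d, hd, X, ?_, ?_, ?_⟩,
    ⟨δ₀, h₀, μ, hμ, ?_, hq⟩⟩⟩
  · exact EGroup.langlands_of_eq (by rw [hqlam, hqy])
  · rwa [hqlam]
  · rwa [hqlam]
  · rwa [texp_pi]

theorem exists_rep (hD : D.IsFor S) {z : Torus n} (hz : D.IsSecondInvariant z) (x : D.Xi K) :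
    ∃ P : S.RepClass, LLC S D P x := by
  have hθ : D.θ = S.aᵀ := hD
  have hθ' : D.θᵀ = S.a := by rw [hθ, Matrix.transpose_transpose]
  induction x using Quotient.inductionOn with
  | h q =>
    obtain ⟨μ, hμ, hτ⟩ := q.exists_ratChar
    rw [hθ'] at hμ
    obtain ⟨δ₀, h₀⟩ := S.W_nonempty
    obtain ⟨d, hd, -⟩ := D.D_nonempty
    obtain ⟨t, ht⟩ := exists_inl_mul_of_ne D.toGroupExtension q.rightHom_y (D.D_rightHom hd)
    obtain ⟨w, rfl⟩ := texp2_surjective t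
    -- This `X` is forced by `y = exp (2 π i (lam / 2 + X)) d`.
    set X := w - (1 / 2 : ℂ) • q.lam with hX
    have hy : q.y = D.inl (texp2 ((1 / 2 : ℂ) • q.lam + X)) * d := by
      rw [ht, hX, add_sub_cancel]
    have hzν := isSecond_of_corresponds hD hz hd hy
    set ν := (1 / 2 : ℂ) • (q.lam - act S.aᵀ q.lam) - (X + act S.aᵀ X) with hν
    -- The two hypotheses of `exists_projRep` come from `z`, as the exponential of `ν`: it has
    -- finite order, and it is fixed by `θ` because it is a square of an element acting by `θ`.
    obtain ⟨N, hN, hzN⟩ := isOfFinOrder_iff_pow_eq_one.mp (D.finOrder_second hz)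
    have hθz := D.θ_second hz
    rw [← hzν, ← texp2_act, texp2_eq_iff, hθ] at hθz
    obtain ⟨k, hk⟩ := hθz
    rw [← hzν, ← texp2_nsmul, texp2_eq_one_iff] at hzN
    obtain ⟨l, hl⟩ := hzN
    obtain ⟨p, hpδ, hp⟩ := ExtendedGroup.exists_projRep (ExtendedGroup.form_strong h₀ hμ) ν q.lam
      hN.ne' (fun m => by
        rw [← zpow_natCast, ← cexp2_int_mul, ← smul_eq_mul, ← smul_dotProduct, Int.cast_natCast, hl,
          intCast_dotProduct, cexp2_intCast]) (fun m => by
        rw [dotProduct_act, hk, add_dotProduct, intCast_dotProduct, cexp2_add, cexp2_intCast,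
          mul_one])
    obtain ⟨h1, h2⟩ := ExtendedGroup.hasDifferential_of_pairing q.lam X hp
    refine ⟨(Quotient.mk _ p : S.RepClass), LLC_mk_iff.mpr ⟨⟨d, hd, X,
      EGroup.langlands_of_eq hy, h1, ?_⟩, ⟨δ₀, h₀, μ, hμ, ⟨1, ?_⟩, hτ⟩⟩⟩
    · rwa [hθ]
    · rw [texp_pi, hpδ]
      simp

/-- Corresponding classes automatically satisfy both conditions: the type follows from `y² = exp (2
π i lam)`, and `δ² = δ₀² exp (2 π i μ)` with `μ` trivial on `K` because `τ` is. -/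
theorem mem_repSet (hD : D.IsFor S) {z : Torus n} (hz : D.IsSecondInvariant z)
    (hK : K ≤ algPi1 n) {P : S.RepClass} {x : D.Xi K} (h : LLC S D P x) : P ∈ S.repSet z K := by
  have hθ : D.θ = S.aᵀ := hD
  obtain ⟨p, q, rfl, rfl, ⟨d, hd, X, h1, h2, h3⟩, ⟨δ₀, h₀, μ, hμ, ⟨g, hg⟩, hτ⟩⟩ := h
  rw [hθ] at h3
  refine ⟨p, rfl, (isOfType_iff h3).mpr
    (isSecond_of_corresponds hD hz hd (EGroup.eq_of_langlands h1)), δ₀, h₀, texp2 (ratVec μ),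
    ⟨μ, rfl, q.ratChar_eq_one hK hτ⟩, ?_⟩
  have h4 : p.δ ^ 2 = (S.inl g * p.δ * (S.inl g)⁻¹) ^ 2 := by
    rw [conj_pow, Subgroup.mem_center_iff.mp p.strong.2.1, mul_inv_cancel_right]
  rw [h4, hg, texp_pi, ExtendedGroup.form_sq h₀ hμ,
    Subgroup.mem_center_iff.mp (S.W_strong h₀).2.1]

/-! ### Equivariance -/

/-- The witness `(d, X, δ₀, μ)` is carried to `(∨ϑ^Γ d, M' X, (ϑ^Γ)⁻¹ δ₀, M⁻¹ μ)`, where `M` and `M'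
= Mᵀ` are the two matrices. The conditions persist because `M` commutes with `a` and pairings are
moved by transposition. -/
theorem LLC_act {f : S.Aut} {f' : D.Aut} (hD : D.IsFor S) (hf : Compatible f f')
    (hK : f'.Stabilizes K) {P : S.RepClass} {x : D.Xi K} (h : LLC S D P x) :
    LLC S D (f.actPi P) (f'.actXi hK x) := by
  have hθ : D.θ = S.aᵀ := hD
  have hM : f'.M.1 = f.M.1ᵀ := hf
  have hMM : f.M⁻¹.1 * f.M.1 = 1 := by
    rw [← Units.val_mul, inv_mul_cancel, Units.val_one]
  have hMM' : f.M.1 * f.M⁻¹.1 = 1 := by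
    rw [← Units.val_mul, mul_inv_cancel, Units.val_one]
  have hMM'' : f'.M.1 * f'.M⁻¹.1 = 1 := by
    rw [← Units.val_mul, mul_inv_cancel, Units.val_one]
  have hMinv : f'.M⁻¹.1ᵀ = f.M⁻¹.1 := by
    have h1 : f'.M⁻¹.1ᵀ * f.M.1 = 1 := by
      have := congrArg Matrix.transpose hMM''
      rwa [Matrix.transpose_mul, Matrix.transpose_one, hM, Matrix.transpose_transpose] at this
    calc f'.M⁻¹.1ᵀ = f'.M⁻¹.1ᵀ * (f.M.1 * f.M⁻¹.1) := by rw [hMM', mul_one]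
      _ = f.M⁻¹.1 := by rw [← mul_assoc, h1, one_mul]
  have hc : S.aᵀ * f'.M.1 = f'.M.1 * S.aᵀ := by
    rw [hM, ← Matrix.transpose_mul, ← Matrix.transpose_mul, f.commute]
  have hcinv : S.a * f.M⁻¹.1 = f.M⁻¹.1 * S.a := by
    calc S.a * f.M⁻¹.1 = f.M⁻¹.1 * (f.M.1 * S.a) * f.M⁻¹.1 := by
          rw [← mul_assoc, hMM, one_mul]
      _ = f.M⁻¹.1 * S.a := by rw [f.commute, mul_assoc, mul_assoc, hMM', mul_one]
  obtain ⟨p, q, rfl, rfl, ⟨d, hd, X, h1, h2, h3⟩, ⟨δ₀, h₀, μ, hμ, ⟨g, hg⟩, hτ⟩⟩ := h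
  have hd' : f'.toEquiv d ∈ D.D := by
    rw [← f'.image_D]
    exact Set.mem_image_of_mem _ hd
  have h₀' : f.toEquiv.symm δ₀ ∈ S.W := by
    have h4 := h₀
    rw [← f.image_W] at h4
    obtain ⟨δ₁, h5, rfl⟩ := h4
    rwa [MulEquiv.symm_apply_apply]
  refine ⟨f.actRep p, f'.actParam hK q, rfl, rfl, ⟨f'.toEquiv d, hd', act f'.M.1 X, ?_, ?_, ?_⟩,
    ⟨f.toEquiv.symm δ₀, h₀', (f.M⁻¹.1.map (Int.cast : ℤ → ℚ)) *ᵥ μ, ?_,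
      ⟨powMap f.M⁻¹.1 g, ?_⟩, ?_⟩⟩
  · have h4 := congrArg f'.toEquiv h1
    rw [map_mul, map_mul, f'.restrict, f'.restrict, texp_neg_pi, ← texp2_act, ← texp2_act, act_neg,
      act_smul, ← texp_neg_pi] at h4
    exact h4
  · intro v hv s
    have hlift : ∀ s : ℝ, canLift f.commute (toPro (canLattices S.a) (s • v))
        = toPro (canLattices S.a) (s • act f.M.1 v) := by
      intro s
      rw [real_smul_vec, real_smul_vec, ← act_smul]
      rfl
    have hm : ∀ s : ℝ, toPro (canLattices S.a) (s • act f.M.1 v) ∈ S.realCan p.δ := by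
      intro s
      have h5 := f.lift_mem p.strong.1 (hv s)
      rwa [hlift] at h5
    have h5 := h2 (act f.M.1 v) hm s
    have h6 : (f.actRep p).π ⟨toPro (canLattices S.a) (s • v), hv s⟩
        = p.π ⟨toPro (canLattices S.a) (s • act f.M.1 v), hm s⟩ := by
      change p.π ⟨canLift f.commute (toPro (canLattices S.a) (s • v)), _⟩ = _
      congr 1
      exact Subtype.ext (hlift s)
    rw [h6, h5, ExtendedGroup.exp_eq_cexp2, ExtendedGroup.exp_eq_cexp2, dotProduct_act, ← hM]
    rfl
  · intro v hv
    have hre : (fun i => (((f.M.1.map (Int.cast : ℤ → ℝ)) *ᵥ v) i : ℂ))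
        = act f.M.1 (fun i => (v i : ℂ)) := by
      ext i
      simp [act, Matrix.mulVec, dotProduct]
    have h5 := f.lift_mem p.strong.1 hv
    have h6 : canLift f.commute (toPro (canLattices S.a) fun i => (v i : ℂ))
        = toPro (canLattices S.a) (fun i => (((f.M.1.map (Int.cast : ℤ → ℝ)) *ᵥ v) i : ℂ)) := by
      rw [hre]
      rfl
    have h7 := h5
    rw [h6] at h7
    have h8 := h3 _ h7
    have h9 : (f.actRep p).π ⟨_, hv⟩ = p.π ⟨_, h7⟩ := by
      change p.π ⟨canLift f.commute (toPro (canLattices S.a) fun i => (v i : ℂ)), _⟩ = _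
      congr 1
      exact Subtype.ext h6
    rw [h9, h8, hre, dotProduct_act, ← hM]
    congr 3
    change _ = (1 / 2 : ℂ) • (act f'.M.1 q.lam - act D.θ (act f'.M.1 q.lam))
      - (act f'.M.1 X + act D.θ (act f'.M.1 X))
    simp only [hθ, act_act, hc, act_sub, act_add, act_smul]
  · rw [ratVec_act, act_act, hcinv, ← act_act]
    nth_rewrite 2 [← hμ]
    rw [act_neg]
  · change S.inl _ * f.toEquiv.symm p.δ * _ = _
    apply f.toEquiv.injective
    rw [map_mul, map_mul, map_mul, map_inv, f.restrict, f.restrict, powMap_powMap, hMM', powMap_one,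
      MulEquiv.apply_symm_apply, MulEquiv.apply_symm_apply, hg, texp_pi, texp_pi, ← texp2_act,
      act_smul, ratVec_act, act_act, hMM', act_one]
  · intro x hx
    have h4 := hτ (algLift f'.M⁻¹.1 x) (f'.lift_inv_isotropy _ hx)
    rw [ratChar_algLift _ (d := (f.M⁻¹.1.map (Int.cast : ℤ → ℚ)) *ᵥ μ)
      (by rw [ratVec_act, hMinv])] at h4
    exact h4

end RealTori

/-! ### Assembly of the equivariant bijection -/

theorem mainTheorem2 {n : ℕ} {E E' : Type*} [Group E] [Group E']
    (S : RealTori.ExtendedGroup n E) (D : RealTori.EGroup n E') (hD : D.IsFor S)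
    (z : RealTori.Torus n) (hz : D.IsSecondInvariant z)
    (f : S.Aut) (f' : D.Aut) (hf : RealTori.Compatible f f')
    (K : AddSubgroup (RealTori.AlgCover n)) (hKclosed : IsClosed (K : Set (RealTori.AlgCover n)))
    (hKpi : K ≤ RealTori.algPi1 n) (hK : f'.Stabilizes K) :
    ∃ Φ : S.repSet z K ≃ D.Xi K,
      (∀ (P : S.repSet z K) (x : D.Xi K), Φ P = x ↔ RealTori.LLC S D P.1 x) ∧
      ∀ P : S.repSet z K, ∃ h : f.actPi P.1 ∈ S.repSet z K,
        Φ ⟨f.actPi P.1, h⟩ = f'.actXi hK (Φ P) := by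
  have huniq : ∀ (P : S.RepClass) (x x' : D.Xi K), RealTori.LLC S D P x →
      RealTori.LLC S D P x' → x = x' := by
    intro P x x' h h'
    induction P using Quotient.inductionOn with
    | h p =>
      induction x using Quotient.inductionOn with
      | h q =>
        induction x' using Quotient.inductionOn with
        | h q' =>
          obtain ⟨h1, h2⟩ := RealTori.LLC_mk_iff.mp h
          obtain ⟨h1', h2'⟩ := RealTori.LLC_mk_iff.mp h'
          exact Quotient.sound (RealTori.param_unique hD h1 h2 h1' h2')
  have huniq' : ∀ (P P' : S.RepClass) (x : D.Xi K), RealTori.LLC S D P x →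
      RealTori.LLC S D P' x → P = P' := by
    intro P P' x h h'
    induction P using Quotient.inductionOn with
    | h p =>
      induction P' using Quotient.inductionOn with
      | h p' =>
        induction x using Quotient.inductionOn with
        | h q =>
          obtain ⟨h1, h2⟩ := RealTori.LLC_mk_iff.mp h
          obtain ⟨h1', h2'⟩ := RealTori.LLC_mk_iff.mp h'
          exact Quotient.sound (RealTori.rep_unique hD h1 h2 h1' h2')
  choose F hF using fun P : S.repSet z K => RealTori.exists_param hD hz hKpi P.2
  have hbij : Function.Bijective F := by
    refine ⟨fun P P' h => Subtype.ext (huniq' _ _ (F P) (hF P) (h ▸ hF P')), fun x => ?_⟩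
    obtain ⟨P, hP⟩ := RealTori.exists_rep (S := S) hD hz x
    have hmem := RealTori.mem_repSet hD hz hKpi hP
    exact ⟨⟨P, hmem⟩, huniq _ _ _ (hF _) hP⟩
  refine ⟨Equiv.ofBijective F hbij, fun P x => ⟨fun h => h ▸ hF P, fun h => huniq _ _ _ (hF P) h⟩,
    fun P => ?_⟩
  -- The relation determines the map, so its invariance gives both stability of the domain and
  -- equivariance.
  have hact := RealTori.LLC_act hD hf hK (hF P)
  exact ⟨RealTori.mem_repSet hD hz hKpi hact, huniq _ _ _ (hF _) hact⟩
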